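/- Let $\mathrm{Diff}(\mathbb C,0)$ be the group, under composition, of germs at $0$ of holomorphic diffeomorphisms of $\mathbb C$ fixing $0$, with the analytic topology, given by the distance $d_A(h,h')=\sup_{k\ge 1}|c_k|^{1/k}$, where $\sum_{k\ge1}c_kz^k$ is the Taylor series of $h-h'$ at $0$. For $\alpha\in\mathbb N$ let $\mathrm{Diff}_\alpha(\mathbb C,0)$ be the subgroup of germs $z+O(z^{\alpha+1})$ (all of $\mathrm{Diff}(\mathbb C,0)$ if $\alpha=0$), with the induced topology. A germ $f$ has a Cremer point at $0$ if $|f'(0)|=1$, $f'(0)$ is not a root of unity, and $f$ is not conjugate in $\mathrm{Diff}(\mathbb C,0)$ to $z\mapsto f'(0)z$. Let $f,g\in\mathrm{Diff}(\mathbb C,0)$ have orders $\mathsf r,\mathsf s\in\mathbb N^*\cup\{\infty\}$. A reduced word is $W(a,b)=\vartheta_l^{r_l}*\cdots*\vartheta_1^{r_1}$ where the letters $\vartheta_i\in\{a,b\}$ alternate, and $r_i\in\{1,\dots,\mathsf r-1\}$ (any $r_i\in\mathbb Z\setminus\{0\}$ if $\mathsf r=\infty$) when $\vartheta_i=a$,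 and likewise with $\mathsf s$ when $\vartheta_i=b$. For $h_1,h_2\in\mathrm{Diff}(\mathbb C,0)$ put $\tilde f=h_1^{-1}\circ f\circ h_1$, $\tilde g=h_2^{-1}\circ g\circ h_2$. Domains of definition. For each germ $h\in\{h_1^{\pm1},h_2^{\pm1}\}$ let $\rho\in(0,\infty]$ be the radius of the maximal open disc about $0$ on which $h$ is defined and one-to-one; the open domain of $h$ is the open disc about $0$ of radius $9\rho/10$. Let $D$ be an open disc about $0$ whose closure lies in a larger open disc about $0$ on which $f^{\pm1},g^{\pm1}$ are defined and one-to-one. The domain of $\tilde f^{\pm1}$ is the set of $p$ in the open domain of $h_1$ such that $h_1(p)\in D$ and $f^{\pm1}(h_1(p))$ is in the open domain of $h_1^{-1}$; similarly for $\tilde g^{\pm1}$. Spell $W(\tilde f,\tilde g)=H_s\circ\cdots\circ H_1$ with $H_i\in\{\tilde f^{\pm1},\tilde g^{\pm1}\}$ and $s=\sum_i|r_i|$. Its domain $\mathrm{Dom}_W(D)$ is the set of $z$ such that, for $i=1,\dots,s$, the point $H_{i-1}\circ\cdots\circ H_1(z)$ lies in $D$ and in the domain of $H_i$. The closed domain of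 definition is $\mathrm{Dom}_W(\overline D)=\overline{\mathrm{Dom}_W(D)}$, to which $W(\tilde f,\tilde g)$ extends holomorphically (by the same composition). **Proposition.** Let $f,g\in\mathrm{Diff}(\mathbb C,0)$ have no Cremer point at $0$. There is $R_0>0$, depending only on $f$ and $g$, such that $f,f^{-1},g,g^{-1}$ are defined and one-to-one on the disc of radius $R_0$ about $0$ and the following holds for every disc $D=\{|z|<R\}$ with $0<R<R_0$. For every $\alpha\in\mathbb N$ and every nonempty reduced word $W(a,b)$, there is an open and dense set $\mathfrak U_W\subset\mathrm{Diff}_\alpha(\mathbb C,0)\times\mathrm{Diff}_\alpha(\mathbb C,0)$ such that, whenever $(h_1,h_2)\in\mathfrak U_W$, the element $W(\tilde f,\tilde g)=W(h_1^{-1}\circ f\circ h_1,\,h_2^{-1}\circ g\circ h_2)$ has only finitely many fixed points in its closed domain of definition $\mathrm{Dom}_W(\overline D)$. -/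

import Mathlib

open Filter Topology Set
open scoped ENNReal

noncomputable section

/-! ### The group of germs of local holomorphic diffeomorphisms fixing the origin -/

/-- A function representing a germ of holomorphic diffeomorphism of `ℂ` fixing `0`
(only its values near `0` are meaningful). -/
structure LocalDiffeo where
  toFun : ℂ → ℂ
  analyticAt : AnalyticAt ℂ toFun 0
  map_zero : toFun 0 = 0
  deriv_ne_zero : deriv toFun 0 ≠ 0

namespace LocalDiffeo

instance setoid : Setoid LocalDiffeo where
  r u v := u.toFun =ᶠ[𝓝 0] v.toFun
  iseqv := ⟨fun _ => EventuallyEq.rfl, fun h => h.symm, fun h h' => h.trans h'⟩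

/-- The identity. -/
def refl : LocalDiffeo := ⟨id, analyticAt_id, rfl, by simp⟩

theorem tendsto_zero (u : LocalDiffeo) : Tendsto u.toFun (𝓝 0) (𝓝 0) := by
  have h := u.analyticAt.continuousAt.tendsto
  rwa [u.map_zero] at h

/-- The composition `u ∘ v`. -/
def comp (u v : LocalDiffeo) : LocalDiffeo where
  toFun := u.toFun ∘ v.toFun
  analyticAt := AnalyticAt.comp (by rw [v.map_zero]; exact u.analyticAt) v.analyticAt
  map_zero := by simp [v.map_zero, u.map_zero]
  deriv_ne_zero := by
    have h : DifferentiableAt ℂ u.toFun (v.toFun 0) := by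
      rw [v.map_zero]; exact u.analyticAt.differentiableAt
    rw [deriv_comp _ h v.analyticAt.differentiableAt, v.map_zero]
    exact mul_ne_zero u.deriv_ne_zero v.deriv_ne_zero

/-- A local inverse. -/
def symm (u : LocalDiffeo) : LocalDiffeo where
  toFun := u.analyticAt.hasStrictDerivAt.localInverse _ _ _ u.deriv_ne_zero
  analyticAt := by
    have h := u.analyticAt.analyticAt_localInverse u.deriv_ne_zero
    rwa [u.map_zero] at h
  map_zero := by
    have h : u.analyticAt.hasStrictDerivAt.localInverse _ _ _ u.deriv_ne_zero (u.toFun 0) = 0 :=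
      HasStrictFDerivAt.localInverse_apply_image ..
    rwa [u.map_zero] at h
  deriv_ne_zero := by
    have h := (u.analyticAt.hasStrictDerivAt.to_localInverse u.deriv_ne_zero).hasDerivAt
    rw [u.map_zero] at h
    rw [h.deriv]
    exact inv_ne_zero u.deriv_ne_zero

theorem symm_comp_equiv (u : LocalDiffeo) : u.symm.comp u ≈ refl := by
  change ∀ᶠ x in 𝓝 0, u.symm.toFun (u.toFun x) = x
  exact HasStrictDerivAt.eventually_left_inverse u.analyticAt.hasStrictDerivAt u.deriv_ne_zero

theorem comp_equiv {u u' v v' : LocalDiffeo} (h : u ≈ u') (h' : v ≈ v') :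
    u.comp v ≈ u'.comp v' := by
  have h₁ : u.toFun =ᶠ[𝓝 0] u'.toFun := h
  have h₂ : v.toFun =ᶠ[𝓝 0] v'.toFun := h'
  change u.toFun ∘ v.toFun =ᶠ[𝓝 0] u'.toFun ∘ v'.toFun
  filter_upwards [h₂, v.tendsto_zero.eventually h₁] with x hx hx'
  simp only [Function.comp_apply]
  rw [hx', hx]

end LocalDiffeo

/-- `Diff(ℂ, 0)`: germs at `0` of holomorphic diffeomorphisms fixing `0`. -/
def DiffGerm : Type := Quotient LocalDiffeo.setoid

namespace DiffGerm

/-- The germ at `0` of a representative. -/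
abbrev mk (u : LocalDiffeo) : DiffGerm := Quotient.mk LocalDiffeo.setoid u

/-- The group structure of `Diff(ℂ, 0)`: the product is the composition of germs. -/
instance : Mul DiffGerm :=
  ⟨Quotient.map₂ LocalDiffeo.comp fun _ _ h _ _ h' => LocalDiffeo.comp_equiv h h'⟩

instance : One DiffGerm := ⟨mk LocalDiffeo.refl⟩

instance : Inv DiffGerm := ⟨fun h => mk (Quotient.out h).symm⟩

instance : Group DiffGerm :=
  Group.ofLeftAxioms
    (by
      intro a b c
      induction a using Quotient.inductionOn
      induction b using Quotient.inductionOn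
      induction c using Quotient.inductionOn
      rfl)
    (by
      intro a
      induction a using Quotient.inductionOn
      rfl)
    (by
      intro a
      have h : mk (Quotient.out a) = a :=
        Quotient.out_eq a
      have h' : a⁻¹ * mk (Quotient.out a) = 1 :=
        Quotient.sound (LocalDiffeo.symm_comp_equiv _)
      rwa [h] at h')

/-- `h.IsGermOf F`: the function `F` is a representative of the germ `h` at `0`. -/
def IsGermOf (h : DiffGerm) (F : ℂ → ℂ) : Prop :=
  ∃ u : LocalDiffeo, mk u = h ∧ F =ᶠ[𝓝 0] u.toFun

/-- The `k`-th Taylor coefficient at `0`. -/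
def coeff (h : DiffGerm) (k : ℕ) : ℂ :=
  Quotient.lift (fun u : LocalDiffeo => iteratedDeriv k u.toFun 0 / (k.factorial : ℂ))
    (fun u v (e : u.toFun =ᶠ[𝓝 0] v.toFun) => by
      rw [e.iteratedDeriv_eq k]) h

theorem coeff_zero (h : DiffGerm) : h.coeff 0 = 0 := by
  induction h using Quotient.inductionOn with
  | h u =>
    change iteratedDeriv 0 u.toFun 0 / _ = 0
    simp [u.map_zero]

theorem coeff_one_ne_zero (h : DiffGerm) : h.coeff 1 ≠ 0 := by
  induction h using Quotient.inductionOn with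
  | h u =>
    change iteratedDeriv 1 u.toFun 0 / _ ≠ 0
    simpa [iteratedDeriv_one] using u.deriv_ne_zero

theorem hasFPowerSeriesAt (u : LocalDiffeo) :
    HasFPowerSeriesAt u.toFun
      (FormalMultilinearSeries.ofScalars ℂ (coeff (mk u))) 0 :=
  u.analyticAt.hasFPowerSeriesAt

theorem coeff_injective {h h' : DiffGerm} (e : ∀ k, h.coeff k = h'.coeff k) : h = h' := by
  induction h using Quotient.inductionOn with
  | h u =>
  induction h' using Quotient.inductionOn with
  | h v =>
    have h₁ := hasFPowerSeriesAt u
    have h₂ := hasFPowerSeriesAt v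
    rw [funext e] at h₁
    refine Quotient.sound (show u.toFun =ᶠ[𝓝 0] v.toFun from ?_)
    have h₃ := h₁.sub h₂
    rw [sub_self] at h₃
    filter_upwards [h₃.eventually_eq_zero] with x hx
    exact sub_eq_zero.1 hx

theorem exists_coeff_bound (h : DiffGerm) :
    ∃ C r : ℝ, 0 < C ∧ 0 < r ∧ ∀ k, ‖h.coeff k‖ ≤ C * r ^ k := by
  induction h using Quotient.inductionOn with
  | h u =>
    obtain ⟨C, r, hC, hr, hb⟩ :=
      FormalMultilinearSeries.le_mul_pow_of_radius_pos _ (hasFPowerSeriesAt u).radius_pos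
    refine ⟨C, r, hC, hr, fun k => ?_⟩
    simpa [FormalMultilinearSeries.ofScalars_norm] using hb k

/-- The quantities `|c_k|^{1/k}`, `k = n + 1 ≥ 1`, where `c_k` are the Taylor coefficients
of `h - h'`. -/
def distTerm (h h' : DiffGerm) (n : ℕ) : ℝ :=
  ‖h.coeff (n + 1) - h'.coeff (n + 1)‖ ^ ((1 : ℝ) / ((n : ℝ) + 1))

theorem distTerm_nonneg (h h' : DiffGerm) (n : ℕ) : 0 ≤ distTerm h h' n :=
  Real.rpow_nonneg (norm_nonneg _) _

theorem distTerm_bddAbove (h h' : DiffGerm) : BddAbove (range (distTerm h h')) := by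
  obtain ⟨C, r, hC, hr, hb⟩ := h.exists_coeff_bound
  obtain ⟨C', r', hC', hr', hb'⟩ := h'.exists_coeff_bound
  have key : ∀ n : ℕ, ‖h.coeff (n + 1) - h'.coeff (n + 1)‖ ≤
      ((1 + C + C') * (r + r')) ^ (n + 1) := by
    intro n
    have h₁ : r ^ (n + 1) ≤ (r + r') ^ (n + 1) := by gcongr; linarith
    have h₂ : r' ^ (n + 1) ≤ (r + r') ^ (n + 1) := by gcongr; linarith
    have h₃ : (1 + C + C') ≤ (1 + C + C') ^ (n + 1) :=
      le_self_pow₀ (by linarith) (Nat.succ_ne_zero n)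
    calc ‖h.coeff (n + 1) - h'.coeff (n + 1)‖
        ≤ ‖h.coeff (n + 1)‖ + ‖h'.coeff (n + 1)‖ := norm_sub_le _ _
      _ ≤ C * r ^ (n + 1) + C' * r' ^ (n + 1) := add_le_add (hb _) (hb' _)
      _ ≤ C * (r + r') ^ (n + 1) + C' * (r + r') ^ (n + 1) := by gcongr
      _ ≤ (1 + C + C') * (r + r') ^ (n + 1) := by
          have : 0 ≤ (r + r') ^ (n + 1) := by positivity
          nlinarith
      _ ≤ (1 + C + C') ^ (n + 1) * (r + r') ^ (n + 1) := by gcongr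
      _ = _ := (mul_pow _ _ _).symm
  refine ⟨(1 + C + C') * (r + r'), ?_⟩
  rintro _ ⟨n, rfl⟩
  have hp : (0 : ℝ) ≤ (1 + C + C') * (r + r') := by positivity
  calc distTerm h h' n
      ≤ (((1 + C + C') * (r + r')) ^ (n + 1)) ^ ((1 : ℝ) / ((n : ℝ) + 1)) :=
        Real.rpow_le_rpow (norm_nonneg _) (key n) (by positivity)
    _ = (1 + C + C') * (r + r') := by
        have := Real.pow_rpow_inv_natCast hp (Nat.succ_ne_zero n)
        simpa [one_div] using this

/-- The analytic topology, given by the distance `sup_{k ≥ 1} |c_k|^{1/k}`. -/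
instance : MetricSpace DiffGerm where
  dist h h' := ⨆ n, distTerm h h' n
  dist_self h := by
    have : ∀ n, distTerm h h n = 0 := fun n => by
      have : (1 : ℝ) / ((n : ℝ) + 1) ≠ 0 := by positivity
      simp only [distTerm, sub_self, norm_zero]
      exact Real.zero_rpow this
    simp [this]
  dist_comm h h' := by simp only [distTerm, norm_sub_rev]
  dist_triangle h h' h'' := by
    refine ciSup_le fun n => ?_
    have h₁ := le_ciSup (distTerm_bddAbove h h') n
    have h₂ := le_ciSup (distTerm_bddAbove h' h'') n
    refine le_trans ?_ (add_le_add h₁ h₂)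
    have hq : (1 : ℝ) / ((n : ℝ) + 1) ≤ 1 := by
      rw [div_le_one (by positivity)]
      linarith [(Nat.cast_nonneg n : (0 : ℝ) ≤ n)]
    calc distTerm h h'' n
        ≤ (‖h.coeff (n + 1) - h'.coeff (n + 1)‖ + ‖h'.coeff (n + 1) - h''.coeff (n + 1)‖) ^
            ((1 : ℝ) / ((n : ℝ) + 1)) :=
          Real.rpow_le_rpow (norm_nonneg _) (norm_sub_le_norm_sub_add_norm_sub _ _ _)
            (by positivity)
      _ ≤ _ := Real.rpow_add_le_add_rpow (norm_nonneg _) (norm_nonneg _) (by positivity) hq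
  eq_of_dist_eq_zero {h h'} e := by
    refine coeff_injective fun k => ?_
    cases k with
    | zero => rw [coeff_zero, coeff_zero]
    | succ n =>
      have h₁ : distTerm h h' n ≤ 0 := (le_ciSup (distTerm_bddAbove h h') n).trans e.le
      have h₂ : distTerm h h' n = 0 := le_antisymm h₁ (distTerm_nonneg _ _ _)
      have h₃ := (Real.rpow_eq_zero (norm_nonneg _) (by positivity)).1 h₂
      exact sub_eq_zero.1 (norm_eq_zero.1 h₃)

/-- `Diff_α(ℂ, 0)`: the germs `z + O(z^{α+1})` tangent to the identity to order `α`;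
all of `Diff(ℂ, 0)` if `α = 0`. -/
def tangentToId (α : ℕ) : Set DiffGerm :=
  {h | ∀ k, 1 ≤ k → k ≤ α → h.coeff k = (1 : DiffGerm).coeff k}

/-- The derivative at the fixed point `0`. -/
def multiplier (h : DiffGerm) : ℂˣ := Units.mk0 (h.coeff 1) h.coeff_one_ne_zero

/-- The germ of `z ↦ c z`. -/
def linear (c : ℂˣ) : DiffGerm :=
  mk
    { toFun := fun z => c * z
      analyticAt := by fun_prop
      map_zero := by simp
      deriv_ne_zero := by simp }

/-- Conjugate to its linear part by a germ of holomorphic change of coordinates. -/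
def IsLinearizable (f : DiffGerm) : Prop :=
  ∃ h : DiffGerm, h * f * h⁻¹ = linear f.multiplier

/-- `0` is a Cremer point of `f`. -/
def HasCremerPoint (f : DiffGerm) : Prop :=
  ‖(f.multiplier : ℂ)‖ = 1 ∧ (∀ n : ℕ, 0 < n → f.multiplier ^ n ≠ 1) ∧ ¬ f.IsLinearizable

/-! ### Domains of definition -/

/-- The germ `h` is defined and one-to-one on the open disc of radius `r` about `0`. -/
def UnivalentOn (h : DiffGerm) (r : ℝ) : Prop :=
  ∃ F : ℂ → ℂ, h.IsGermOf F ∧ DifferentiableOn ℂ F (Metric.ball 0 r) ∧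
    InjOn F (Metric.ball 0 r)

/-- The radius `ρ ∈ (0, ∞]` of the maximal open disc about `0` on which `h` is defined
and one-to-one. -/
def univalenceRadius (h : DiffGerm) : ℝ≥0∞ :=
  ⨆ (r : ℝ) (_ : h.UnivalentOn r), ENNReal.ofReal r

/-- The open domain of definition of `h`: the open disc about `0` of radius `9ρ/10`. -/
def openDom (h : DiffGerm) : Set ℂ :=
  {z | ENNReal.ofReal ‖z‖ < 9 / 10 * h.univalenceRadius}

/-- The value at `z` of the Taylor series of `h`, that is, of the holomorphic extension of the
germ `h` to any open disc about `0` that contains `z` (if there is such an extension). -/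
def eval (h : DiffGerm) (z : ℂ) : ℂ := ∑' k : ℕ, h.coeff k * z ^ k

/-- The map `h⁻¹ ∘ F ∘ h`. -/
def conjMap (F h : DiffGerm) (z : ℂ) : ℂ := h⁻¹.eval (F.eval (h.eval z))

/-- The domain of definition of `h⁻¹ ∘ F ∘ h`, where `F` has domain of definition `D`. -/
def conjDom (D : Set ℂ) (F h : DiffGerm) : Set ℂ :=
  {z | z ∈ h.openDom ∧ h.eval z ∈ D ∧ F.eval (h.eval z) ∈ h⁻¹.openDom}

end DiffGerm

/-! ### Reduced words and the pseudogroup -/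

/-- The two letters of a word. -/
inductive Letter
  | a
  | b

/-- A word `ϑ_l^{r_l} ∗ ⋯ ∗ ϑ_1^{r_1}`, listed from left to right. -/
abbrev Word : Type := List (Letter × ℤ)

/-- The exponents allowed for a letter of order `n` (`n = 0` stands for infinite order):
`1, …, n - 1` if the order is finite, and all nonzero integers otherwise. -/
def IsReducedExponent (n : ℕ) (r : ℤ) : Prop :=
  if n = 0 then r ≠ 0 else 1 ≤ r ∧ r < n

/-- The word is reduced, where `a` has the order of the germ `f` and `b` that of `g`. -/
def Word.IsReduced (f g : DiffGerm) (W : Word) : Prop :=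
  W.IsChain (fun p q => p.1 ≠ q.1) ∧
    ∀ p ∈ W, match p.1 with
      | .a => IsReducedExponent (orderOf f) p.2
      | .b => IsReducedExponent (orderOf g) p.2

/-- The spelling `θ_s ∗ ⋯ ∗ θ_1` of a word: each `ϑ^r` is split into `|r|` copies of
`ϑ` (marked `true`) or of `ϑ⁻¹` (marked `false`), according to the sign of `r`. -/
def Word.spelling (W : Word) : List (Letter × Bool) :=
  W.flatMap fun p => List.replicate p.2.natAbs (p.1, decide (0 < p.2))

/-- The germ `f^{±1}` or `g^{±1}` substituted for the letter `θ`. -/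
def baseGerm (f g : DiffGerm) : Letter × Bool → DiffGerm
  | (.a, true) => f
  | (.a, false) => f⁻¹
  | (.b, true) => g
  | (.b, false) => g⁻¹

/-- The conjugating germ attached to the letter `θ`: `h₁` for `a^{±1}`, `h₂` for `b^{±1}`. -/
def conjGerm (h₁ h₂ : DiffGerm) : Letter × Bool → DiffGerm
  | (.a, _) => h₁
  | (.b, _) => h₂

/-- The map `H_s ∘ ⋯ ∘ H_1`, where each `H_i` is one of `f̃^{±1} = h₁⁻¹ ∘ f^{±1} ∘ h₁` and
`g̃^{±1} = h₂⁻¹ ∘ g^{±1} ∘ h₂`. -/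
def spellingMap (f g h₁ h₂ : DiffGerm) : List (Letter × Bool) → ℂ → ℂ
  | [], z => z
  | θ :: L, z =>
      DiffGerm.conjMap (baseGerm f g θ) (conjGerm h₁ h₂ θ) (spellingMap f g h₁ h₂ L z)

/-- The domain of definition of `H_s ∘ ⋯ ∘ H_1` as an element of the pseudogroup generated by
`f̃`, `g̃` on `D`: the points `z` such that for each `i` the point `H_{i-1} ∘ ⋯ ∘ H_1 (z)` lies
in `D` and in the domain of definition of `H_i`. -/
def spellingDom (D : Set ℂ) (f g h₁ h₂ : DiffGerm) : List (Letter × Bool) → Set ℂ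
  | [] => D
  | θ :: L => {z | z ∈ spellingDom D f g h₁ h₂ L ∧ spellingMap f g h₁ h₂ L z ∈ D ∧
      spellingMap f g h₁ h₂ L z ∈
        DiffGerm.conjDom D (baseGerm f g θ) (conjGerm h₁ h₂ θ)}

/-- The closed domain of definition of `W(f̃, g̃)`: the closure of the open one. -/
def wordClosedDom (D : Set ℂ) (f g h₁ h₂ : DiffGerm) (W : Word) : Set ℂ :=
  closure (spellingDom D f g h₁ h₂ W.spelling)

/-- The fixed points of `W(f̃, g̃)` in its closed domain of definition. On the closed domain
the points met along the spelling stay in the closed discs on which the Taylor series of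
`h₁^{±1}`, `h₂^{±1}`, `f^{±1}`, `g^{±1}` converge, so `spellingMap` is the holomorphic
extension of `W(f̃, g̃)`. -/
def wordFixedPoints (D : Set ℂ) (f g h₁ h₂ : DiffGerm) (W : Word) : Set ℂ :=
  {z | z ∈ wordClosedDom D f g h₁ h₂ W ∧ spellingMap f g h₁ h₂ W.spelling z = z}

end

/-!
# Finitely many fixed points for generic words in two conjugated germs

The word `W(f̃, g̃)` is an analytic family of injective maps, parametrized by the pair `(h₁, h₂)`.
There are two things to show: that for generic parameters it is not the identity near any point of
its domain, and that the closure of its domain is still contained in an open set on which it is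
holomorphic, in a way that is uniform for nearby parameters. Then a compactness argument
(`UnivalenceFrame.exists_open_finite_fixedPoints`) gives finiteness: the closed domain is covered
by finitely many discs on which the word is holomorphic, it differs from the identity on each of
them, and this persists for nearby parameters.

*Domains.* The radius of univalence is only lower semicontinuous in the germ, but by
`DiffGerm.exists_uniform_radius` it is almost constant on some open subset of any open set of
parameters. This leaves room between the factor `9 / 10` of the statement, the factor `0.905` of
the closed domains and the factor `0.91` of the open domains of a `UnivalenceFrame`.

*Words with a change of letter.* If `W` fixes the initial point of an orbit whose points are
otherwise distinct, add to the conjugating germ of one of the two letters a small multiple of a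
polynomial that vanishes, to high order at `0`, at all points of the orbit except the one at which
the letter changes. The orbit is unchanged up to that point, moves there, and never meets the old
orbit again, because all maps are injective (`UnivalenceFrame.exists_ne_of_switch`). That the points
of the orbit are generically distinct follows by induction on the length, from the same statement
for shorter words (`UnivalenceFrame.exists_spellingMap_ne`).

*Powers of a letter.* Such a word should be conjugate to a power of `f^{±1}` or `g^{±1}`, which has
no fixed point near `0` except `0` unless it is the identity
(`DiffGerm.exists_radius_no_periodic`); this is where Cremer points are excluded, and it determines
the radius `R₀`. But `h₁ ∘ h₁⁻¹`, evaluated with the two germs on their own discs of univalence,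
need not be the identity on the whole domain of the composition: two discs on which a germ and its
inverse are univalent may overlap in a set that is not connected. That this does not happen on discs
smaller by the factor `0.91` is `comp_eq_of_univalent`. At a nearest point of failure, one
could move so as to decrease both `|y|` and `|k(y)|`, where `k` is the univalent inverse, unless
`y k'(y) / k(y)` is a negative real number; and `mul_deriv_ne_of_univalent` excludes that.

*The argument estimate.* The last fact is a form of the sharp bound
`|arg (z k'(z) / k(z))| ≤ log ((1 + |z|) / (1 - |z|))` for univalent functions, together with
`log (1.91 / 0.09) < π`. The proof uses the square root transform `F` of `k`. For a point `a`, the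
function `N = (F - F(a)) / (F + F(a))` on the right half of the disc is univalent, and the product
of two of its values is never `1`. Thus the images of `N` and `1 / N` are disjoint, their
logarithmic areas add up, and this bounds a Dirichlet integral from above
(`integral_annulus_norm_deriv_sq_le`, `lintegral_halfDisc_le`).
The reproducing kernel of the Dirichlet space bounds it from below (`norm_sq_le_of_energy_le`),
and the comparison is the argument estimate.
-/

noncomputable section

/-! ### Area integrals and circle averages -/

open MeasureTheory Real in
theorem setIntegral_annulus_eq_circleAverage {φ : ℂ → ℝ} {δ ρ : ℝ} (hδ : 0 ≤ δ) (hδρ : δ ≤ ρ)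
    (hφ : ContinuousOn φ {z | δ ≤ ‖z‖ ∧ ‖z‖ ≤ ρ}) :
    ∫ z in {z : ℂ | δ < ‖z‖ ∧ ‖z‖ < ρ}, φ z =
      ∫ r in δ..ρ, r * (2 * π * circleAverage φ 0 r) := by
  have hA : MeasurableSet {z : ℂ | δ < ‖z‖ ∧ ‖z‖ < ρ} :=
    (measurableSet_lt measurable_const measurable_norm).inter
      (measurableSet_lt measurable_norm measurable_const)
  rw [← integral_indicator hA, ← Complex.integral_comp_polarCoord_symm]
  have hcont : ContinuousOn (fun p : ℝ × ℝ => p.1 * φ (Complex.polarCoord.symm p))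
      (Icc δ ρ ×ˢ Icc (-π) π) := by
    refine continuousOn_fst.mul (hφ.comp ?_ ?_)
    · have : (⇑Complex.polarCoord.symm : ℝ × ℝ → ℂ)
        = fun p : ℝ × ℝ => (p.1 : ℂ) * (Real.cos p.2 + Real.sin p.2 * Complex.I) := by
        funext p; exact Complex.polarCoord_symm_apply p
      rw [this]; fun_prop
    · rintro ⟨r, θ⟩ ⟨hr, -⟩
      have hr0 : 0 ≤ r := hδ.trans hr.1
      change δ ≤ ‖Complex.polarCoord.symm (r, θ)‖ ∧ ‖Complex.polarCoord.symm (r, θ)‖ ≤ ρ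
      rw [Complex.norm_polarCoord_symm, abs_of_nonneg hr0]
      exact hr
  have hint : IntegrableOn (fun p : ℝ × ℝ => p.1 * φ (Complex.polarCoord.symm p))
      (Ioo δ ρ ×ˢ Ioo (-π) π) :=
    (hcont.integrableOn_compact (isCompact_Icc.prod isCompact_Icc)).mono_set
      (prod_mono Ioo_subset_Icc_self Ioo_subset_Icc_self)
  have h1 : ∫ p in polarCoord.target, p.1 • ({z : ℂ | δ < ‖z‖ ∧ ‖z‖ < ρ}.indicator φ)
        (Complex.polarCoord.symm p) =
      ∫ p in Ioo δ ρ ×ˢ Ioo (-π) π, p.1 * φ (Complex.polarCoord.symm p) := by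
    have hsub : Ioo δ ρ ×ˢ Ioo (-π) π ⊆ polarCoord.target := by
      rintro ⟨r, θ⟩ ⟨hr, hθ⟩
      exact ⟨lt_of_le_of_lt hδ hr.1, hθ⟩
    rw [← integral_indicator (polarCoord.open_target.measurableSet),
      ← integral_indicator (measurableSet_Ioo.prod measurableSet_Ioo)]
    congr 1
    funext p
    by_cases hp : p ∈ polarCoord.target
    · have hp1 : 0 < p.1 := hp.1
      by_cases hq : p ∈ Ioo δ ρ ×ˢ Ioo (-π) π
      · rw [indicator_of_mem hp, indicator_of_mem hq, indicator_of_mem, smul_eq_mul]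
        simpa [Complex.norm_polarCoord_symm, abs_of_pos hp1] using hq.1
      · rw [indicator_of_mem hp, indicator_of_notMem hq, indicator_of_notMem, smul_zero]
        intro hmem
        apply hq
        refine ⟨?_, hp.2⟩
        simpa [Complex.norm_polarCoord_symm, abs_of_pos hp1] using hmem
    · rw [indicator_of_notMem hp, indicator_of_notMem (fun h => hp (hsub h))]
  rw [h1, Measure.volume_eq_prod, setIntegral_prod _ (by rwa [← Measure.volume_eq_prod]),
    intervalIntegral.integral_of_le hδρ, integral_Ioc_eq_integral_Ioo]
  refine setIntegral_congr_fun measurableSet_Ioo fun r hr => ?_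
  simp only
  rw [integral_const_mul, circleAverage_def, smul_eq_mul, ← integral_Ioc_eq_integral_Ioo,
    ← intervalIntegral.integral_of_le (by linarith [Real.pi_pos])]
  have h2 : ∀ θ : ℝ, Complex.polarCoord.symm (r, θ) = circleMap 0 r θ := by
    intro θ
    rw [Complex.polarCoord_symm_apply, circleMap, zero_add, Complex.exp_mul_I]
    simp
  simp only [h2]
  have hper : Function.Periodic (fun θ => φ (circleMap 0 r θ)) (2 * π) := by
    intro θ
    simp only [periodic_circleMap 0 r θ]
  have h3 := hper.intervalIntegral_add_eq (-π) 0
  rw [show -π + 2 * π = π by ring, zero_add] at h3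
  rw [h3]
  field_simp

open MeasureTheory in
/-- The change of variables formula for an injective holomorphic map. -/
theorem setLIntegral_image_of_hasDerivAt {f f' : ℂ → ℂ} {s : Set ℂ} (hs : MeasurableSet s)
    (hf : ∀ z ∈ s, HasDerivAt f (f' z) z) (hinj : InjOn f s) (g : ℂ → ℝ≥0∞) :
    ∫⁻ v in f '' s, g v = ∫⁻ z in s, ENNReal.ofReal (‖f' z‖ ^ 2) * g (f z) := by
  have hdet : ∀ a : ℂ,
      ((ContinuousLinearMap.toSpanSingleton ℂ a).restrictScalars ℝ).det = ‖a‖ ^ 2 := by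
    intro a
    have h : (((ContinuousLinearMap.toSpanSingleton ℂ a).restrictScalars ℝ) : ℂ →ₗ[ℝ] ℂ) =
        Algebra.lmul ℝ ℂ a := by
      ext
      simp [mul_comm]
    rw [ContinuousLinearMap.det, h, ← Algebra.norm_apply, Algebra.norm_complex_apply,
      Complex.normSq_eq_norm_sq]
  rw [lintegral_image_eq_lintegral_abs_det_fderiv_mul volume hs
    (fun z hz => ((hf z hz).hasFDerivAt.restrictScalars ℝ).hasFDerivWithinAt) hinj]
  simp only [hdet, abs_pow, abs_norm]

/-- The mean value over a circle of `‖w⁻¹ + s'‖²`: the mixed term has mean value zero because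
`w s'(w)` vanishes at the centre. -/
theorem circleAverage_norm_inv_add_sq {g : ℂ → ℂ} (hg : DifferentiableOn ℂ g (Metric.ball 0 1))
    {r : ℝ} (hr : 0 < r) (hr1 : r < 1) :
    Real.circleAverage (fun w => ‖w⁻¹ + g w‖ ^ 2) 0 r =
      (r ^ 2)⁻¹ + Real.circleAverage (fun w => ‖g w‖ ^ 2) 0 r := by
  have hsub : Metric.closedBall (0 : ℂ) r ⊆ Metric.ball 0 1 :=
    Metric.closedBall_subset_ball hr1
  have hgs : ContinuousOn g (Metric.sphere 0 r) :=
    hg.continuousOn.mono (Metric.sphere_subset_closedBall.trans hsub)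
  have hd : DiffContOnCl ℂ (fun w => w * g w) (Metric.ball 0 |r|) := by
    rw [abs_of_pos hr]
    refine DifferentiableOn.diffContOnCl ?_
    rw [closure_ball _ hr.ne']
    exact (differentiableOn_id.mul hg).mono hsub
  have hmean : Real.circleAverage (fun w => w * g w) 0 r = 0 := by
    rw [hd.circleAverage]; simp
  have hcint : CircleIntegrable (fun w => w * g w) 0 r :=
    (continuousOn_id.mul hgs).circleIntegrable hr.le
  have hre : Real.circleAverage (fun w => (w * g w).re) 0 r = 0 := by
    have := Complex.reCLM.circleAverage_comp_comm hcint
    rw [hmean] at this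
    simpa [Function.comp_def] using this
  have hcs : ContinuousOn (fun w => (2 * (r ^ 2)⁻¹) • (w * g w).re) (Metric.sphere 0 r) :=
    (Complex.continuous_re.comp_continuousOn (continuousOn_id.mul hgs)).const_smul
      (2 * (r ^ 2)⁻¹)
  have hEq : EqOn (fun w => ‖w⁻¹ + g w‖ ^ 2)
      (fun w => ((r ^ 2)⁻¹ + (2 * (r ^ 2)⁻¹) • (w * g w).re) + ‖g w‖ ^ 2)
      (Metric.sphere 0 |r|) := by
    intro w hw
    rw [abs_of_pos hr, mem_sphere_zero_iff_norm] at hw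
    have hw0 : w ≠ 0 := by rintro rfl; simp at hw; exact hr.ne hw
    have hns : w.re * w.re + w.im * w.im = r ^ 2 := by
      rw [← hw, ← Complex.normSq_apply, Complex.normSq_eq_norm_sq]
    simp only [← Complex.normSq_eq_norm_sq, Complex.normSq_apply, Complex.add_re, Complex.add_im,
      Complex.inv_re, Complex.inv_im, Complex.mul_re, hns, smul_eq_mul]
    have hr2 : r ^ 2 ≠ 0 := by positivity
    field_simp
    linear_combination (hns)
  rw [Real.circleAverage_congr_sphere hEq, Real.circleAverage_fun_add,
    Real.circleAverage_fun_add, Real.circleAverage_const, Real.circleAverage_fun_smul, hre]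
  · simp
  · exact continuousOn_const.circleIntegrable hr.le
  · refine ContinuousOn.circleIntegrable hr.le ?_
    exact hcs
  · refine ContinuousOn.circleIntegrable hr.le ?_
    exact continuousOn_const.add hcs
  · exact ContinuousOn.circleIntegrable hr.le (hgs.norm.pow 2)

/-- The open annulus between two radii. -/
def annulus (δ ρ : ℝ) : Set ℂ := {z | δ < ‖z‖ ∧ ‖z‖ < ρ}

theorem measurableSet_annulus (δ ρ : ℝ) : MeasurableSet (annulus δ ρ) :=
  (measurableSet_lt measurable_const measurable_norm).inter
    (measurableSet_lt measurable_norm measurable_const)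

theorem continuousOn_circleAverage_annulus {φ : ℂ → ℝ} {δ ρ : ℝ} (hδ : 0 ≤ δ)
    (hφ : ContinuousOn φ {z | δ ≤ ‖z‖ ∧ ‖z‖ ≤ ρ}) :
    ContinuousOn (fun r => Real.circleAverage φ 0 r) (Icc δ ρ) := by
  refine Real.ContinuousOn.circleAverage ?_ fun r hr => hδ.trans hr.1
  simpa using hφ

open MeasureTheory Real in
/-- In an annulus, the energy of `log (w e^{s(w)})` is the sum of those of `log w` and `s`. -/
theorem integral_annulus_norm_inv_add_sq {g : ℂ → ℂ}
    (hg : DifferentiableOn ℂ g (Metric.ball 0 1)) {δ ρ : ℝ} (hδ : 0 < δ) (hδρ : δ ≤ ρ)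
    (hρ : ρ < 1) :
    ∫ w in annulus δ ρ, ‖w⁻¹ + g w‖ ^ 2 =
      2 * π * Real.log (ρ / δ) + ∫ w in annulus δ ρ, ‖g w‖ ^ 2 := by
  have hsub : {z : ℂ | δ ≤ ‖z‖ ∧ ‖z‖ ≤ ρ} ⊆ Metric.ball 0 1 := fun z hz => by
    rw [mem_ball_zero_iff]; exact lt_of_le_of_lt hz.2 hρ
  have hgc := hg.continuousOn.mono hsub
  have hne : ∀ z ∈ {z : ℂ | δ ≤ ‖z‖ ∧ ‖z‖ ≤ ρ}, z ≠ 0 := fun z hz => by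
    rintro rfl
    have := hz.1
    simp at this
    linarith
  have h1 : ContinuousOn (fun w : ℂ => ‖w⁻¹ + g w‖ ^ 2) {z | δ ≤ ‖z‖ ∧ ‖z‖ ≤ ρ} :=
    ((continuousOn_id.inv₀ hne).add hgc).norm.pow 2
  have h2 : ContinuousOn (fun w : ℂ => ‖g w‖ ^ 2) {z | δ ≤ ‖z‖ ∧ ‖z‖ ≤ ρ} := hgc.norm.pow 2
  unfold annulus
  rw [setIntegral_annulus_eq_circleAverage hδ.le hδρ h1,
    setIntegral_annulus_eq_circleAverage hδ.le hδρ h2]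
  have h3 : ∫ r in δ..ρ, r * (2 * π * circleAverage (fun w => ‖w⁻¹ + g w‖ ^ 2) 0 r) =
      ∫ r in δ..ρ, (2 * π * r⁻¹ + r * (2 * π * circleAverage (fun w => ‖g w‖ ^ 2) 0 r)) := by
    refine intervalIntegral.integral_congr fun r hr => ?_
    rw [uIcc_of_le hδρ] at hr
    have hr0 : 0 < r := hδ.trans_le hr.1
    change r * (2 * π * circleAverage (fun w => ‖w⁻¹ + g w‖ ^ 2) 0 r) =
      2 * π * r⁻¹ + r * (2 * π * circleAverage (fun w => ‖g w‖ ^ 2) 0 r)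
    rw [circleAverage_norm_inv_add_sq hg hr0 (hr.2.trans_lt hρ)]
    field_simp
  rw [h3, intervalIntegral.integral_add, intervalIntegral.integral_const_mul,
    integral_inv_of_pos hδ (hδ.trans_le hδρ)]
  · refine (ContinuousOn.intervalIntegrable ?_)
    rw [uIcc_of_le hδρ]
    exact continuousOn_const.mul (continuousOn_id.inv₀ fun r hr => (hδ.trans_le hr.1).ne')
  · refine (ContinuousOn.intervalIntegrable ?_)
    rw [uIcc_of_le hδρ]
    exact continuousOn_id.mul (continuousOn_const.mul
      (continuousOn_circleAverage_annulus hδ.le h2))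

/-! ### The area inequality for Bieberbach–Eilenberg functions -/

/-- A value omitted by a holomorphic `N` with `N 0 = 0` on a closed disc is at least as large as
the minimum of `‖N‖` on the boundary circle: apply the maximum principle to
`(v̄ N - m²) / (m (N - v))`. -/
theorem le_norm_of_forall_ne {N : ℂ → ℂ} {δ m : ℝ} {v : ℂ} (hδ : 0 < δ)
    (hN : DifferentiableOn ℂ N (Metric.ball 0 1)) (hδ1 : δ < 1) (h0 : N 0 = 0) (hm : 0 < m)
    (hmin : ∀ w, ‖w‖ = δ → m ≤ ‖N w‖) (hv0 : v ≠ 0)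
    (hv : ∀ w ∈ Metric.closedBall (0 : ℂ) δ, N w ≠ v) : m ≤ ‖v‖ := by
  by_contra! hlt
  have hsub : Metric.closedBall (0 : ℂ) δ ⊆ Metric.ball 0 1 :=
    Metric.closedBall_subset_ball hδ1
  set Φ : ℂ → ℂ := fun w => ((starRingEnd ℂ) v * N w - m ^ 2) / (m * (N w - v)) with hΦ
  have hmC : (m : ℂ) ≠ 0 := by exact_mod_cast hm.ne'
  have hd : DiffContOnCl ℂ Φ (Metric.ball 0 δ) := by
    refine DifferentiableOn.diffContOnCl ?_
    rw [closure_ball _ hδ.ne']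
    refine DifferentiableOn.div ?_ ?_ ?_
    · exact ((hN.mono hsub).const_mul _).sub_const _
    · exact ((hN.mono hsub).sub_const _).const_mul _
    · intro w hw
      exact mul_ne_zero hmC (sub_ne_zero.2 (hv w hw))
  have hbd : ∀ w ∈ frontier (Metric.ball (0 : ℂ) δ), ‖Φ w‖ ≤ 1 := by
    intro w hw
    rw [frontier_ball _ hδ.ne', mem_sphere_zero_iff_norm] at hw
    have hNw := hmin w hw
    have hne : N w - v ≠ 0 :=
      sub_ne_zero.2 (hv w (mem_closedBall_zero_iff.2 hw.le))
    rw [hΦ]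
    simp only [norm_div]
    refine div_le_one_of_le₀ ?_ (norm_nonneg _)
    refine le_of_sq_le_sq ?_ (norm_nonneg _)
    rw [norm_mul, mul_pow, ← Complex.normSq_eq_norm_sq, ← Complex.normSq_eq_norm_sq,
      ← Complex.normSq_eq_norm_sq]
    have h1 : Complex.normSq v < m ^ 2 := by
      rw [Complex.normSq_eq_norm_sq]
      exact pow_lt_pow_left₀ hlt (norm_nonneg _) two_ne_zero
    have h2 : m ^ 2 ≤ Complex.normSq (N w) := by
      rw [Complex.normSq_eq_norm_sq]
      exact pow_le_pow_left₀ hm.le hNw 2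
    simp only [Complex.normSq_apply] at h1 h2
    simp only [Complex.normSq_apply, Complex.sub_re, Complex.sub_im, Complex.mul_re,
      Complex.mul_im, Complex.conj_re, Complex.conj_im, Complex.ofReal_re, Complex.ofReal_im,
      ← Complex.ofReal_pow]
    nlinarith [mul_nonneg (sub_nonneg.2 h1.le) (sub_nonneg.2 h2)]
  have h0' : (0 : ℂ) ∈ closure (Metric.ball (0 : ℂ) δ) :=
    subset_closure (Metric.mem_ball_self hδ)
  have hle := Complex.norm_le_of_forall_mem_frontier_norm_le Metric.isBounded_ball hd hbd h0'
  rw [hΦ] at hle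
  simp only [h0, mul_zero, zero_sub, norm_div, norm_neg, norm_mul, norm_pow, Complex.norm_real,
    Real.norm_of_nonneg hm.le] at hle
  have hvpos : 0 < ‖v‖ := norm_pos_iff.2 hv0
  rw [div_le_one (by positivity)] at hle
  nlinarith

open MeasureTheory Real in
theorem lintegral_annulus_inv_norm_sq {m M : ℝ} (hm : 0 < m) (hmM : m ≤ M) :
    ∫⁻ v in annulus m M, ENNReal.ofReal ((‖v‖ ^ 2)⁻¹) =
      ENNReal.ofReal (2 * π * Real.log (M / m)) := by
  have hc : ContinuousOn (fun v : ℂ => (‖v‖ ^ 2)⁻¹) {z | m ≤ ‖z‖ ∧ ‖z‖ ≤ M} := by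
    refine ContinuousOn.inv₀ (by fun_prop) fun z hz => ?_
    have : 0 < ‖z‖ := hm.trans_le hz.1
    positivity
  have hK : IsCompact {z : ℂ | m ≤ ‖z‖ ∧ ‖z‖ ≤ M} := by
    refine (isCompact_closedBall (0 : ℂ) M).of_isClosed_subset
      ((isClosed_le continuous_const continuous_norm).inter
        (isClosed_le continuous_norm continuous_const)) fun z hz => ?_
    exact mem_closedBall_zero_iff.2 hz.2
  have hint : IntegrableOn (fun v : ℂ => (‖v‖ ^ 2)⁻¹) (annulus m M) :=
    (hc.integrableOn_compact hK).mono_set fun z hz => ⟨hz.1.le, hz.2.le⟩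
  rw [← ofReal_integral_eq_lintegral_ofReal hint (Eventually.of_forall fun v => by positivity)]
  congr 1
  unfold annulus
  rw [setIntegral_annulus_eq_circleAverage hm.le hmM hc,
    ← integral_inv_of_pos hm (hm.trans_le hmM), ← intervalIntegral.integral_const_mul]
  refine intervalIntegral.integral_congr fun r hr => ?_
  rw [uIcc_of_le hmM] at hr
  have hr0 : 0 < r := hm.trans_le hr.1
  have : circleAverage (fun v : ℂ => (‖v‖ ^ 2)⁻¹) 0 r = (r ^ 2)⁻¹ := by
    refine circleAverage_const_on_circle fun z hz => ?_
    rw [abs_of_pos hr0, mem_sphere_zero_iff_norm] at hz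
    simp [hz]
  simp only [this]
  field_simp

open MeasureTheory Real in
/-- The area inequality for a Bieberbach–Eilenberg function `N = w e^{s(w)}`: the images of an
annulus under `N` and `1 / N` are disjoint, and their logarithmic areas add up to at most that of
`{m ≤ ‖v‖ ≤ 1 / m}`. -/
theorem integral_annulus_norm_deriv_sq_le {s : ℂ → ℂ}
    (hs : DifferentiableOn ℂ s (Metric.ball 0 1))
    (hinj : InjOn (fun w => w * Complex.exp (s w)) (Metric.ball 0 1))
    (hBE : ∀ w₁ ∈ Metric.ball (0 : ℂ) 1, ∀ w₂ ∈ Metric.ball (0 : ℂ) 1,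
      (w₁ * Complex.exp (s w₁)) * (w₂ * Complex.exp (s w₂)) ≠ 1)
    {δ ρ m m₁ : ℝ} (hδ : 0 < δ) (hδρ : δ < ρ) (hρ : ρ < 1) (hm : 0 < m) (hm₁ : m < m₁)
    (hmin : ∀ w, ‖w‖ = δ → m₁ ≤ ‖w * Complex.exp (s w)‖) :
    ∫ w in annulus δ ρ, ‖deriv s w‖ ^ 2 ≤ 2 * π * (Real.log (δ / m) - Real.log ρ) := by
  set N : ℂ → ℂ := fun w => w * Complex.exp (s w) with hN
  set A := annulus δ ρ with hA
  have hAm : MeasurableSet A := measurableSet_annulus δ ρ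
  have hAb : A ⊆ Metric.ball 0 1 := fun z hz => mem_ball_zero_iff.2 (hz.2.trans hρ)
  have hA0 : ∀ z ∈ A, z ≠ 0 := fun z hz => norm_pos_iff.1 (hδ.trans hz.1)
  have hs' : ∀ z ∈ Metric.ball (0 : ℂ) 1, HasDerivAt s (deriv s z) z := fun z hz =>
    ((hs z hz).differentiableAt (Metric.isOpen_ball.mem_nhds hz)).hasDerivAt
  have hN' : ∀ z ∈ Metric.ball (0 : ℂ) 1,
      HasDerivAt N (Complex.exp (s z) * (1 + z * deriv s z)) z := fun z hz => by
    have := (hasDerivAt_id z).mul (hs' z hz).cexp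
    refine this.congr_deriv ?_
    simp only [id]; ring
  have hNd : DifferentiableOn ℂ N (Metric.ball 0 1) := fun z hz =>
    (hN' z hz).differentiableAt.differentiableWithinAt
  have hNne : ∀ z ∈ A, N z ≠ 0 := fun z hz => mul_ne_zero (hA0 z hz) (Complex.exp_ne_zero _)
  have hδ1 : δ < 1 := hδρ.trans hρ
  have hN0 : N 0 = 0 := by simp [hN]
  -- the values of `N` and `1 / N` on the annulus are at least `m`
  have hlow : ∀ z ∈ A, m < ‖N z‖ := fun z hz =>
    hm₁.trans_le <| le_norm_of_forall_ne hδ hNd hδ1 hN0 (hm.trans hm₁) hmin (hNne z hz)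
      fun w hw heq => by
      have hwb : w ∈ Metric.ball (0 : ℂ) 1 := Metric.closedBall_subset_ball hδ1 hw
      have := hinj hwb (hAb hz) heq
      rw [this, mem_closedBall_zero_iff] at hw
      exact absurd hz.1 (not_lt.2 hw)
  have hlow' : ∀ z ∈ A, m < ‖(N z)⁻¹‖ := fun z hz =>
    hm₁.trans_le <| le_norm_of_forall_ne hδ hNd hδ1 hN0 (hm.trans hm₁) hmin
      (inv_ne_zero (hNne z hz)) fun w hw heq => by
      have hwb : w ∈ Metric.ball (0 : ℂ) 1 := Metric.closedBall_subset_ball hδ1 hw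
      apply hBE w hwb z (hAb hz)
      change N w * N z = 1
      rw [heq, inv_mul_cancel₀ (hNne z hz)]
  -- the logarithmic area of both images is the energy of `log N`
  have key : ∀ z ∈ A, ENNReal.ofReal (‖Complex.exp (s z) * (1 + z * deriv s z)‖ ^ 2) *
      ENNReal.ofReal ((‖N z‖ ^ 2)⁻¹) = ENNReal.ofReal (‖z⁻¹ + deriv s z‖ ^ 2) := fun z hz => by
    rw [← ENNReal.ofReal_mul (by positivity)]
    congr 1
    have hz0 := hA0 z hz
    have : z⁻¹ + deriv s z = (Complex.exp (s z) * (1 + z * deriv s z)) / N z := by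
      simp only [hN]
      field_simp
    rw [this, norm_div, div_pow, div_eq_mul_inv]
  have hI1 : ∫⁻ v in N '' A, ENNReal.ofReal ((‖v‖ ^ 2)⁻¹) =
      ∫⁻ z in A, ENNReal.ofReal (‖z⁻¹ + deriv s z‖ ^ 2) := by
    rw [setLIntegral_image_of_hasDerivAt hAm (fun z hz => hN' z (hAb hz)) (hinj.mono hAb)]
    exact setLIntegral_congr_fun hAm key
  have hinj' : InjOn (fun z => (N z)⁻¹) A :=
    fun z hz z' hz' h => hinj (hAb hz) (hAb hz') (inv_injective h)
  have hI2 : ∫⁻ v in (fun z => (N z)⁻¹) '' A, ENNReal.ofReal ((‖v‖ ^ 2)⁻¹) =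
      ∫⁻ z in A, ENNReal.ofReal (‖z⁻¹ + deriv s z‖ ^ 2) := by
    rw [setLIntegral_image_of_hasDerivAt (f := fun z => (N z)⁻¹) hAm
      (fun z hz => (hN' z (hAb hz)).fun_inv (hNne z hz)) hinj']
    refine setLIntegral_congr_fun hAm fun z hz => ?_
    rw [← key z hz, ← ENNReal.ofReal_mul (by positivity), ← ENNReal.ofReal_mul (by positivity)]
    congr 1
    have : ‖N z‖ ≠ 0 := norm_ne_zero_iff.2 (hNne z hz)
    rw [norm_div, norm_neg, norm_inv, norm_pow]
    field_simp
  obtain ⟨z₀, hz₀⟩ : A.Nonempty := by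
    refine ⟨((δ + ρ) / 2 : ℝ), ?_⟩
    change δ < ‖(((δ + ρ) / 2 : ℝ) : ℂ)‖ ∧ ‖(((δ + ρ) / 2 : ℝ) : ℂ)‖ < ρ
    rw [Complex.norm_real, Real.norm_of_nonneg (by linarith)]
    constructor <;> linarith
  have hlt_inv : ∀ z ∈ A, ‖N z‖ < m⁻¹ := fun z hz => by
    have h := hlow' z hz
    rw [norm_inv] at h
    exact (lt_inv_comm₀ hm (norm_pos_iff.2 (hNne z hz))).1 h
  have hmm : m ≤ m⁻¹ := ((hlow z₀ hz₀).trans (hlt_inv z₀ hz₀)).le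
  have hsub : N '' A ∪ (fun z => (N z)⁻¹) '' A ⊆ annulus m m⁻¹ := by
    rintro v (⟨z, hz, rfl⟩ | ⟨z, hz, rfl⟩)
    · exact ⟨hlow z hz, hlt_inv z hz⟩
    · refine ⟨hlow' z hz, ?_⟩
      rw [norm_inv]
      exact (inv_lt_inv₀ (norm_pos_iff.2 (hNne z hz)) hm).2 (hlow z hz)
  have hdisj : Disjoint (N '' A) ((fun z => (N z)⁻¹) '' A) := by
    rw [Set.disjoint_left]
    rintro v ⟨z, hz, rfl⟩ ⟨z', hz', h⟩
    apply hBE z (hAb hz) z' (hAb hz')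
    change N z * N z' = 1
    change (N z')⁻¹ = N z at h
    rw [← h, inv_mul_cancel₀ (hNne z' hz')]
  have hmeas : MeasurableSet ((fun z => (N z)⁻¹) '' A) :=
    hAm.image_of_continuousOn_injOn ((hNd.continuousOn.mono hAb).inv₀ hNne) hinj'
  have hle : ∫⁻ v in N '' A ∪ (fun z => (N z)⁻¹) '' A, ENNReal.ofReal ((‖v‖ ^ 2)⁻¹) ≤
      ∫⁻ v in annulus m m⁻¹, ENNReal.ofReal ((‖v‖ ^ 2)⁻¹) :=
    lintegral_mono_set hsub
  have hcl : ContinuousOn (deriv s) (Metric.ball 0 1) :=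
    (hs.deriv Metric.isOpen_ball).continuousOn
  have hK : IsCompact {z : ℂ | δ ≤ ‖z‖ ∧ ‖z‖ ≤ ρ} := by
    refine (isCompact_closedBall (0 : ℂ) ρ).of_isClosed_subset
      ((isClosed_le continuous_const continuous_norm).inter
        (isClosed_le continuous_norm continuous_const)) fun z hz => ?_
    exact mem_closedBall_zero_iff.2 hz.2
  have hint : IntegrableOn (fun z : ℂ => ‖z⁻¹ + deriv s z‖ ^ 2) A := by
    refine IntegrableOn.mono_set (ContinuousOn.integrableOn_compact hK ?_)
      (fun z hz => ⟨hz.1.le, hz.2.le⟩)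
    refine ((continuousOn_id.inv₀ fun z hz => ?_).add (hcl.mono fun z hz => ?_)).norm.pow 2
    · exact norm_pos_iff.1 (hδ.trans_le hz.1)
    · exact mem_ball_zero_iff.2 (hz.2.trans_lt hρ)
  rw [lintegral_union hmeas hdisj, hI1, hI2, lintegral_annulus_inv_norm_sq hm hmm,
    ← ofReal_integral_eq_lintegral_ofReal hint (Eventually.of_forall fun v => by positivity),
    ← ENNReal.ofReal_add (by positivity) (by positivity)] at hle
  have hlog : 0 ≤ Real.log (m⁻¹ / m) := Real.log_nonneg ((one_le_div₀ hm).2 hmm)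
  rw [ENNReal.ofReal_le_ofReal_iff (by positivity), hA,
    integral_annulus_norm_inv_add_sq (hs.deriv Metric.isOpen_ball) hδ hδρ.le hρ,
    Real.log_div (inv_ne_zero hm.ne') hm.ne', Real.log_inv,
    Real.log_div (hδ.trans hδρ).ne' hδ.ne'] at hle
  rw [Real.log_div hδ.ne' hm.ne']
  linarith

/-! ### Point values and the Dirichlet integral -/

open Real in
/-- The reproducing property of `κ(z) = a / (1 - a² z²)` on a circle. -/
theorem circleAverage_mul_conj_kernel {g : ℂ → ℂ}
    (hg : DifferentiableOn ℂ g (Metric.ball 0 1)) {a r : ℝ} (ha : 0 < a) (ha1 : a < 1)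
    (hr : 0 < r) (hr1 : r < 1) :
    circleAverage (fun z => g z * (starRingEnd ℂ) (a / (1 - a ^ 2 * z ^ 2))) 0 r =
      (a / 2) * (g (a * r ^ 2) + g (-(a * r ^ 2))) := by
  set c : ℂ := a * r ^ 2 with hc
  have hcn : ‖c‖ < r := by
    rw [hc, norm_mul, norm_pow, Complex.norm_real, Complex.norm_real, Real.norm_of_nonneg ha.le,
      Real.norm_of_nonneg hr.le]
    nlinarith [mul_pos hr (mul_pos ha hr)]
  have hsub : Metric.closedBall (0 : ℂ) r ⊆ Metric.ball 0 1 :=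
    Metric.closedBall_subset_ball hr1
  have hd : DiffContOnCl ℂ g (Metric.ball 0 |r|) := by
    rw [abs_of_pos hr]
    refine DifferentiableOn.diffContOnCl ?_
    rw [closure_ball _ hr.ne']
    exact hg.mono hsub
  have hgs : ContinuousOn g (Metric.sphere 0 r) :=
    hg.continuousOn.mono (Metric.sphere_subset_closedBall.trans hsub)
  have hc1 : c ∈ Metric.ball (0 : ℂ) |r| := by
    rw [abs_of_pos hr, mem_ball_zero_iff]; exact hcn
  have hc2 : -c ∈ Metric.ball (0 : ℂ) |r| := by
    rw [abs_of_pos hr, mem_ball_zero_iff, norm_neg]; exact hcn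
  have h1 := hd.circleAverage_smul_div hc1
  have h2 := hd.circleAverage_smul_div hc2
  have hne : ∀ z ∈ Metric.sphere (0 : ℂ) r, z - c ≠ 0 ∧ z + c ≠ 0 := by
    intro z hz
    rw [mem_sphere_zero_iff_norm] at hz
    constructor
    · intro h
      rw [sub_eq_zero.1 h] at hz
      exact hcn.ne hz
    · intro h
      rw [eq_neg_of_add_eq_zero_left h, norm_neg] at hz
      exact hcn.ne hz
  have hEq : EqOn (fun z => g z * (starRingEnd ℂ) (a / (1 - a ^ 2 * z ^ 2)))
      (fun z => ((a : ℂ) / 2) • (((z - 0) / (z - c)) • g z + ((z - 0) / (z - -c)) • g z))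
      (Metric.sphere 0 |r|) := by
    intro z hz
    rw [abs_of_pos hr] at hz
    obtain ⟨hz1, hz2⟩ := hne z hz
    rw [mem_sphere_zero_iff_norm] at hz
    have hz0 : z ≠ 0 := by rintro rfl; simp at hz; exact hr.ne hz
    have hconj : (starRingEnd ℂ) z = r ^ 2 / z := by
      rw [eq_div_iff hz0, mul_comm, Complex.mul_conj, Complex.normSq_eq_norm_sq, hz]
      push_cast; ring
    have hden : 1 - (a : ℂ) ^ 2 * (r ^ 2 / z) ^ 2 = (z - c) * (z + c) / z ^ 2 := by
      rw [hc]; field_simp; ring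
    simp only [map_div₀, map_sub, map_mul, map_pow, map_one, Complex.conj_ofReal, hconj,
      smul_eq_mul, sub_zero, sub_neg_eq_add]
    rw [hden]
    field_simp
    ring
  rw [circleAverage_congr_sphere hEq, circleAverage_fun_smul, circleAverage_fun_add, h1, h2,
    smul_eq_mul]
  · refine ContinuousOn.circleIntegrable hr.le (ContinuousOn.fun_smul ?_ hgs)
    exact ContinuousOn.div (by fun_prop) (by fun_prop) fun z hz => (hne z hz).1
  · refine ContinuousOn.circleIntegrable hr.le (ContinuousOn.fun_smul ?_ hgs)
    exact ContinuousOn.div (by fun_prop) (by fun_prop) fun z hz => by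
      rw [sub_neg_eq_add]; exact (hne z hz).2

open Real in
/-- Bessel's inequality on a circle for the kernel `κ`: expand `‖g - c κ‖² ≥ 0`. -/
theorem circleAverage_norm_sq_ge {g : ℂ → ℂ}
    (hg : DifferentiableOn ℂ g (Metric.ball 0 1)) {a r : ℝ} (ha : 0 < a) (ha1 : a < 1)
    (hr : 0 < r) (hr1 : r < 1) (c : ℂ) :
    ((starRingEnd ℂ) c * (a * (g (a * r ^ 2) + g (-(a * r ^ 2))))).re
      - ‖c‖ ^ 2 * (a ^ 2 / (1 - (a ^ 2 * r ^ 2) ^ 2)) ≤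
      circleAverage (fun z => ‖g z‖ ^ 2) 0 r := by
  set κ : ℂ → ℂ := fun z => a / (1 - a ^ 2 * z ^ 2) with hκ
  have hden : ∀ z ∈ Metric.ball (0 : ℂ) 1, 1 - (a : ℂ) ^ 2 * z ^ 2 ≠ 0 := by
    intro z hz h
    rw [mem_ball_zero_iff] at hz
    have h1 : ‖(a : ℂ) ^ 2 * z ^ 2‖ = 1 := by rw [← sub_eq_zero.1 h, norm_one]
    rw [norm_mul, norm_pow, norm_pow, Complex.norm_real, Real.norm_of_nonneg ha.le] at h1
    have h2 : a ^ 2 < 1 := by nlinarith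
    have h3 : ‖z‖ ^ 2 < 1 := by nlinarith [norm_nonneg z]
    nlinarith [sq_nonneg a, sq_nonneg ‖z‖]
  have hκd : DifferentiableOn ℂ κ (Metric.ball 0 1) :=
    DifferentiableOn.div (by fun_prop) (by fun_prop) hden
  have hsub : Metric.sphere (0 : ℂ) r ⊆ Metric.ball 0 1 :=
    Metric.sphere_subset_closedBall.trans (Metric.closedBall_subset_ball hr1)
  have hgs := hg.continuousOn.mono hsub
  have hκs := hκd.continuousOn.mono hsub
  have h1 := circleAverage_mul_conj_kernel hg ha ha1 hr hr1
  have h2 := circleAverage_mul_conj_kernel hκd ha ha1 hr hr1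
  change circleAverage (fun z => g z * (starRingEnd ℂ) (κ z)) 0 r = _ at h1
  change circleAverage (fun z => κ z * (starRingEnd ℂ) (κ z)) 0 r = _ at h2
  have hi1 : CircleIntegrable (fun z => (starRingEnd ℂ) c * (g z * (starRingEnd ℂ) (κ z))) 0 r :=
    (continuousOn_const.mul
      (hgs.mul (Complex.continuous_conj.comp_continuousOn hκs))).circleIntegrable hr.le
  have hi2 : CircleIntegrable (fun z => κ z * (starRingEnd ℂ) (κ z)) 0 r :=
    (hκs.mul (Complex.continuous_conj.comp_continuousOn hκs)).circleIntegrable hr.le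
  have h1' : circleAverage (fun z => ((starRingEnd ℂ) c * (g z * (starRingEnd ℂ) (κ z))).re) 0 r =
      ((starRingEnd ℂ) c * ((a / 2) * (g (a * r ^ 2) + g (-(a * r ^ 2))))).re := by
    have h := Complex.reCLM.circleAverage_comp_comm hi1
    have h3 := circleAverage_fun_smul (a := (starRingEnd ℂ) c) (c := 0) (R := r)
      (f := fun z => g z * (starRingEnd ℂ) (κ z))
    simp only [smul_eq_mul] at h3
    rw [h3, h1] at h
    exact h
  have h2' : circleAverage (fun z => (κ z * (starRingEnd ℂ) (κ z)).re) 0 r =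
      a ^ 2 / (1 - (a ^ 2 * r ^ 2) ^ 2) := by
    have h := Complex.reCLM.circleAverage_comp_comm hi2
    rw [h2] at h
    refine h.trans ?_
    have h4 : (a : ℂ) / 2 * (κ (a * r ^ 2) + κ (-(a * r ^ 2))) =
        ((a ^ 2 / (1 - (a ^ 2 * r ^ 2) ^ 2) : ℝ) : ℂ) := by
      simp only [hκ]
      push_cast
      rw [neg_sq]
      ring
    rw [h4]
    exact Complex.ofReal_re _
  have hc1 : ContinuousOn (fun z => ((starRingEnd ℂ) c * (g z * (starRingEnd ℂ) (κ z))).re)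
      (Metric.sphere 0 r) :=
    Complex.continuous_re.comp_continuousOn
      (continuousOn_const.mul (hgs.mul (Complex.continuous_conj.comp_continuousOn hκs)))
  have hc2 : ContinuousOn (fun z => (κ z * (starRingEnd ℂ) (κ z)).re) (Metric.sphere 0 r) :=
    Complex.continuous_re.comp_continuousOn
      (hκs.mul (Complex.continuous_conj.comp_continuousOn hκs))
  have hmono : circleAverage (fun z =>
      (2 : ℝ) • ((starRingEnd ℂ) c * (g z * (starRingEnd ℂ) (κ z))).re
        - (‖c‖ ^ 2) • (κ z * (starRingEnd ℂ) (κ z)).re) 0 r ≤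
      circleAverage (fun z => ‖g z‖ ^ 2) 0 r := by
    refine circleAverage_mono ?_ ?_ ?_
    · exact ContinuousOn.circleIntegrable hr.le ((hc1.const_smul (2 : ℝ)).sub
        (hc2.const_smul (‖c‖ ^ 2)))
    · exact ContinuousOn.circleIntegrable hr.le (hgs.norm.pow 2)
    · intro z _
      have h := sq_nonneg ‖g z - c * κ z‖
      rw [← Complex.normSq_eq_norm_sq, Complex.normSq_apply] at h
      rw [← Complex.normSq_eq_norm_sq, ← Complex.normSq_eq_norm_sq, Complex.normSq_apply,
        Complex.normSq_apply]
      simp only [smul_eq_mul, Complex.mul_re, Complex.mul_im, Complex.conj_re, Complex.conj_im,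
        Complex.sub_re, Complex.sub_im] at h ⊢
      nlinarith [h]
  rw [circleAverage_fun_sub, circleAverage_fun_smul, circleAverage_fun_smul, h1', h2'] at hmono
  · refine le_trans (le_of_eq ?_) hmono
    simp only [smul_eq_mul]
    congr 1
    have : (starRingEnd ℂ) c * (a * (g (a * r ^ 2) + g (-(a * r ^ 2)))) =
      (2 : ℝ) * ((starRingEnd ℂ) c * (a / 2 * (g (a * r ^ 2) + g (-(a * r ^ 2))))) := by
      push_cast; ring
    rw [this, Complex.re_ofReal_mul]
  · exact ContinuousOn.circleIntegrable hr.le (hc1.const_smul (2 : ℝ))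
  · exact ContinuousOn.circleIntegrable hr.le (hc2.const_smul (‖c‖ ^ 2))

open Real MeasureTheory in
/-- The sharp bound for the value at `a` of a function `s` on the unit disc with `s(-a) = -s(a)`
in terms of its Dirichlet integral. -/
theorem norm_sq_le_of_energy_le {s g : ℂ → ℂ}
    (hg : DifferentiableOn ℂ g (Metric.ball 0 1))
    (hs : ∀ z ∈ Metric.ball (0 : ℂ) 1, HasDerivAt s (g z) z) {a : ℝ} (ha : 0 < a) (ha1 : a < 1)
    (hodd : s (-a) = -s a) {C : ℝ}
    (hC : ∀ ρ : ℝ, 0 < ρ → ρ < 1 → ∫ z in annulus 0 ρ, ‖g z‖ ^ 2 ≤ C) :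
    2 * ‖s a‖ ^ 2 ≤ Real.log ((1 + a ^ 2) / (1 - a ^ 2)) * (C / π) := by
  set Λ := Real.log ((1 + a ^ 2) / (1 - a ^ 2)) with hΛ
  have ha2 : a ^ 2 < 1 := by nlinarith
  have hΛ0 : 0 < Λ := Real.log_pos ((one_lt_div (by linarith)).2 (by nlinarith))
  -- integrating Bessel's inequality over circles bounds the Dirichlet integral over the disc of
  -- radius `r` below by `P c r`, whose derivative in `r` is `p c r`
  set P : ℂ → ℝ → ℝ := fun c r =>
    π * ((starRingEnd ℂ) c * (s (a * r ^ 2) - s (-(a * r ^ 2)))).re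
      - π * ‖c‖ ^ 2 * ((Real.log (1 + a ^ 2 * r ^ 2) - Real.log (1 - a ^ 2 * r ^ 2)) / 2) with hP
  have hmem : ∀ r : ℝ, r ∈ Icc (0 : ℝ) 1 → (a * r ^ 2 : ℂ) ∈ Metric.ball (0 : ℂ) 1 := by
    intro r hr
    rw [mem_ball_zero_iff, norm_mul, norm_pow, Complex.norm_real, Complex.norm_real,
      Real.norm_of_nonneg ha.le, Real.norm_of_nonneg hr.1]
    have : r ^ 2 ≤ 1 := by nlinarith [hr.1, hr.2]
    nlinarith
  have hmem' : ∀ r : ℝ, r ∈ Icc (0 : ℝ) 1 → (-(a * r ^ 2) : ℂ) ∈ Metric.ball (0 : ℂ) 1 := by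
    intro r hr
    have := hmem r hr
    rwa [mem_ball_zero_iff, norm_neg, ← mem_ball_zero_iff]
  have hlt : ∀ r : ℝ, r ∈ Icc (0 : ℝ) 1 → a ^ 2 * r ^ 2 < 1 := by
    intro r hr
    have : r ^ 2 ≤ 1 := by nlinarith [hr.1, hr.2]
    nlinarith [sq_nonneg a]
  set p : ℂ → ℝ → ℝ := fun c r => r * (2 * π * (((starRingEnd ℂ) c *
    (a * (g (a * r ^ 2) + g (-(a * r ^ 2))))).re
      - ‖c‖ ^ 2 * (a ^ 2 / (1 - (a ^ 2 * r ^ 2) ^ 2)))) with hp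
  have hPd : ∀ c : ℂ, ∀ r ∈ Icc (0 : ℝ) 1, HasDerivAt (P c) (p c r) r := by
    intro c r hr
    have hu : HasDerivAt (fun x : ℝ => (a * x ^ 2 : ℂ)) (a * (2 * r)) r := by
      have h : HasDerivAt (fun x : ℝ => a * x ^ 2) (a * (2 * r)) r := by
        simpa using (hasDerivAt_pow 2 r).const_mul a
      have := h.ofReal_comp
      push_cast at this
      exact this
    have h1 := (hs _ (hmem r hr)).comp r hu
    have h2 := (hs _ (hmem' r hr)).comp r hu.neg
    have h3 := (h1.sub h2).const_mul ((starRingEnd ℂ) c)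
    have h4 := ((Complex.reCLM.hasFDerivAt.comp_hasDerivAt r h3)).const_mul π
    have hq : HasDerivAt (fun x : ℝ => a ^ 2 * x ^ 2) (a ^ 2 * (2 * r)) r := by
      simpa using (hasDerivAt_pow 2 r).const_mul (a ^ 2)
    have hpos1 : 1 + a ^ 2 * r ^ 2 ≠ 0 := by positivity
    have hpos2 : 1 - a ^ 2 * r ^ 2 ≠ 0 := by linarith [hlt r hr]
    have h5 := ((((hq.const_add 1).log hpos1).sub ((hq.const_sub 1).log hpos2)).div_const
      2).const_mul (π * ‖c‖ ^ 2)
    refine (h4.sub h5).congr_deriv ?_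
    simp only [hp, Complex.reCLM_apply]
    have e1 : (starRingEnd ℂ) c * (g (a * r ^ 2) * (a * (2 * r)) -
        g (-(a * r ^ 2)) * -(a * (2 * r))) = ((2 * r : ℝ) : ℂ) *
          ((starRingEnd ℂ) c * (a * (g (a * r ^ 2) + g (-(a * r ^ 2))))) := by
      push_cast; ring
    rw [e1, Complex.re_ofReal_mul]
    have hpos3 : 1 - (a ^ 2 * r ^ 2) ^ 2 ≠ 0 := by
      rw [show 1 - (a ^ 2 * r ^ 2) ^ 2 = (1 + a ^ 2 * r ^ 2) * (1 - a ^ 2 * r ^ 2) by ring]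
      exact mul_ne_zero hpos1 hpos2
    have e2 : a ^ 2 * (2 * r) / (1 + a ^ 2 * r ^ 2) - -(a ^ 2 * (2 * r)) / (1 - a ^ 2 * r ^ 2) =
        4 * r * (a ^ 2 / (1 - (a ^ 2 * r ^ 2) ^ 2)) := by
      rw [show 1 - (a ^ 2 * r ^ 2) ^ 2 = (1 + a ^ 2 * r ^ 2) * (1 - a ^ 2 * r ^ 2) by ring]
      field_simp
      ring
    rw [e2]
    ring
  have hpc : ∀ c : ℂ, ContinuousOn (p c) (Icc 0 1) := by
    intro c
    have hg1 : ContinuousOn (fun r : ℝ => g (a * r ^ 2)) (Icc 0 1) :=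
      hg.continuousOn.comp (by fun_prop) hmem
    have hg2 : ContinuousOn (fun r : ℝ => g (-(a * r ^ 2))) (Icc 0 1) :=
      hg.continuousOn.comp (by fun_prop) hmem'
    have hd : ContinuousOn (fun r : ℝ => a ^ 2 / (1 - (a ^ 2 * r ^ 2) ^ 2)) (Icc 0 1) := by
      refine ContinuousOn.div (by fun_prop) (by fun_prop) fun r hr => ?_
      have h1 := hlt r hr
      have h2 : 0 ≤ a ^ 2 * r ^ 2 := by positivity
      nlinarith
    refine continuousOn_id.mul (continuousOn_const.mul ((Complex.continuous_re.comp_continuousOn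
      (continuousOn_const.mul (continuousOn_const.mul (hg1.add hg2)))).sub
        (continuousOn_const.mul hd)))
  have hle : ∀ c : ℂ, ∀ ρ : ℝ, 0 < ρ → ρ < 1 → P c ρ ≤ C := by
    intro c ρ hρ hρ1
    have hsubI : Icc 0 ρ ⊆ Icc (0 : ℝ) 1 := Icc_subset_Icc_right hρ1.le
    have hP0 : P c 0 = 0 := by simp [hP]
    have hFTC : ∫ r in (0 : ℝ)..ρ, p c r = P c ρ := by
      rw [intervalIntegral.integral_eq_sub_of_hasDerivAt
        (fun r hr => hPd c r (hsubI (by rwa [uIcc_of_le hρ.le] at hr))), hP0, sub_zero]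
      exact ContinuousOn.intervalIntegrable (by
        rw [uIcc_of_le hρ.le]; exact (hpc c).mono hsubI)
    have hcg : ContinuousOn (fun z => ‖g z‖ ^ 2) {z : ℂ | 0 ≤ ‖z‖ ∧ ‖z‖ ≤ ρ} := by
      refine (hg.continuousOn.mono fun z hz => ?_).norm.pow 2
      exact mem_ball_zero_iff.2 (hz.2.trans_lt hρ1)
    have h := hC ρ hρ hρ1
    unfold annulus at h
    rw [setIntegral_annulus_eq_circleAverage le_rfl hρ.le hcg] at h
    refine le_trans ?_ h
    rw [← hFTC]
    refine intervalIntegral.integral_mono_on hρ.le ?_ ?_ fun r hr => ?_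
    · exact ContinuousOn.intervalIntegrable (by
        rw [uIcc_of_le hρ.le]; exact (hpc c).mono hsubI)
    · refine ContinuousOn.intervalIntegrable ?_
      rw [uIcc_of_le hρ.le]
      exact continuousOn_id.mul (continuousOn_const.mul
        (continuousOn_circleAverage_annulus le_rfl hcg))
    · rcases hr.1.eq_or_lt with h0 | h0
      · simp [hp, ← h0]
      · have := circleAverage_norm_sq_ge hg ha ha1 h0 (hr.2.trans_lt hρ1) c
        simp only [hp]
        gcongr
  have hle1 : ∀ c : ℂ, P c 1 ≤ C := by
    intro c
    have hcont : ContinuousWithinAt (P c) (Ioo 0 1) 1 :=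
      (hPd c 1 ⟨zero_le_one, le_rfl⟩).continuousAt.continuousWithinAt
    have hcl : (1 : ℝ) ∈ closure (Ioo (0 : ℝ) 1) := by
      rw [closure_Ioo zero_ne_one]; exact ⟨zero_le_one, le_rfl⟩
    have := mem_closure_iff_nhdsWithin_neBot.1 hcl
    exact le_of_tendsto hcont (eventually_mem_nhdsWithin.mono fun ρ hρ => hle c ρ hρ.1 hρ.2)
  -- this value of `c` maximizes `P c 1`
  have hfin := hle1 ((2 / Λ : ℝ) * s a)
  simp only [hP] at hfin
  have hlog : Real.log (1 + a ^ 2 * 1 ^ 2) - Real.log (1 - a ^ 2 * 1 ^ 2) = Λ := by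
    rw [hΛ, Real.log_div (by positivity) (by linarith)]; simp
  rw [hlog] at hfin
  have e3 : ((starRingEnd ℂ) ((2 / Λ : ℝ) * s a) *
      (s (a * (1 : ℝ) ^ 2) - s (-(a * (1 : ℝ) ^ 2)))).re = 4 / Λ * ‖s a‖ ^ 2 := by
    have : (starRingEnd ℂ) ((2 / Λ : ℝ) * s a) * (s (a * (1 : ℝ) ^ 2) - s (-(a * (1 : ℝ) ^ 2))) =
        ((4 / Λ * ‖s a‖ ^ 2 : ℝ) : ℂ) := by
      rw [Complex.ofReal_one, one_pow, mul_one, hodd, map_mul, Complex.conj_ofReal]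
      have h := Complex.mul_conj (s a)
      rw [Complex.normSq_eq_norm_sq] at h
      push_cast at h ⊢
      linear_combination (4 / (Λ : ℂ)) * h
    rw [this, Complex.ofReal_re]
  rw [e3, norm_mul, Complex.norm_real, Real.norm_of_nonneg (by positivity)] at hfin
  have e4 : π * (4 / Λ * ‖s a‖ ^ 2) - π * (2 / Λ * ‖s a‖) ^ 2 * (Λ / 2) =
      π * (2 * ‖s a‖ ^ 2) / Λ := by
    field_simp
    ring
  rw [e4, div_le_iff₀ hΛ0] at hfin
  rw [← mul_div_assoc, le_div_iff₀ Real.pi_pos]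
  linarith

/-! ### Univalent functions and logarithms -/

/-- An injective holomorphic function has no critical point. The inverse function is continuous by
the open mapping theorem and holomorphic away from an isolated point, hence holomorphic. -/
theorem deriv_ne_zero_of_injOn {f : ℂ → ℂ} {U : Set ℂ} (hU : IsOpen U)
    (hf : DifferentiableOn ℂ f U) (hinj : InjOn f U) {z₀ : ℂ} (hz₀ : z₀ ∈ U) :
    deriv f z₀ ≠ 0 := by
  intro h0
  have hfa : AnalyticAt ℂ f z₀ := hf.analyticAt (hU.mem_nhds hz₀)
  -- a connected neighbourhood on which `z₀` is the only critical point
  have hev : ∀ᶠ z in 𝓝[≠] z₀, deriv f z ≠ 0 := by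
    rcases hfa.deriv.eventually_eq_zero_or_eventually_ne_zero with h | h
    · exfalso
      obtain ⟨ε, hε, hball⟩ := Metric.eventually_nhds_iff_ball.1 (h.and (hU.mem_nhds hz₀))
      have hz₁ : z₀ + (ε / 2 : ℝ) ∈ Metric.ball z₀ ε := by
        rw [Metric.mem_ball, dist_eq_norm, add_sub_cancel_left, Complex.norm_real,
          Real.norm_of_nonneg (by positivity)]
        linarith
      have := hinj (hball _ hz₁).2 hz₀ (Metric.isOpen_ball.is_const_of_deriv_eq_zero
        (convex_ball z₀ ε).isPreconnected (hf.mono fun z hz => (hball z hz).2)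
        (fun z hz => (hball z hz).1) hz₁ (Metric.mem_ball_self hε))
      rw [add_eq_left] at this
      have h2 : (ε / 2 : ℝ) = 0 := by exact_mod_cast this
      linarith
    · exact h
  rw [eventually_nhdsWithin_iff] at hev
  obtain ⟨ε, hε, hball⟩ := Metric.eventually_nhds_iff_ball.1 (hev.and (hU.mem_nhds hz₀))
  set B := Metric.ball z₀ ε with hB
  have hBU : B ⊆ U := fun z hz => (hball z hz).2
  have hinjB := hinj.mono hBU
  have hopen : ∀ O ⊆ B, IsOpen O → IsOpen (f '' O) := by
    intro O hO hOo
    have han : AnalyticOnNhd ℂ f B := (hf.mono hBU).analyticOnNhd Metric.isOpen_ball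
    rcases han.is_constant_or_isOpen (convex_ball z₀ ε).isPreconnected with ⟨w, hw⟩ | h
    · exfalso
      have hz₁ : z₀ + (ε / 2 : ℝ) ∈ B := by
        rw [hB, Metric.mem_ball, dist_eq_norm, add_sub_cancel_left, Complex.norm_real,
          Real.norm_of_nonneg (by positivity)]
        linarith
      have := hinjB hz₁ (Metric.mem_ball_self hε)
        ((hw _ hz₁).trans (hw _ (Metric.mem_ball_self hε)).symm)
      rw [add_eq_left] at this
      have h2 : (ε / 2 : ℝ) = 0 := by exact_mod_cast this
      linarith
    · exact h O hO hOo
  set g := Function.invFunOn f B with hg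
  have hgf : ∀ z ∈ B, g (f z) = z := fun z hz => hinjB.leftInvOn_invFunOn hz
  have hV : IsOpen (f '' B) := hopen B subset_rfl Metric.isOpen_ball
  have hgcont : ∀ v ∈ f '' B, ContinuousAt g v := by
    rintro _ ⟨z, hz, rfl⟩
    rw [ContinuousAt, hgf z hz]
    intro O hO
    obtain ⟨O', hO', hO'o, hzO'⟩ := mem_nhds_iff.1 hO
    have : f '' (O' ∩ B) ∈ 𝓝 (f z) :=
      (hopen _ inter_subset_right (hO'o.inter Metric.isOpen_ball)).mem_nhds
        ⟨z, ⟨hzO', hz⟩, rfl⟩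
    refine mem_map.2 (mem_of_superset this ?_)
    rintro _ ⟨z', ⟨hz'1, hz'2⟩, rfl⟩
    change g (f z') ∈ O
    rw [hgf z' hz'2]
    exact hO' hz'1
  have hgd : DifferentiableOn ℂ g (f '' B) := by
    refine (Complex.differentiableOn_compl_singleton_and_continuousAt_iff
      (hV.mem_nhds ⟨z₀, Metric.mem_ball_self hε, rfl⟩)).1
      ⟨?_, hgcont _ ⟨z₀, Metric.mem_ball_self hε, rfl⟩⟩
    rintro _ ⟨⟨z, hz, rfl⟩, hne⟩
    have hzne : z ≠ z₀ := fun h => hne (by rw [h]; rfl)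
    have hfd : HasDerivAt f (deriv f z) (g (f z)) := by
      rw [hgf z hz]
      exact (hf.differentiableAt (hU.mem_nhds (hBU hz))).hasDerivAt
    refine (HasDerivAt.of_local_left_inverse (hgcont _ ⟨z, hz, rfl⟩) hfd ((hball z hz).1 hzne)
      ?_).differentiableAt.differentiableWithinAt
    filter_upwards [hV.mem_nhds ⟨z, hz, rfl⟩]
    rintro _ ⟨z', hz', rfl⟩
    rw [hgf z' hz']
  have hfd₀ : HasDerivAt f (deriv f z₀) z₀ := hfa.differentiableAt.hasDerivAt
  have hgd₀ := (hgd.differentiableAt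
    (hV.mem_nhds ⟨z₀, Metric.mem_ball_self hε, rfl⟩)).hasDerivAt
  have hcomp := hgd₀.comp z₀ hfd₀
  have hid : HasDerivAt (g ∘ f) 1 z₀ := by
    refine (hasDerivAt_id z₀).congr_of_eventuallyEq ?_
    filter_upwards [Metric.ball_mem_nhds z₀ hε] with z hz
    exact hgf z hz
  have := hcomp.unique hid
  rw [h0, mul_zero] at this
  exact zero_ne_one this

/-- A nonvanishing holomorphic function on a disc has a holomorphic logarithm. -/
theorem exists_log_on_ball {u : ℂ → ℂ} {c : ℂ} {r : ℝ}
    (hu : DifferentiableOn ℂ u (Metric.ball c r)) (h0 : ∀ z ∈ Metric.ball c r, u z ≠ 0) :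
    ∃ ℓ : ℂ → ℂ, DifferentiableOn ℂ ℓ (Metric.ball c r) ∧
      ∀ z ∈ Metric.ball c r, Complex.exp (ℓ z) = u z := by
  rcases le_or_gt r 0 with hr | hr
  · refine ⟨0, ?_, ?_⟩ <;> simp [Metric.ball_eq_empty.2 hr]
  have hq : DifferentiableOn ℂ (fun z => deriv u z / u z) (Metric.ball c r) :=
    (hu.deriv Metric.isOpen_ball).div hu h0
  have hc : c ∈ Metric.ball c r := Metric.mem_ball_self hr
  obtain ⟨ℓ, hℓc, hℓ⟩ := hq.isExactOn_ball.with_val_at c (Complex.log (u c))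
  refine ⟨ℓ, fun z hz => (hℓ z hz).differentiableAt.differentiableWithinAt, fun z hz => ?_⟩
  have hd : ∀ z ∈ Metric.ball c r,
      HasDerivAt (fun z => u z * Complex.exp (-ℓ z)) 0 z := fun z hz => by
    have h1 := (hu.differentiableAt (Metric.isOpen_ball.mem_nhds hz)).hasDerivAt
    refine (h1.mul (hℓ z hz).neg.cexp).congr_deriv ?_
    have := h0 z hz
    simp only [Pi.neg_apply]
    field_simp
    ring
  have hconst := Metric.isOpen_ball.is_const_of_deriv_eq_zero
    (convex_ball c r).isPreconnected
    (fun z hz => (hd z hz).differentiableAt.differentiableWithinAt) (fun z hz => (hd z hz).deriv)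
    hz hc
  simp only [hℓc, Complex.exp_neg, Complex.exp_log (h0 c hc), mul_inv_cancel₀ (h0 c hc)] at hconst
  exact (mul_inv_eq_one₀ (Complex.exp_ne_zero _)).1 hconst |>.symm

/-! ### The half disc -/

/-- The open right half of the unit disc. -/
def halfDisc : Set ℂ := {ζ | ‖ζ‖ < 1 ∧ 0 < ζ.re}

/-- A conformal map of the right half of the unit disc onto the unit disc, vanishing at `a`. -/
def halfDiscMap (a : ℝ) (ζ : ℂ) : ℂ := ((ζ - a) * (1 + a * ζ)) / ((ζ + a) * (1 - a * ζ))

/-- The function `ζ / (1 - ζ²)` maps the half disc into the right half plane. -/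
theorem re_div_one_sub_sq_pos {ζ : ℂ} (hζ : ζ ∈ halfDisc) : 0 < (ζ / (1 - ζ ^ 2)).re := by
  have hn : ζ.re * ζ.re + ζ.im * ζ.im < 1 := by
    rw [← Complex.normSq_apply, Complex.normSq_eq_norm_sq]
    nlinarith [hζ.1, norm_nonneg ζ]
  have hre := hζ.2
  have hne : 1 - ζ ^ 2 ≠ 0 := by
    intro h
    have h1 := congrArg Complex.re h
    simp only [Complex.sub_re, Complex.one_re, sq, Complex.mul_re, Complex.zero_re] at h1
    nlinarith [mul_self_nonneg ζ.im]
  have hpos : 0 < Complex.normSq (1 - ζ ^ 2) := Complex.normSq_pos.2 hne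
  rw [Complex.div_re, ← add_div]
  refine div_pos ?_ hpos
  simp only [Complex.sub_re, Complex.sub_im, Complex.one_re, Complex.one_im, sq, Complex.mul_re,
    Complex.mul_im]
  nlinarith [mul_pos hre (sub_pos.2 hn)]

theorem halfDisc_injOn_div : InjOn (fun ζ : ℂ => ζ / (1 - ζ ^ 2)) halfDisc := by
  intro ζ hζ ζ' hζ' h
  have hne : ∀ ζ ∈ halfDisc, 1 - ζ ^ 2 ≠ 0 := by
    intro ζ hζ h0
    have := re_div_one_sub_sq_pos hζ
    simp [h0] at this
  simp only at h
  rw [div_eq_div_iff (hne ζ hζ) (hne ζ' hζ')] at h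
  have h1 : (ζ - ζ') * (1 + ζ * ζ') = 0 := by linear_combination h
  rcases mul_eq_zero.1 h1 with h2 | h2
  · exact sub_eq_zero.1 h2
  · exfalso
    have h3 : ‖ζ * ζ'‖ = 1 := by
      rw [eq_neg_of_add_eq_zero_right h2, norm_neg, norm_one]
    rw [norm_mul] at h3
    nlinarith [hζ.1, hζ'.1, norm_nonneg ζ, norm_nonneg ζ']

/-- `halfDiscMap a` is the composition of `ζ / (1 - ζ²)`, which maps the half disc conformally onto
the right half plane, with a Cayley transform. -/
theorem halfDiscMap_eq {a : ℝ} (ha : 0 < a) {ζ : ℂ} (hζ : ζ ∈ halfDisc) :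
    halfDiscMap a ζ =
      ((1 - a ^ 2) / a * (ζ / (1 - ζ ^ 2)) - 1) / ((1 - a ^ 2) / a * (ζ / (1 - ζ ^ 2)) + 1) := by
  have hne : 1 - ζ ^ 2 ≠ 0 := by
    intro h0
    have := re_div_one_sub_sq_pos hζ
    simp [h0] at this
  have haC : (a : ℂ) ≠ 0 := by exact_mod_cast ha.ne'
  have e1 : (1 - (a : ℂ) ^ 2) / a * (ζ / (1 - ζ ^ 2)) - 1 =
      ((ζ - a) * (1 + a * ζ)) / (a * (1 - ζ ^ 2)) := by
    field_simp; ring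
  have e2 : (1 - (a : ℂ) ^ 2) / a * (ζ / (1 - ζ ^ 2)) + 1 =
      ((ζ + a) * (1 - a * ζ)) / (a * (1 - ζ ^ 2)) := by
    field_simp; ring
  rw [e1, e2, div_div_div_cancel_right₀ (mul_ne_zero haC hne), halfDiscMap]

theorem norm_sub_one_div_add_one_lt {v : ℂ} (hv : 0 < v.re) : ‖(v - 1) / (v + 1)‖ < 1 := by
  have hne : v + 1 ≠ 0 := by
    intro h
    have := congrArg Complex.re h
    simp at this
    linarith
  rw [norm_div, div_lt_one (norm_pos_iff.2 hne)]
  refine lt_of_pow_lt_pow_left₀ 2 (norm_nonneg _) ?_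
  rw [← Complex.normSq_eq_norm_sq, ← Complex.normSq_eq_norm_sq, Complex.normSq_apply,
    Complex.normSq_apply]
  simp only [Complex.sub_re, Complex.sub_im, Complex.add_re, Complex.add_im, Complex.one_re,
    Complex.one_im]
  nlinarith

theorem re_one_add_div_one_sub_pos {w : ℂ} (hw : ‖w‖ < 1) : 0 < ((1 + w) / (1 - w)).re := by
  have hn : w.re * w.re + w.im * w.im < 1 := by
    rw [← Complex.normSq_apply, Complex.normSq_eq_norm_sq]
    nlinarith [norm_nonneg w]
  have hne : 1 - w ≠ 0 := by
    intro h
    rw [← sub_eq_zero.1 h] at hw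
    simp at hw
  have hpos : 0 < Complex.normSq (1 - w) := Complex.normSq_pos.2 hne
  rw [Complex.div_re, ← add_div]
  refine div_pos ?_ hpos
  simp only [Complex.sub_re, Complex.sub_im, Complex.add_re, Complex.add_im, Complex.one_re,
    Complex.one_im]
  nlinarith

/-- The solution `ζ` of `ζ / (1 - ζ²) = u` in the half disc, where `0 < re u`. -/
theorem half_disc_solution {u : ℂ} (hu : 0 < u.re) :
    1 + 4 * u ^ 2 ∈ Complex.slitPlane ∧
    1 + (1 + 4 * u ^ 2) ^ (1 / 2 : ℂ) ≠ 0 ∧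
    2 * u / (1 + (1 + 4 * u ^ 2) ^ (1 / 2 : ℂ)) ∈ halfDisc ∧
    (2 * u / (1 + (1 + 4 * u ^ 2) ^ (1 / 2 : ℂ))) /
      (1 - (2 * u / (1 + (1 + 4 * u ^ 2) ^ (1 / 2 : ℂ))) ^ 2) = u := by
  have hslit : 1 + 4 * u ^ 2 ∈ Complex.slitPlane := by
    rw [Complex.mem_slitPlane_iff]
    by_cases him : u.im = 0
    · left
      simp only [sq, Complex.add_re, Complex.one_re, Complex.mul_re, Complex.re_ofNat,
        Complex.im_ofNat, him]
      nlinarith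
    · right
      simp only [sq, Complex.add_im, Complex.one_im, Complex.mul_im, Complex.re_ofNat,
        Complex.im_ofNat]
      intro h
      have : u.re * u.im = 0 := by linarith
      rcases mul_eq_zero.1 this with h | h
      · exact hu.ne' h
      · exact him h
  set q := (1 + 4 * u ^ 2) ^ (1 / 2 : ℂ) with hq
  have hq2 : q ^ 2 = 1 + 4 * u ^ 2 := by
    rw [hq, ← Complex.cpow_nat_mul]
    norm_num
  have hqre : 0 < q.re := by
    have hne : 1 + 4 * u ^ 2 ≠ 0 := Complex.slitPlane_ne_zero hslit
    rw [hq, Complex.cpow_def_of_ne_zero hne, Complex.exp_re]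
    refine mul_pos (Real.exp_pos _) (Real.cos_pos_of_mem_Ioo ?_)
    have harg := Complex.mem_slitPlane_iff_arg.1 hslit
    have h1 := Complex.neg_pi_lt_arg (1 + 4 * u ^ 2)
    have h2 := lt_of_le_of_ne (Complex.arg_le_pi (1 + 4 * u ^ 2)) harg.1
    have : (Complex.log (1 + 4 * u ^ 2) * (1 / 2)).im = Complex.arg (1 + 4 * u ^ 2) / 2 := by
      rw [show (1 / 2 : ℂ) = ((1 / 2 : ℝ) : ℂ) by push_cast; rfl, mul_comm,
        Complex.im_ofReal_mul, Complex.log_im]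
      ring
    rw [this]
    constructor <;> linarith
  have h1q : 1 + q ≠ 0 := by
    intro h
    have := congrArg Complex.re h
    simp at this
    linarith
  have hu0 : u ≠ 0 := by rintro rfl; simp at hu
  set ζ := 2 * u / (1 + q) with hζ
  have hζre : 0 < ζ.re := by
    rw [hζ, Complex.div_re, ← add_div]
    refine div_pos ?_ (Complex.normSq_pos.2 h1q)
    have him := congrArg Complex.im hq2
    simp only [sq, Complex.add_im, Complex.one_im, Complex.mul_im, Complex.mul_re,
      Complex.re_ofNat, Complex.im_ofNat] at him
    simp only [Complex.add_re, Complex.add_im, Complex.one_re, Complex.one_im, Complex.mul_re,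
      Complex.mul_im, Complex.re_ofNat, Complex.im_ofNat]
    -- the imaginary parts of `q` and `u` have the same sign
    have hsign : 0 ≤ u.im * q.im := by
      have : q.re * q.im = 4 * (u.re * u.im) := by linarith
      by_contra! hneg
      have h3 : q.re * (u.im * q.im) = 4 * u.re * (u.im * u.im) := by linear_combination u.im * this
      nlinarith [mul_pos_of_neg_of_neg hneg (neg_lt_zero.2 hqre), mul_self_nonneg u.im,
        mul_nonneg hu.le (mul_self_nonneg u.im)]
    nlinarith [mul_pos hu hqre]
  have hζ0 : ζ ≠ 0 := by
    intro h; rw [h] at hζre; simp at hζre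
  have heq : ζ = u * (1 - ζ ^ 2) := by
    rw [hζ]
    field_simp
    linear_combination (-1 : ℂ) * hq2
  have hinv : ζ⁻¹ - ζ = u⁻¹ := by
    have h1 : 1 - ζ ^ 2 ≠ 0 := by
      intro h; rw [h, mul_zero] at heq; exact hζ0 heq
    have : u⁻¹ = (1 - ζ ^ 2) / ζ := by
      rw [inv_eq_iff_eq_inv, inv_div, eq_div_iff h1]; exact heq.symm
    rw [this]; field_simp
  have hζn : ‖ζ‖ < 1 := by
    have h1 := congrArg Complex.re hinv
    rw [Complex.sub_re, Complex.inv_re, Complex.inv_re] at h1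
    have h2 : 0 < u.re / Complex.normSq u := div_pos hu (Complex.normSq_pos.2 hu0)
    rw [← h1] at h2
    have hpos := Complex.normSq_pos.2 hζ0
    have h3 : ζ.re < ζ.re / Complex.normSq ζ := by linarith
    rw [lt_div_iff₀ hpos] at h3
    have h4 : Complex.normSq ζ < 1 := by nlinarith
    rw [Complex.normSq_eq_norm_sq] at h4
    nlinarith [norm_nonneg ζ]
  refine ⟨hslit, h1q, ⟨hζn, hζre⟩, ?_⟩
  have h1 : 1 - ζ ^ 2 ≠ 0 := by
    intro h; rw [h, mul_zero] at heq; exact hζ0 heq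
  rw [div_eq_iff h1]; exact heq

/-- The holomorphic inverse of `halfDiscMap a`. -/
theorem exists_halfDiscMap_inverse {a : ℝ} (ha : 0 < a) (ha1 : a < 1) :
    ∃ τ : ℂ → ℂ, DifferentiableOn ℂ τ (Metric.ball 0 1) ∧
      (∀ w ∈ Metric.ball (0 : ℂ) 1, τ w ∈ halfDisc ∧ halfDiscMap a (τ w) = w) ∧
      ∀ ζ ∈ halfDisc, halfDiscMap a ζ ∈ Metric.ball (0 : ℂ) 1 ∧ τ (halfDiscMap a ζ) = ζ := by
  have hb : 0 < (1 - a ^ 2) / a := div_pos (by nlinarith) ha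
  set b : ℝ := (1 - a ^ 2) / a with hbdef
  have hbC : (b : ℂ) ≠ 0 := by exact_mod_cast hb.ne'
  have hbeq : (1 - (a : ℂ) ^ 2) / a = b := by rw [hbdef]; push_cast; ring
  set u : ℂ → ℂ := fun w => (1 + w) / (1 - w) / b with hu
  have hure : ∀ w ∈ Metric.ball (0 : ℂ) 1, 0 < (u w).re := by
    intro w hw
    rw [mem_ball_zero_iff] at hw
    simp only [hu, Complex.div_ofReal_re]
    exact div_pos (re_one_add_div_one_sub_pos hw) hb
  have h1w : ∀ w ∈ Metric.ball (0 : ℂ) 1, 1 - w ≠ 0 := by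
    intro w hw h
    rw [mem_ball_zero_iff, ← sub_eq_zero.1 h] at hw
    simp at hw
  set τ : ℂ → ℂ := fun w => 2 * u w / (1 + (1 + 4 * (u w) ^ 2) ^ (1 / 2 : ℂ)) with hτ
  have hmain : ∀ w ∈ Metric.ball (0 : ℂ) 1, τ w ∈ halfDisc ∧ halfDiscMap a (τ w) = w := by
    intro w hw
    obtain ⟨-, -, h1, h2⟩ := half_disc_solution (hure w hw)
    refine ⟨h1, ?_⟩
    rw [halfDiscMap_eq ha h1, hbeq]
    have h3 : τ w / (1 - τ w ^ 2) = u w := h2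
    rw [h3]
    have h4 := h1w w hw
    have h5 : (b : ℂ) * u w = (1 + w) / (1 - w) := by rw [hu]; field_simp
    rw [h5, div_sub_one h4, div_add_one h4, div_div_div_cancel_right₀ h4]
    ring
  have hmaps : ∀ ζ ∈ halfDisc, halfDiscMap a ζ ∈ Metric.ball (0 : ℂ) 1 := by
    intro ζ hζ
    rw [mem_ball_zero_iff, halfDiscMap_eq ha hζ, hbeq]
    apply norm_sub_one_div_add_one_lt
    rw [Complex.re_ofReal_mul]
    exact mul_pos hb (re_div_one_sub_sq_pos hζ)
  refine ⟨τ, ?_, hmain, fun ζ hζ => ⟨hmaps ζ hζ, ?_⟩⟩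
  · intro w hw
    obtain ⟨h1, h2, -, -⟩ := half_disc_solution (hure w hw)
    have hud : DifferentiableAt ℂ u w := by
      have := h1w w hw
      simp only [hu]
      fun_prop (disch := assumption)
    refine DifferentiableAt.differentiableWithinAt ?_
    refine DifferentiableAt.div (hud.const_mul 2) ?_ h2
    refine DifferentiableAt.const_add _ ?_
    exact DifferentiableAt.cpow (((hud.pow 2).const_mul 4).const_add 1)
      (differentiableAt_const _) h1
  · obtain ⟨h1, h2⟩ := hmain _ (hmaps ζ hζ)
    generalize τ (halfDiscMap a ζ) = ζ' at h1 h2 ⊢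
    apply halfDisc_injOn_div h1 hζ
    rw [halfDiscMap_eq ha h1, halfDiscMap_eq ha hζ, hbeq] at h2
    set v₁ := (b : ℂ) * (ζ' / (1 - ζ' ^ 2)) with hv1
    set v₂ := (b : ℂ) * (ζ / (1 - ζ ^ 2)) with hv2
    have hr1 : v₁ + 1 ≠ 0 := by
      intro h
      have h3 := congrArg Complex.re h
      have h4 := mul_pos hb (re_div_one_sub_sq_pos h1)
      rw [Complex.add_re, hv1, Complex.re_ofReal_mul, Complex.one_re, Complex.zero_re] at h3
      linarith
    have hr2 : v₂ + 1 ≠ 0 := by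
      intro h
      have h3 := congrArg Complex.re h
      have h4 := mul_pos hb (re_div_one_sub_sq_pos hζ)
      rw [Complex.add_re, hv2, Complex.re_ofReal_mul, Complex.one_re, Complex.zero_re] at h3
      linarith
    rw [div_eq_div_iff hr1 hr2] at h2
    have h5 : v₁ = v₂ := by linear_combination h2 / 2
    exact mul_left_cancel₀ hbC h5

/-! ### Dirichlet integrals over the half disc -/

open MeasureTheory Real in
/-- The Dirichlet integral over the half disc of a function `s` such that
`halfDiscMap a · e^s` is univalent and Bieberbach–Eilenberg. -/
theorem lintegral_halfDisc_le {a : ℝ} (ha : 0 < a) (ha1 : a < 1) {s : ℂ → ℂ}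
    (hs : DifferentiableOn ℂ s (Metric.ball 0 1))
    (hinj : InjOn (fun ζ => halfDiscMap a ζ * Complex.exp (s ζ)) halfDisc)
    (hBE : ∀ ζ₁ ∈ halfDisc, ∀ ζ₂ ∈ halfDisc, (halfDiscMap a ζ₁ * Complex.exp (s ζ₁)) *
      (halfDiscMap a ζ₂ * Complex.exp (s ζ₂)) ≠ 1) :
    (s a).re ≤ 0 ∧ ∫⁻ ζ in halfDisc, ENNReal.ofReal (‖deriv s ζ‖ ^ 2) ≤
      ENNReal.ofReal (2 * π * -(s a).re) := by
  obtain ⟨τ, hτd, hτ, hτ'⟩ := exists_halfDiscMap_inverse ha ha1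
  have hH : ∀ w ∈ Metric.ball (0 : ℂ) 1, τ w ∈ Metric.ball (0 : ℂ) 1 := fun w hw =>
    mem_ball_zero_iff.2 (hτ w hw).1.1
  have haH : (a : ℂ) ∈ halfDisc := by
    refine ⟨?_, by simpa using ha⟩
    rw [Complex.norm_real, Real.norm_of_nonneg ha.le]; exact ha1
  have hT0 : halfDiscMap a a = 0 := by simp [halfDiscMap]
  have hτ0 : τ 0 = a := by
    have := (hτ' a haH).2
    rwa [hT0] at this
  set S : ℂ → ℂ := fun w => s (τ w) with hS
  have hSd : DifferentiableOn ℂ S (Metric.ball 0 1) := hs.comp hτd hH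
  have hN : ∀ w ∈ Metric.ball (0 : ℂ) 1,
      w * Complex.exp (S w) = halfDiscMap a (τ w) * Complex.exp (s (τ w)) := fun w hw => by
    rw [(hτ w hw).2]
  have hτinj : InjOn τ (Metric.ball 0 1) := fun w hw w' hw' h => by
    rw [← (hτ w hw).2, h, (hτ w' hw').2]
  have hNinj : InjOn (fun w => w * Complex.exp (S w)) (Metric.ball 0 1) := by
    intro w hw w' hw' h
    simp only [hN w hw, hN w' hw'] at h
    exact hτinj hw hw' (hinj (hτ w hw).1 (hτ w' hw').1 h)
  have hNBE : ∀ w₁ ∈ Metric.ball (0 : ℂ) 1, ∀ w₂ ∈ Metric.ball (0 : ℂ) 1,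
      (w₁ * Complex.exp (S w₁)) * (w₂ * Complex.exp (S w₂)) ≠ 1 := by
    intro w hw w' hw'
    rw [hN w hw, hN w' hw']
    exact hBE _ (hτ w hw).1 _ (hτ w' hw').1
  -- the area inequality on small annuli, up to `η`
  have hbound : ∀ η : ℝ, 0 < η → ∃ δ₀ : ℝ, 0 < δ₀ ∧ ∀ δ ρ : ℝ, 0 < δ → δ < δ₀ → δ < ρ → ρ < 1 →
      ∫ w in annulus δ ρ, ‖deriv S w‖ ^ 2 ≤
        2 * π * (-(s a).re + 2 * η - Real.log ρ) := by
    intro η hη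
    have hc : ContinuousAt S 0 := (hSd.differentiableAt
      (Metric.isOpen_ball.mem_nhds (Metric.mem_ball_self one_pos))).continuousAt
    have hev : ∀ᶠ w in 𝓝 (0 : ℂ), (s a).re - η < (S w).re := by
      have h : ContinuousAt (fun w => (S w).re) 0 := Complex.continuous_re.continuousAt.comp hc
      have h0 : (S 0).re = (s a).re := by simp only [hS, hτ0]
      exact h.eventually (lt_mem_nhds (by change _ < (S 0).re; rw [h0]; linarith))
    obtain ⟨δ₀, hδ₀, hball⟩ := Metric.eventually_nhds_iff_ball.1 hev
    refine ⟨δ₀, hδ₀, fun δ ρ hδ hδδ₀ hδρ hρ => ?_⟩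
    have h := integral_annulus_norm_deriv_sq_le hSd hNinj hNBE hδ hδρ hρ
      (m := δ * Real.exp ((s a).re - 2 * η)) (m₁ := δ * Real.exp ((s a).re - η))
      (by positivity) (by gcongr; linarith) (fun w hw => by
        rw [norm_mul, hw, Complex.norm_exp]
        have : w ∈ Metric.ball (0 : ℂ) δ₀ := by rw [mem_ball_zero_iff, hw]; exact hδδ₀
        have := (hball w this).le
        gcongr)
    refine h.trans (le_of_eq ?_)
    rw [← div_div, div_self hδ.ne', one_div, ← Real.exp_neg, Real.log_exp]
    ring
  set A : ℕ → Set ℂ := fun n => annulus (1 / ((n : ℝ) + 2)) (1 - 1 / ((n : ℝ) + 2)) with hA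
  have hAmono : Monotone A := by
    intro n m hnm z hz
    have : 1 / ((m : ℝ) + 2) ≤ 1 / ((n : ℝ) + 2) := by gcongr
    exact ⟨this.trans_lt hz.1, hz.2.trans_le (by linarith)⟩
  have hAb : ∀ n, A n ⊆ Metric.ball (0 : ℂ) 1 := fun n z hz => by
    rw [mem_ball_zero_iff]
    have : 0 < 1 / ((n : ℝ) + 2) := by positivity
    linarith [hz.2]
  have hτ1 : ∀ w ∈ Metric.ball (0 : ℂ) 1, HasDerivAt τ (deriv τ w) w := fun w hw =>
    (hτd.differentiableAt (Metric.isOpen_ball.mem_nhds hw)).hasDerivAt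
  have hchain : ∀ w ∈ Metric.ball (0 : ℂ) 1, deriv S w = deriv s (τ w) * deriv τ w := by
    intro w hw
    have h1 : HasDerivAt s (deriv s (τ w)) (τ w) :=
      (hs.differentiableAt (Metric.isOpen_ball.mem_nhds (hH w hw))).hasDerivAt
    exact (h1.comp w (hτ1 w hw)).deriv
  have hIn : ∀ n, ∫⁻ ζ in τ '' A n, ENNReal.ofReal (‖deriv s ζ‖ ^ 2) =
      ENNReal.ofReal (∫ w in A n, ‖deriv S w‖ ^ 2) := by
    intro n
    rw [setLIntegral_image_of_hasDerivAt (measurableSet_annulus _ _)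
      (fun w hw => hτ1 w (hAb n hw)) (hτinj.mono (hAb n))]
    have hK : IsCompact {z : ℂ | 1 / ((n : ℝ) + 2) ≤ ‖z‖ ∧ ‖z‖ ≤ 1 - 1 / ((n : ℝ) + 2)} := by
      refine (isCompact_closedBall (0 : ℂ) (1 - 1 / ((n : ℝ) + 2))).of_isClosed_subset
        ((isClosed_le continuous_const continuous_norm).inter
          (isClosed_le continuous_norm continuous_const)) fun z hz => ?_
      exact mem_closedBall_zero_iff.2 hz.2
    have hint : IntegrableOn (fun z : ℂ => ‖deriv S z‖ ^ 2) (A n) := by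
      refine IntegrableOn.mono_set (ContinuousOn.integrableOn_compact hK ?_)
        (fun z hz => ⟨hz.1.le, hz.2.le⟩)
      refine ((hSd.deriv Metric.isOpen_ball).continuousOn.mono fun z hz => ?_).norm.pow 2
      have : 0 < 1 / ((n : ℝ) + 2) := by positivity
      exact mem_ball_zero_iff.2 (hz.2.trans_lt (by linarith))
    rw [ofReal_integral_eq_lintegral_ofReal hint (Eventually.of_forall fun v => by positivity)]
    refine setLIntegral_congr_fun (measurableSet_annulus _ _) fun w hw => ?_
    rw [← ENNReal.ofReal_mul (by positivity), hchain w (hAb n hw), norm_mul]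
    congr 1
    ring
  have hevn : ∀ η : ℝ, 0 < η → ∀ᶠ n in atTop,
      ∫ w in A n, ‖deriv S w‖ ^ 2 ≤ 2 * π * (-(s a).re + 3 * η) := by
    intro η hη
    obtain ⟨δ₀, hδ₀, hb⟩ := hbound η hη
    have hlim : Tendsto (fun n : ℕ => 1 / ((n : ℝ) + 2)) atTop (𝓝 0) := by
      have := (tendsto_one_div_add_atTop_nhds_zero_nat (𝕜 := ℝ)).comp (tendsto_add_atTop_nat 1)
      refine this.congr fun n => ?_
      simp only [Function.comp_apply]
      push_cast
      ring
    have hlog : Tendsto (fun n : ℕ => -Real.log (1 - 1 / ((n : ℝ) + 2))) atTop (𝓝 0) := by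
      have h1 : Tendsto (fun n : ℕ => 1 - 1 / ((n : ℝ) + 2)) atTop (𝓝 1) := by
        simpa using hlim.const_sub 1
      have := ((Real.continuousAt_log one_ne_zero).tendsto.comp h1).neg
      simpa using this
    filter_upwards [hlim.eventually (gt_mem_nhds hδ₀),
      hlim.eventually (gt_mem_nhds (show (0 : ℝ) < 1 / 2 by norm_num)),
      hlog.eventually (gt_mem_nhds hη)] with n hn1 hn2 hn3
    have h0 : 0 < 1 / ((n : ℝ) + 2) := by positivity
    refine (hb _ (1 - 1 / ((n : ℝ) + 2)) h0 hn1 (by linarith) (by linarith)).trans ?_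
    have : (0 : ℝ) < 2 * π := by positivity
    gcongr
    linarith
  have hre : (s a).re ≤ 0 := by
    refine le_of_forall_pos_le_add fun ε hε => ?_
    obtain ⟨n, hn⟩ := (hevn (ε / 3) (by positivity)).exists
    have h0 : 0 ≤ ∫ w in A n, ‖deriv S w‖ ^ 2 := integral_nonneg fun w => by positivity
    have h1 : 0 ≤ -(s a).re + 3 * (ε / 3) := by
      by_contra! hneg
      have : 2 * π * (-(s a).re + 3 * (ε / 3)) < 0 := mul_neg_of_pos_of_neg (by positivity) hneg
      linarith
    linarith
  refine ⟨hre, ?_⟩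
  -- the images of the annuli exhaust the half disc, up to the point `a`
  have hcover : halfDisc ⊆ (⋃ n, τ '' A n) ∪ {(a : ℂ)} := by
    intro ζ hζ
    by_cases hζa : ζ = a
    · right; exact hζa
    left
    obtain ⟨hw, hτw⟩ := hτ' ζ hζ
    set w := halfDiscMap a ζ with hwdef
    have hw0 : w ≠ 0 := by
      intro h
      rw [h, hτ0] at hτw
      exact hζa hτw.symm
    rw [mem_ball_zero_iff] at hw
    have hwpos : 0 < ‖w‖ := norm_pos_iff.2 hw0
    obtain ⟨n, hn⟩ := exists_nat_one_div_lt (lt_min hwpos (sub_pos.2 hw))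
    refine mem_iUnion.2 ⟨n, w, ⟨?_, ?_⟩, hτw⟩
    · refine lt_of_le_of_lt ?_ (hn.trans_le (min_le_left _ _))
      gcongr; norm_num
    · have h1 : 1 / ((n : ℝ) + 2) ≤ 1 / ((n : ℝ) + 1) := by gcongr; norm_num
      have h2 := hn.trans_le (min_le_right _ _)
      linarith
  have hmono : Monotone fun n => τ '' A n := fun n m h => image_mono (hAmono h)
  have hle : ∀ η : ℝ, 0 < η → ∫⁻ ζ in halfDisc, ENNReal.ofReal (‖deriv s ζ‖ ^ 2) ≤
      ENNReal.ofReal (2 * π * (-(s a).re + 3 * η)) := by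
    intro η hη
    calc ∫⁻ ζ in halfDisc, ENNReal.ofReal (‖deriv s ζ‖ ^ 2)
        ≤ ∫⁻ ζ in (⋃ n, τ '' A n) ∪ {(a : ℂ)}, ENNReal.ofReal (‖deriv s ζ‖ ^ 2) :=
          lintegral_mono_set hcover
      _ ≤ (∫⁻ ζ in ⋃ n, τ '' A n, ENNReal.ofReal (‖deriv s ζ‖ ^ 2)) +
          ∫⁻ ζ in {(a : ℂ)}, ENNReal.ofReal (‖deriv s ζ‖ ^ 2) := lintegral_union_le _ _ _
      _ = ∫⁻ ζ in ⋃ n, τ '' A n, ENNReal.ofReal (‖deriv s ζ‖ ^ 2) := by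
          rw [Measure.restrict_singleton]; simp
      _ ≤ ENNReal.ofReal (2 * π * (-(s a).re + 3 * η)) := by
          rw [setLIntegral_iUnion_of_directed _ hmono.directed_le]
          refine iSup_le fun n => ?_
          obtain ⟨m, hnm, hm⟩ := ((eventually_ge_atTop n).and (hevn η hη)).exists
          calc ∫⁻ ζ in τ '' A n, ENNReal.ofReal (‖deriv s ζ‖ ^ 2)
              ≤ ∫⁻ ζ in τ '' A m, ENNReal.ofReal (‖deriv s ζ‖ ^ 2) :=
                lintegral_mono_set (hmono hnm)
            _ ≤ _ := by
                rw [hIn m]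
                exact ENNReal.ofReal_le_ofReal hm
  have hlim : Tendsto (fun η : ℝ => ENNReal.ofReal (2 * π * (-(s a).re + 3 * η))) (𝓝[>] 0)
      (𝓝 (ENNReal.ofReal (2 * π * -(s a).re))) := by
    have : Continuous fun η : ℝ => ENNReal.ofReal (2 * π * (-(s a).re + 3 * η)) :=
      ENNReal.continuous_ofReal.comp (by fun_prop)
    have h := this.tendsto 0
    simp only [mul_zero, add_zero] at h
    exact h.mono_left nhdsWithin_le_nhds
  exact ge_of_tendsto hlim (eventually_mem_nhdsWithin.mono fun η hη => hle η hη)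

open MeasureTheory Real in
/-- The Dirichlet integral over the disc of an odd function, in terms of the half disc. -/
theorem integral_annulus_le_of_odd {s : ℂ → ℂ} (hs : DifferentiableOn ℂ s (Metric.ball 0 1))
    (hodd : ∀ z ∈ Metric.ball (0 : ℂ) 1, s (-z) = -s z) {B : ℝ} (hB : 0 ≤ B)
    (hle : ∫⁻ ζ in halfDisc, ENNReal.ofReal (‖deriv s ζ‖ ^ 2) ≤ ENNReal.ofReal B)
    {ρ : ℝ} (hρ1 : ρ < 1) :
    ∫ z in annulus 0 ρ, ‖deriv s z‖ ^ 2 ≤ 2 * B := by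
  have hsd : ∀ z ∈ Metric.ball (0 : ℂ) 1, HasDerivAt s (deriv s z) z := fun z hz =>
    (hs.differentiableAt (Metric.isOpen_ball.mem_nhds hz)).hasDerivAt
  have heven : ∀ z ∈ Metric.ball (0 : ℂ) 1, deriv s (-z) = deriv s z := by
    intro z hz
    have hz' : -z ∈ Metric.ball (0 : ℂ) 1 := by
      rwa [mem_ball_zero_iff, norm_neg, ← mem_ball_zero_iff]
    have h1 : HasDerivAt (fun z => s (-z)) (deriv s (-z) * -1) z :=
      (hsd _ hz').comp z (hasDerivAt_neg z)
    have h2 : HasDerivAt (fun z => s (-z)) (-deriv s z) z := by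
      refine (hsd z hz).neg.congr_of_eventuallyEq ?_
      filter_upwards [Metric.isOpen_ball.mem_nhds hz] with x hx using hodd x hx
    have := h1.unique h2
    linear_combination -this
  have hHm : MeasurableSet halfDisc :=
    (measurableSet_lt measurable_norm measurable_const).inter
      (measurableSet_lt measurable_const Complex.measurable_re)
  have hreflect : ∫⁻ ζ in (fun z : ℂ => -z) '' halfDisc, ENNReal.ofReal (‖deriv s ζ‖ ^ 2) =
      ∫⁻ ζ in halfDisc, ENNReal.ofReal (‖deriv s ζ‖ ^ 2) := by
    rw [setLIntegral_image_of_hasDerivAt hHm (fun z _ => hasDerivAt_neg z)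
      (fun z _ z' _ h => neg_injective h)]
    refine setLIntegral_congr_fun hHm fun z hz => ?_
    simp only [norm_neg, norm_one, one_pow, ENNReal.ofReal_one, one_mul]
    rw [heven z (mem_ball_zero_iff.2 hz.1)]
  have hnull : volume {z : ℂ | z.re = 0} = 0 := by
    have h := Measure.addHaar_submodule (volume : Measure ℂ) (LinearMap.ker Complex.reLm) (by
      intro h
      have : (1 : ℂ) ∈ LinearMap.ker Complex.reLm := by rw [h]; trivial
      simp at this)
    exact h
  have hcover : annulus 0 ρ ⊆ (halfDisc ∪ (fun z : ℂ => -z) '' halfDisc) ∪ {z : ℂ | z.re = 0} := by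
    intro z hz
    have hz1 : ‖z‖ < 1 := hz.2.trans hρ1
    rcases lt_trichotomy z.re 0 with h | h | h
    · left; right
      exact ⟨-z, ⟨by rwa [norm_neg], by rw [Complex.neg_re]; linarith⟩, neg_neg z⟩
    · right; exact h
    · left; left; exact ⟨hz1, h⟩
  rw [integral_eq_lintegral_of_nonneg_ae (Eventually.of_forall fun z => by positivity)]
  · refine ENNReal.toReal_le_of_le_ofReal (by positivity) ?_
    calc ∫⁻ z in annulus 0 ρ, ENNReal.ofReal (‖deriv s z‖ ^ 2)
        ≤ ∫⁻ z in (halfDisc ∪ (fun z : ℂ => -z) '' halfDisc) ∪ {z : ℂ | z.re = 0},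
            ENNReal.ofReal (‖deriv s z‖ ^ 2) := lintegral_mono_set hcover
      _ ≤ ((∫⁻ z in halfDisc, ENNReal.ofReal (‖deriv s z‖ ^ 2)) +
            ∫⁻ z in (fun z : ℂ => -z) '' halfDisc, ENNReal.ofReal (‖deriv s z‖ ^ 2)) +
            ∫⁻ z in {z : ℂ | z.re = 0}, ENNReal.ofReal (‖deriv s z‖ ^ 2) :=
          (lintegral_union_le _ _ _).trans (add_le_add_left (lintegral_union_le _ _ _) _)
      _ ≤ ENNReal.ofReal (2 * B) := by
          rw [Measure.restrict_eq_zero.2 hnull, lintegral_zero_measure, add_zero, hreflect, two_mul,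
            ENNReal.ofReal_add hB hB]
          exact add_le_add hle hle
  · refine ContinuousOn.aestronglyMeasurable ?_ (measurableSet_annulus _ _)
    refine ((hs.deriv Metric.isOpen_ball).continuousOn.mono fun z hz => ?_).norm.pow 2
    exact mem_ball_zero_iff.2 (hz.2.trans hρ1)

/-! ### The argument of `z k'(z) / k(z)` -/

/-- The square root transform of a univalent function: `F ζ` is a square root of `k (ζ²)`. -/
theorem exists_sqrt_transform {k : ℂ → ℂ} (hk : DifferentiableOn ℂ k (Metric.ball 0 1))
    (hinj : InjOn k (Metric.ball 0 1)) (h0 : k 0 = 0) :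
    ∃ F : ℂ → ℂ, DifferentiableOn ℂ F (Metric.ball 0 1) ∧ InjOn F (Metric.ball 0 1) ∧
      (∀ ζ ∈ Metric.ball (0 : ℂ) 1, F ζ ^ 2 = k (ζ ^ 2)) ∧ ∀ ζ, F (-ζ) = -F ζ := by
  have hB0 : (0 : ℂ) ∈ Metric.ball (0 : ℂ) 1 := Metric.mem_ball_self one_pos
  have hu : DifferentiableOn ℂ (dslope k 0) (Metric.ball 0 1) :=
    (Complex.differentiableOn_dslope (Metric.isOpen_ball.mem_nhds hB0)).2 hk
  have hk' : ∀ z, z * dslope k 0 z = k z := fun z => by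
    have := sub_smul_dslope k 0 z
    rwa [sub_zero, h0, sub_zero, smul_eq_mul] at this
  have hune : ∀ z ∈ Metric.ball (0 : ℂ) 1, dslope k 0 z ≠ 0 := by
    intro z hz h
    by_cases hz0 : z = 0
    · rw [hz0, dslope_same] at h
      exact deriv_ne_zero_of_injOn Metric.isOpen_ball hk hinj hB0 h
    · refine hz0 (hinj hz hB0 ?_)
      rw [h0, ← hk' z, h, mul_zero]
  obtain ⟨ℓ, hℓd, hℓ⟩ := exists_log_on_ball hu hune
  have hsq : ∀ ζ ∈ Metric.ball (0 : ℂ) 1, ζ ^ 2 ∈ Metric.ball (0 : ℂ) 1 := by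
    intro ζ hζ
    rw [mem_ball_zero_iff] at hζ ⊢
    rw [norm_pow]
    exact pow_lt_one₀ (norm_nonneg _) hζ two_ne_zero
  have hFsq : ∀ ζ ∈ Metric.ball (0 : ℂ) 1,
      (ζ * Complex.exp (ℓ (ζ ^ 2) / 2)) ^ 2 = k (ζ ^ 2) := by
    intro ζ hζ
    rw [mul_pow, ← Complex.exp_nat_mul, ← hk' (ζ ^ 2), ← hℓ _ (hsq ζ hζ)]
    congr 2
    push_cast
    ring
  refine ⟨fun ζ => ζ * Complex.exp (ℓ (ζ ^ 2) / 2), ?_, ?_, hFsq, fun ζ => by simp⟩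
  · have : DifferentiableOn ℂ (fun ζ => ℓ (ζ ^ 2)) (Metric.ball 0 1) :=
      hℓd.comp (by fun_prop) hsq
    exact differentiableOn_id.mul (this.div_const 2).cexp
  · intro ζ₁ h₁ ζ₂ h₂ h
    have e : ζ₁ ^ 2 = ζ₂ ^ 2 := by
      refine hinj (hsq _ h₁) (hsq _ h₂) ?_
      rw [← hFsq _ h₁, ← hFsq _ h₂]
      exact congrArg (· ^ 2) h
    simp only [e] at h
    exact mul_right_cancel₀ (Complex.exp_ne_zero _) h

/-- The numerical fact behind the constant `0.91`. -/
theorem log_lt_pi {r : ℝ} (hr : 0 < r) (hr1 : r ≤ 0.91) :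
    Real.log ((1 + r) / (1 - r)) < Real.pi := by
  rw [Real.log_lt_iff_lt_exp (div_pos (by linarith) (by linarith)), div_lt_iff₀ (by linarith)]
  have h1 : (22 : ℝ) < Real.exp Real.pi := by
    have e : Real.exp 3.14 < Real.exp Real.pi := Real.exp_lt_exp.2 Real.pi_gt_d2
    have e2 : Real.exp 3.14 = Real.exp 1 ^ 3 * Real.exp 0.14 := by
      rw [← Real.exp_nat_mul, ← Real.exp_add]; norm_num
    have e3 : (1.14 : ℝ) ≤ Real.exp 0.14 := by
      have := Real.add_one_le_exp (0.14 : ℝ); linarith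
    have e4 : (2.718 : ℝ) ^ 3 ≤ Real.exp 1 ^ 3 := by
      have := Real.exp_one_gt_d9
      gcongr; linarith
    have e5 : (2.718 : ℝ) ^ 3 * 1.14 ≤ Real.exp 1 ^ 3 * Real.exp 0.14 := by gcongr
    rw [← e2] at e5
    exact (lt_of_lt_of_le (by norm_num) e5).trans e
  nlinarith

/-- For a univalent function `k` of the unit disc fixing `0`, the quotient `z k'(z) / k(z)` is not
a negative real number if `|z| ≤ 0.91`. In fact a continuous argument of this quotient is bounded by
`log ((1 + |z|) / (1 - |z|))`, which is less than `π`.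

Let `F` be the square root transform of `k` and `a² = r`. On the half disc, the function
`(F ζ - F a) / (F ζ + F a)` is univalent and Bieberbach–Eilenberg, because `F` is odd. Divided by
`halfDiscMap a`, it becomes `e^s` for an odd function `s` on the unit disc, and `e^(s a)` is a
positive multiple of `z k'(z) / k(z)` at `z = r`. The two estimates of the Dirichlet integral of
`s`, from above by the area inequality and from below in terms of `s a`, give
`|s a|² ≤ 2 Λ (-re (s a))` with `Λ = log ((1 + r) / (1 - r))`, hence `|im (s a)| ≤ Λ < π`. -/
theorem mul_deriv_ne_of_univalent_real {k : ℂ → ℂ} (hk : DifferentiableOn ℂ k (Metric.ball 0 1))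
    (hinj : InjOn k (Metric.ball 0 1)) (h0 : k 0 = 0) {r : ℝ} (hr : 0 < r) (hr1 : r ≤ 0.91)
    {c : ℝ} (hc : 0 < c) : (r : ℂ) * deriv k r ≠ -c * k r := by
  intro hcon
  obtain ⟨F, hF, hFinj, hFsq, hFodd⟩ := exists_sqrt_transform hk hinj h0
  set a := Real.sqrt r with ha_def
  have ha : 0 < a := Real.sqrt_pos.2 hr
  have ha2 : a ^ 2 = r := Real.sq_sqrt hr.le
  have ha1 : a < 1 := by nlinarith
  have hB0 : (0 : ℂ) ∈ Metric.ball (0 : ℂ) 1 := Metric.mem_ball_self one_pos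
  have haB : (a : ℂ) ∈ Metric.ball (0 : ℂ) 1 := by
    rw [mem_ball_zero_iff, Complex.norm_real, Real.norm_of_nonneg ha.le]; exact ha1
  have hneg : ∀ ζ ∈ Metric.ball (0 : ℂ) 1, -ζ ∈ Metric.ball (0 : ℂ) 1 := fun ζ hζ => by
    rwa [mem_ball_zero_iff, norm_neg, ← mem_ball_zero_iff]
  have hmaB := hneg _ haB
  have haC : (a : ℂ) ≠ 0 := by exact_mod_cast ha.ne'
  have haC2 : ((a : ℂ)) ^ 2 = r := by exact_mod_cast ha2
  have hF0 : F 0 = 0 := by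
    have := hFodd 0
    rw [neg_zero] at this
    exact self_eq_neg.1 this
  have hFa : F a ≠ 0 := fun h => haC (hFinj haB hB0 (by rw [h, hF0]))
  have hDd : ∀ b ∈ Metric.ball (0 : ℂ) 1, DifferentiableOn ℂ (dslope F b) (Metric.ball 0 1) :=
    fun b hb => (Complex.differentiableOn_dslope (Metric.isOpen_ball.mem_nhds hb)).2 hF
  have hDmul : ∀ b z, (z - b) * dslope F b z = F z - F b := fun b z => sub_smul_dslope F b z
  have hDne : ∀ b ∈ Metric.ball (0 : ℂ) 1, ∀ z ∈ Metric.ball (0 : ℂ) 1, dslope F b z ≠ 0 := by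
    intro b hb z hz h
    by_cases hzb : z = b
    · rw [hzb, dslope_same] at h
      exact deriv_ne_zero_of_injOn Metric.isOpen_ball hF hFinj hb h
    · refine hzb (hFinj hz hb ?_)
      rw [← sub_eq_zero, ← hDmul b z, h, mul_zero]
  have hF' : deriv F (-a) = deriv F a := by
    have h1 : (fun z => F (-z)) = fun z => -F z := funext hFodd
    have h2 := deriv_comp_neg F (a : ℂ)
    rw [h1, deriv.fun_neg] at h2
    linear_combination h2
  have hDneg : ∀ z, dslope F a (-z) = dslope F (-a) z := by
    intro z
    by_cases hz : z = -a
    · rw [hz, neg_neg, dslope_same, dslope_same, hF']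
    · have hza : z + a ≠ 0 := fun h => hz (eq_neg_of_add_eq_zero_left h)
      refine mul_left_cancel₀ hza ?_
      have e1 := hDmul a (-z)
      have e2 := hDmul (-a) z
      rw [hFodd] at e1 e2
      linear_combination -e1 - e2
  have hp : ∀ z ∈ Metric.ball (0 : ℂ) 1, 1 + a * z ≠ 0 := by
    intro z hz h
    have h1 : (a : ℂ) * z = -1 := by linear_combination h
    have h2 := congrArg norm h1
    rw [norm_mul, norm_neg, norm_one, Complex.norm_real, Real.norm_of_nonneg ha.le] at h2
    rw [mem_ball_zero_iff] at hz
    nlinarith [norm_nonneg z]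
  have hm : ∀ z ∈ Metric.ball (0 : ℂ) 1, 1 - a * z ≠ 0 := by
    intro z hz
    have := hp _ (hneg z hz)
    rwa [mul_neg, ← sub_eq_add_neg] at this
  -- the quotient of `(F z - F a) / (F z + F a)` by `halfDiscMap a z`, without its removable
  -- singularities
  set Q : ℂ → ℂ := fun z => dslope F a z / dslope F (-a) z * ((1 - a * z) / (1 + a * z)) with hQ
  have hQd : DifferentiableOn ℂ Q (Metric.ball 0 1) :=
    ((hDd _ haB).div (hDd _ hmaB) (hDne _ hmaB)).mul
      (DifferentiableOn.div (by fun_prop) (by fun_prop) hp)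
  have hQne : ∀ z ∈ Metric.ball (0 : ℂ) 1, Q z ≠ 0 := fun z hz =>
    mul_ne_zero (div_ne_zero (hDne _ haB z hz) (hDne _ hmaB z hz)) (div_ne_zero (hm z hz) (hp z hz))
  have hQQ : ∀ z ∈ Metric.ball (0 : ℂ) 1, Q z * Q (-z) = 1 := by
    intro z hz
    have h1 := hDneg z
    have h2 : dslope F (-a) (-z) = dslope F a z := by rw [← hDneg (-z), neg_neg]
    have := hDne _ haB z hz
    have := hDne _ hmaB z hz
    have := hp z hz
    have := hm z hz
    simp only [hQ, h1, h2, mul_neg, sub_neg_eq_add, ← sub_eq_add_neg]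
    field_simp
  have hQ0 : Q 0 = 1 := by
    have h1 : dslope F (-a) 0 = dslope F a 0 := by rw [← hDneg 0, neg_zero]
    simp [hQ, h1, hDne _ haB 0 hB0]
  obtain ⟨s₀, hs₀d, hs₀⟩ := exists_log_on_ball hQd hQne
  set s : ℂ → ℂ := fun z => s₀ z - s₀ 0 with hs_def
  have hsd : DifferentiableOn ℂ s (Metric.ball 0 1) := hs₀d.sub_const _
  have hs : ∀ z ∈ Metric.ball (0 : ℂ) 1, Complex.exp (s z) = Q z := fun z hz => by
    rw [hs_def, Complex.exp_sub, hs₀ z hz, hs₀ 0 hB0, hQ0, div_one]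
  have hs0 : s 0 = 0 := sub_self _
  have hodd : ∀ z ∈ Metric.ball (0 : ℂ) 1, s (-z) = -s z := by
    have hs'd : DifferentiableOn ℂ (fun z => s (-z)) (Metric.ball 0 1) :=
      hsd.comp (by fun_prop) hneg
    have htd : DifferentiableOn ℂ (fun z => s z + s (-z)) (Metric.ball 0 1) := hsd.add hs'd
    have hexp : ∀ z ∈ Metric.ball (0 : ℂ) 1, Complex.exp (s z + s (-z)) = 1 := fun z hz => by
      rw [Complex.exp_add, hs z hz, hs _ (hneg z hz), hQQ z hz]
    have hder : EqOn (deriv fun z => s z + s (-z)) 0 (Metric.ball 0 1) := by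
      intro z hz
      have hd := (htd.differentiableAt (Metric.isOpen_ball.mem_nhds hz)).hasDerivAt
      have h1 : HasDerivAt (fun _ : ℂ => (1 : ℂ)) _ z := hd.cexp.congr_of_eventuallyEq (by
        filter_upwards [Metric.isOpen_ball.mem_nhds hz] with x hx using (hexp x hx).symm)
      have h2 := h1.unique (hasDerivAt_const z (1 : ℂ))
      rw [hexp z hz, one_mul] at h2
      exact h2
    intro z hz
    have := Metric.isOpen_ball.is_const_of_deriv_eq_zero
      (convex_ball (0 : ℂ) 1).isPreconnected htd hder hz hB0
    simp only [neg_zero, hs0, add_zero] at this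
    linear_combination this
  have hHB : ∀ ζ ∈ halfDisc, ζ ∈ Metric.ball (0 : ℂ) 1 := fun ζ hζ => mem_ball_zero_iff.2 hζ.1
  have hFadd : ∀ ζ ∈ halfDisc, F ζ + F a ≠ 0 := by
    intro ζ hζ h
    have h1 : F ζ = F (-a) := by rw [hFodd]; linear_combination h
    have h2 := hFinj (hHB ζ hζ) hmaB h1
    have h3 := hζ.2
    rw [h2, Complex.neg_re, Complex.ofReal_re] at h3
    linarith
  have hM : ∀ ζ ∈ halfDisc,
      halfDiscMap a ζ * Complex.exp (s ζ) = (F ζ - F a) / (F ζ + F a) := by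
    intro ζ hζ
    have hζB := hHB ζ hζ
    have e1 := hDmul a ζ
    have e2 := hDmul (-a) ζ
    rw [hFodd, sub_neg_eq_add, sub_neg_eq_add] at e2
    have hζa : ζ + a ≠ 0 := by
      intro h
      refine hFadd ζ hζ ?_
      rw [← e2, h, zero_mul]
    have := hDne _ hmaB ζ hζB
    have : 1 + ζ * a ≠ 0 := by rw [mul_comm]; exact hp ζ hζB
    have : 1 - ζ * a ≠ 0 := by rw [mul_comm]; exact hm ζ hζB
    rw [hs ζ hζB, ← e1, ← e2]
    simp only [hQ, halfDiscMap]
    field_simp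
  have h := lintegral_halfDisc_le ha ha1 hsd (by
      intro ζ hζ ζ' hζ' h
      simp only [hM ζ hζ, hM ζ' hζ'] at h
      rw [div_eq_div_iff (hFadd ζ hζ) (hFadd ζ' hζ')] at h
      refine hFinj (hHB ζ hζ) (hHB ζ' hζ') (mul_left_cancel₀ hFa ?_)
      linear_combination h / 2)
    (by
      intro ζ hζ ζ' hζ' h
      rw [hM ζ hζ, hM ζ' hζ', div_mul_div_comm,
        div_eq_one_iff_eq (mul_ne_zero (hFadd ζ hζ) (hFadd ζ' hζ'))] at h
      have h1 : F a * (F ζ + F ζ') = 0 := by linear_combination -h / 2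
      have h2 : F ζ = F (-ζ') := by
        rw [hFodd]; linear_combination (mul_eq_zero.1 h1).resolve_left hFa
      have h3 := hFinj (hHB ζ hζ) (hneg _ (hHB ζ' hζ')) h2
      have h4 := hζ.2
      rw [h3, Complex.neg_re] at h4
      linarith [hζ'.2])
  have hX : 0 ≤ -(s a).re := by linarith [h.1]
  have hE := norm_sq_le_of_energy_le (hsd.deriv Metric.isOpen_ball)
    (fun z hz => (hsd.differentiableAt (Metric.isOpen_ball.mem_nhds hz)).hasDerivAt) ha ha1
    (hodd a haB) (C := 2 * (2 * Real.pi * -(s a).re)) (fun ρ _ hρ1 =>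
      integral_annulus_le_of_odd hsd hodd (by positivity) h.2 hρ1)
  rw [ha2] at hE
  have hΛ := log_lt_pi hr hr1
  have hΛ0 : 0 < Real.log ((1 + r) / (1 - r)) :=
    Real.log_pos ((one_lt_div (by linarith)).2 (by linarith))
  set Λ := Real.log ((1 + r) / (1 - r)) with hΛdef
  -- the bound for the imaginary part of `s a`
  have hdiv : 2 * (2 * Real.pi * -(s a).re) / Real.pi = 4 * -(s a).re := by
    field_simp; ring
  rw [hdiv, ← Complex.normSq_eq_norm_sq, Complex.normSq_apply] at hE
  have him : (s a).im ^ 2 < Real.pi ^ 2 := by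
    nlinarith [sq_nonneg ((s a).re + Λ)]
  have him' := abs_lt_of_sq_lt_sq him Real.pi_pos.le
  rw [abs_lt] at him'
  -- the exponential of `s a` is a negative real number
  have hval : Complex.exp (s a) = ((-c * ((1 - r) / (1 + r)) : ℝ) : ℂ) := by
    have hd1 : HasDerivAt F (deriv F a) a :=
      (hF.differentiableAt (Metric.isOpen_ball.mem_nhds haB)).hasDerivAt
    have hrB : (r : ℂ) ∈ Metric.ball (0 : ℂ) 1 := by
      rw [mem_ball_zero_iff, Complex.norm_real, Real.norm_of_nonneg hr.le]; linarith
    have hd2 : HasDerivAt k (deriv k ((a : ℂ) ^ 2)) ((a : ℂ) ^ 2) := by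
      rw [haC2]
      exact (hk.differentiableAt (Metric.isOpen_ball.mem_nhds hrB)).hasDerivAt
    have hd3 : HasDerivAt (fun z => k (z ^ 2)) _ (a : ℂ) := hd2.comp (a : ℂ) (hasDerivAt_pow 2 _)
    have hd4 : HasDerivAt (fun z => F z ^ 2) _ (a : ℂ) := hd3.congr_of_eventuallyEq (by
      filter_upwards [Metric.isOpen_ball.mem_nhds haB] with x hx using hFsq x hx)
    have e := (hd1.pow 2).unique hd4
    rw [haC2] at e
    simp only [Nat.cast_ofNat, Nat.add_one_sub_one, pow_one] at e
    have e3 : F a ^ 2 = k r := by rw [hFsq a haB, haC2]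
    have e4 : a * deriv F a = -c * F a := by
      refine mul_left_cancel₀ hFa ?_
      linear_combination a / 2 * e + hcon + c * e3 + deriv k r * haC2
    have e5 := hDmul (-a) a
    rw [hFodd, sub_neg_eq_add, sub_neg_eq_add] at e5
    have e6 : dslope F (-a) a = F a / a := by
      rw [eq_div_iff haC]; linear_combination e5 / 2
    have e7 : deriv F a = -c * F a / a := by
      rw [eq_div_iff haC]; linear_combination e4
    have hr' : (1 + r : ℂ) ≠ 0 := by
      have : (1 + r : ℝ) ≠ 0 := by linarith
      exact_mod_cast this
    rw [hs a haB]
    simp only [hQ, dslope_same, e6, e7]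
    have e8 : (a : ℂ) * a = r := by rw [← sq]; exact haC2
    rw [e8]
    push_cast
    field_simp
  have hc' : 0 < c * ((1 - r) / (1 + r)) := mul_pos hc (div_pos (by linarith) (by linarith))
  have him0 := congrArg Complex.im hval
  have hre0 := congrArg Complex.re hval
  rw [Complex.exp_im, Complex.ofReal_im] at him0
  rw [Complex.exp_re, Complex.ofReal_re] at hre0
  have hsin := (mul_eq_zero.1 him0).resolve_left (Real.exp_ne_zero _)
  rw [(Real.sin_eq_zero_iff_of_lt_of_lt him'.1 him'.2).1 hsin, Real.cos_zero, mul_one] at hre0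
  linarith [Real.exp_pos (s a).re]

/-- The version of `mul_deriv_ne_of_univalent_real` for a disc of any radius and any point of it. -/
theorem mul_deriv_ne_of_univalent {k : ℂ → ℂ} {R : ℝ}
    (hk : DifferentiableOn ℂ k (Metric.ball 0 R)) (hinj : InjOn k (Metric.ball 0 R))
    (h0 : k 0 = 0) {y : ℂ} (hy : y ≠ 0) (hyR : ‖y‖ ≤ 0.91 * R) {c : ℝ} (hc : 0 < c) :
    y * deriv k y ≠ -c * k y := by
  have hny : 0 < ‖y‖ := norm_pos_iff.2 hy
  have hR : 0 < R := by linarith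
  -- normalize the radius, and rotate `y` to the positive axis
  set r := ‖y‖ / R with hr
  have hr0 : 0 < r := by positivity
  have hr1 : r ≤ 0.91 := by rw [hr, div_le_iff₀ hR]; exact hyR
  set ω : ℂ := y / r with hω
  have hrC : (r : ℂ) ≠ 0 := by exact_mod_cast hr0.ne'
  have hω0 : ω ≠ 0 := div_ne_zero hy hrC
  have hωn : ‖ω‖ = R := by
    rw [hω, norm_div, Complex.norm_real, Real.norm_of_nonneg hr0.le, hr]
    field_simp
  have hωr : ω * r = y := by rw [hω]; field_simp
  have hmaps : ∀ z ∈ Metric.ball (0 : ℂ) 1, ω * z ∈ Metric.ball (0 : ℂ) R := by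
    intro z hz
    rw [mem_ball_zero_iff] at hz ⊢
    rw [norm_mul, hωn]
    nlinarith
  have hyB : y ∈ Metric.ball (0 : ℂ) R := by
    rw [mem_ball_zero_iff]; linarith
  have h := mul_deriv_ne_of_univalent_real (k := fun z => k (ω * z))
    (hk.comp (by fun_prop) hmaps)
    (fun z hz z' hz' e => mul_left_cancel₀ hω0 (hinj (hmaps z hz) (hmaps z' hz') e))
    (by simpa using h0) hr0 hr1 hc
  intro hcon
  refine h ?_
  have hd : HasDerivAt k (deriv k (ω * r)) (ω * r) := by
    rw [hωr]
    exact (hk.differentiableAt (Metric.isOpen_ball.mem_nhds hyB)).hasDerivAt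
  have hd' : HasDerivAt (fun z => k (ω * z)) (deriv k (ω * r) * ω) (r : ℂ) :=
    hd.comp (r : ℂ) (hasDerivAt_const_mul ω)
  rw [hd'.deriv]
  simp only [hωr]
  linear_combination hcon + deriv k y * hωr

/-! ### Local inverses on discs of comparable radii -/

open ComplexConjugate in
theorem eventually_norm_lt_of_deriv {f : ℂ → ℂ} {f' y v : ℂ} (hf : HasDerivAt f f' y)
    (hv : (conj (f y) * (f' * v)).re < 0) :
    ∀ᶠ t : ℝ in 𝓝[>] 0, ‖f (y + t * v)‖ < ‖f y‖ := by
  have hline : HasDerivAt (fun t : ℝ => y + t * v) v 0 := by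
    have := ((hasDerivAt_id (0 : ℝ)).ofReal_comp.mul_const v).const_add y
    simpa using this
  have hf0 : HasDerivAt f f' (y + ((0 : ℝ) : ℂ) * v) := by simpa using hf
  have h1 : HasDerivAt (fun t : ℝ => f (y + t * v)) (f' * v) 0 := by
    have := hf0.scomp (0 : ℝ) hline
    rw [smul_eq_mul, mul_comm] at this
    exact this
  have h2 := h1.norm_sq
  have h3 := h2.tendsto_slope_zero_right
  simp only [zero_add, Complex.ofReal_zero, zero_mul, add_zero, Complex.inner] at h3
  have hneg : 2 * (conj (f y) * (f' * v)).re < 0 := by linarith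
  rw [mul_comm (conj (f y))] at hneg
  have h4 := h3.eventually (gt_mem_nhds hneg)
  filter_upwards [h4, self_mem_nhdsWithin] with t ht ht0
  rw [smul_eq_mul] at ht
  have ht0' : 0 < t⁻¹ := inv_pos.2 ht0
  refine lt_of_pow_lt_pow_left₀ 2 (norm_nonneg _) ?_
  by_contra! hcon
  have := mul_nonneg ht0'.le (sub_nonneg.2 hcon)
  linarith

open ComplexConjugate in
/-- Let `k` be an inverse of `h` near `0`, both univalent on discs. On the smaller concentric discs
`h ∘ k` stays the identity: otherwise, at the failure point `y` nearest to `0`, the modulus of both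
`y` and `k y` could be decreased at the same time, because `y k'(y) / k(y)` is not a negative
real number. -/
theorem comp_eq_of_univalent {h k : ℂ → ℂ} {r₁ r₂ : ℝ}
    (hh : DifferentiableOn ℂ h (Metric.ball 0 r₁)) (h0 : h 0 = 0)
    (hk : DifferentiableOn ℂ k (Metric.ball 0 r₂)) (hkinj : InjOn k (Metric.ball 0 r₂))
    (k0 : k 0 = 0) (hhk : ∀ᶠ y in 𝓝 0, h (k y) = y) {y : ℂ} (hy : ‖y‖ ≤ 0.91 * r₂)
    (hky : ‖k y‖ ≤ 0.91 * r₁) : h (k y) = y := by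
  rcases eq_or_ne y 0 with rfl | hy0
  · rw [k0, h0]
  have hr₂ : 0 < r₂ := by have := norm_pos_iff.2 hy0; linarith
  have hmem : ∀ z : ℂ, ‖z‖ ≤ 0.91 * r₂ → z ∈ Metric.ball (0 : ℂ) r₂ := fun z hz => by
    rw [mem_ball_zero_iff]; linarith
  have hkne : ∀ z : ℂ, ‖z‖ ≤ 0.91 * r₂ → z ≠ 0 → k z ≠ 0 := fun z hz hz0 hkz =>
    hz0 (hkinj (hmem z hz) (Metric.mem_ball_self hr₂) (by rw [hkz, k0]))
  have hr₁ : 0 < r₁ := by have := norm_pos_iff.2 (hkne y hy hy0); linarith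
  by_contra hcon
  set G : Set ℂ := {y | ∀ᶠ z in 𝓝 y, h (k z) = z} with hG
  have hGo : IsOpen G := isOpen_setOfPred_eventually_nhds
  set E : Set ℂ := {y | ‖y‖ ≤ 0.91 * r₂ ∧ ‖k y‖ ≤ 0.91 * r₁} with hE
  have hEc : IsCompact E := by
    have h1 : ContinuousOn (fun z => ‖k z‖) (Metric.closedBall 0 (0.91 * r₂)) :=
      (hk.continuousOn.mono fun z hz => hmem z (mem_closedBall_zero_iff.1 hz)).norm
    have h2 := h1.preimage_isClosed_of_isClosed Metric.isClosed_closedBall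
      (isClosed_Iic (a := 0.91 * r₁))
    refine (isCompact_closedBall (0 : ℂ) (0.91 * r₂)).of_isClosed_subset ?_
      (fun z hz => mem_closedBall_zero_iff.2 hz.1)
    convert h2 using 1
    ext z
    simp [hE]
  have hyE : y ∈ E \ G := ⟨⟨hy, hky⟩, fun hyG =>
    hcon (Eventually.self_of_nhds (p := fun z => h (k z) = z) hyG)⟩
  obtain ⟨y₀, hy₀, hmin⟩ := (hEc.diff hGo).exists_isMinOn ⟨y, hyE⟩ continuous_norm.continuousOn
  have hy₀0 : y₀ ≠ 0 := fun h => hy₀.2 (by rw [h]; exact hhk)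
  have hk₀ : k y₀ ≠ 0 := hkne y₀ hy₀.1.1 hy₀0
  have hd : HasDerivAt k (deriv k y₀) y₀ :=
    (hk.differentiableAt (Metric.isOpen_ball.mem_nhds (hmem y₀ hy₀.1.1))).hasDerivAt
  set κ : ℂ := y₀ * deriv k y₀ / k y₀ with hκ
  have hk' : deriv k y₀ ≠ 0 :=
    deriv_ne_zero_of_injOn Metric.isOpen_ball hk hkinj (hmem y₀ hy₀.1.1)
  have hκ0 : κ ≠ 0 := div_ne_zero (mul_ne_zero hy₀0 hk') hk₀
  have hκn : 0 < ‖κ‖ := norm_pos_iff.2 hκ0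
  have hκre : 0 < κ.re + ‖κ‖ := by
    have h1 : -‖κ‖ ≤ κ.re := (abs_le.1 (Complex.abs_re_le_norm κ)).1
    rcases h1.lt_or_eq with h2 | h2
    · linarith
    exfalso
    have h3 : κ.im = 0 := by
      have := Complex.sq_norm κ
      rw [Complex.normSq_apply, ← h2] at this
      have : κ.im * κ.im = 0 := by linarith
      exact mul_self_eq_zero.1 this
    have h4 : κ = -(‖κ‖ : ℂ) := Complex.ext (by simp [← h2]) (by simp [h3])
    refine mul_deriv_ne_of_univalent hk hkinj k0 hy₀0 hy₀.1.1 hκn ?_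
    rw [← h4, hκ, div_mul_cancel₀ _ hk₀]
  have hκC : (‖κ‖ : ℂ) ≠ 0 := by exact_mod_cast hκn.ne'
  -- the bisector of the directions that decrease `‖y‖` and `‖k y‖` fastest
  set v : ℂ := -(y₀ * (1 + conj κ / ‖κ‖)) with hv
  have hv1 : (conj (id y₀) * (1 * v)).re < 0 := by
    have e : conj (id y₀) * (1 * v) =
        ((-(‖y₀‖ ^ 2 / ‖κ‖) : ℝ) : ℂ) * (‖κ‖ + conj κ) := by
      have := Complex.conj_mul' y₀
      simp only [id, hv]
      push_cast
      rw [← this]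
      field_simp
    rw [e, Complex.re_ofReal_mul]
    simp only [Complex.add_re, Complex.ofReal_re, Complex.conj_re]
    have : 0 < ‖y₀‖ := norm_pos_iff.2 hy₀0
    exact mul_neg_of_neg_of_pos (neg_neg_of_pos (by positivity)) (by linarith)
  have hv2 : (conj (k y₀) * (deriv k y₀ * v)).re < 0 := by
    have e : conj (k y₀) * (deriv k y₀ * v) =
        ((-(‖k y₀‖ ^ 2) : ℝ) : ℂ) * (κ + ‖κ‖) := by
      have h1 := Complex.conj_mul' (k y₀)
      have h2 : κ * conj κ = ‖κ‖ ^ 2 := Complex.mul_conj' κ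
      have h3 : y₀ * deriv k y₀ = κ * k y₀ := by rw [hκ, div_mul_cancel₀ _ hk₀]
      have h4 : deriv k y₀ * v = -(k y₀ * (κ + ‖κ‖)) := by
        have : deriv k y₀ * v = -(y₀ * deriv k y₀) * (1 + conj κ / ‖κ‖) := by rw [hv]; ring
        rw [this, h3]
        field_simp
        linear_combination -h2
      rw [h4]
      push_cast
      rw [← h1]
      ring
    rw [e, Complex.re_ofReal_mul]
    simp only [Complex.add_re, Complex.ofReal_re]
    have : 0 < ‖k y₀‖ := norm_pos_iff.2 hk₀
    exact mul_neg_of_neg_of_pos (neg_neg_of_pos (by positivity)) hκre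
  have ev1 := eventually_norm_lt_of_deriv (hasDerivAt_id y₀) hv1
  have ev2 := eventually_norm_lt_of_deriv hd hv2
  have htend : Tendsto (fun t : ℝ => y₀ + t * v) (𝓝[>] 0) (𝓝[≠] y₀) := by
    refine tendsto_nhdsWithin_iff.2 ⟨?_, ?_⟩
    · have : Continuous fun t : ℝ => y₀ + t * v := by fun_prop
      have := this.tendsto 0
      simp only [Complex.ofReal_zero, zero_mul, add_zero] at this
      exact this.mono_left nhdsWithin_le_nhds
    · filter_upwards [ev1] with t ht h
      simp only [id] at ht
      rw [h] at ht
      exact lt_irrefl _ ht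
  have hfreq : ∃ᶠ z in 𝓝[≠] y₀, (h ∘ k) z = id z := by
    refine htend.frequently (Eventually.frequently ?_)
    filter_upwards [ev1, ev2] with t ht1 ht2
    by_contra hne
    have hmemE : y₀ + t * v ∈ E \ G :=
      ⟨⟨ht1.le.trans hy₀.1.1, ht2.le.trans hy₀.1.2⟩, 
        fun hg => hne (Eventually.self_of_nhds (p := fun z => h (k z) = z) hg)⟩
    exact absurd (hmin hmemE) (not_le.2 ht1)
  have hkan : AnalyticAt ℂ k y₀ := hk.analyticAt (Metric.isOpen_ball.mem_nhds (hmem y₀ hy₀.1.1))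
  have hhan : AnalyticAt ℂ h (k y₀) := hh.analyticAt (Metric.isOpen_ball.mem_nhds (by
    rw [mem_ball_zero_iff]; linarith [hy₀.1.2]))
  exact hy₀.2 (((hhan.comp hkan).frequently_eq_iff_eventually_eq analyticAt_id).1 hfreq)

/-! ### Germs and their Taylor series -/

namespace DiffGerm

theorem isGermOf_mk (u : LocalDiffeo) : (mk u).IsGermOf u.toFun := ⟨u, rfl, EventuallyEq.rfl⟩

theorem IsGermOf.congr {h : DiffGerm} {F G : ℂ → ℂ} (hF : h.IsGermOf F) (e : G =ᶠ[𝓝 0] F) :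
    h.IsGermOf G := by
  obtain ⟨u, hu, hFu⟩ := hF
  exact ⟨u, hu, e.trans hFu⟩

theorem IsGermOf.analyticAt {h : DiffGerm} {F : ℂ → ℂ} (hF : h.IsGermOf F) :
    AnalyticAt ℂ F 0 := by
  obtain ⟨u, -, hFu⟩ := hF
  exact u.analyticAt.congr hFu.symm

theorem IsGermOf.map_zero {h : DiffGerm} {F : ℂ → ℂ} (hF : h.IsGermOf F) : F 0 = 0 := by
  obtain ⟨u, -, hFu⟩ := hF
  rw [hFu.self_of_nhds, u.map_zero]

theorem IsGermOf.tendsto {h : DiffGerm} {F : ℂ → ℂ} (hF : h.IsGermOf F) :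
    Tendsto F (𝓝 0) (𝓝 0) := by
  have := hF.analyticAt.continuousAt.tendsto
  rwa [hF.map_zero] at this

theorem IsGermOf.coeff_eq {h : DiffGerm} {F : ℂ → ℂ} (hF : h.IsGermOf F) (k : ℕ) :
    h.coeff k = iteratedDeriv k F 0 / (k.factorial : ℂ) := by
  obtain ⟨u, rfl, hFu⟩ := hF
  rw [hFu.iteratedDeriv_eq k]
  rfl

theorem IsGermOf.eventuallyEq {h : DiffGerm} {F G : ℂ → ℂ} (hF : h.IsGermOf F)
    (hG : h.IsGermOf G) : F =ᶠ[𝓝 0] G := by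
  obtain ⟨u, hu, hFu⟩ := hF
  obtain ⟨v, hv, hGv⟩ := hG
  have : u.toFun =ᶠ[𝓝 0] v.toFun := Quotient.exact (hu.trans hv.symm)
  exact hFu.trans (this.trans hGv.symm)

theorem IsGermOf.unique {h h' : DiffGerm} {F : ℂ → ℂ} (hF : h.IsGermOf F)
    (hF' : h'.IsGermOf F) : h = h' := by
  obtain ⟨u, rfl, hFu⟩ := hF
  obtain ⟨v, rfl, hFv⟩ := hF'
  exact Quotient.sound (show u.toFun =ᶠ[𝓝 0] v.toFun from hFu.symm.trans hFv)

theorem IsGermOf.mul {h h' : DiffGerm} {F F' : ℂ → ℂ} (hF : h.IsGermOf F)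
    (hF' : h'.IsGermOf F') : (h * h').IsGermOf (F ∘ F') := by
  have ht := hF'.tendsto
  obtain ⟨u, rfl, hFu⟩ := hF
  obtain ⟨v, rfl, hFv⟩ := hF'
  refine ⟨u.comp v, rfl, ?_⟩
  filter_upwards [hFv, ht.eventually hFu] with x hx hx'
  change F (F' x) = u.toFun (v.toFun x)
  rw [hx', hx]

theorem isGermOf_one : (1 : DiffGerm).IsGermOf id := ⟨LocalDiffeo.refl, rfl, EventuallyEq.rfl⟩

theorem IsGermOf.deriv_ne_zero {h : DiffGerm} {F : ℂ → ℂ} (hF : h.IsGermOf F) :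
    deriv F 0 ≠ 0 := by
  obtain ⟨u, -, hFu⟩ := hF
  rw [hFu.deriv_eq]
  exact u.deriv_ne_zero

theorem IsGermOf.coeff_one_eq {h : DiffGerm} {F : ℂ → ℂ} (hF : h.IsGermOf F) :
    h.coeff 1 = deriv F 0 := by
  rw [hF.coeff_eq]; simp

/-- A representative holomorphic on a disc is the sum of the Taylor series of the germ. -/
theorem IsGermOf.hasSum {h : DiffGerm} {F : ℂ → ℂ} (hF : h.IsGermOf F) {r : ℝ}
    (hd : DifferentiableOn ℂ F (Metric.ball 0 r)) {z : ℂ} (hz : z ∈ Metric.ball (0 : ℂ) r) :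
    HasSum (fun k => h.coeff k * z ^ k) (F z) := by
  have := Complex.hasSum_taylorSeries_on_ball hd hz
  refine this.congr_fun fun k => ?_
  rw [hF.coeff_eq, sub_zero, smul_eq_mul, smul_eq_mul]
  ring

theorem IsGermOf.eval_eq {h : DiffGerm} {F : ℂ → ℂ} (hF : h.IsGermOf F) {r : ℝ}
    (hd : DifferentiableOn ℂ F (Metric.ball 0 r)) {z : ℂ} (hz : z ∈ Metric.ball (0 : ℂ) r) :
    h.eval z = F z := (hF.hasSum hd hz).tsum_eq

theorem isGermOf_eval (h : DiffGerm) : h.IsGermOf h.eval := by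
  obtain ⟨u, rfl⟩ : ∃ u, mk u = h := ⟨Quotient.out h, Quotient.out_eq h⟩
  obtain ⟨r, hr, hd⟩ := Metric.eventually_nhds_iff_ball.1 u.analyticAt.eventually_analyticAt
  refine (isGermOf_mk u).congr ?_
  filter_upwards [Metric.ball_mem_nhds (0 : ℂ) hr] with z hz
  exact (isGermOf_mk u).eval_eq
    (fun x hx => (hd x hx).differentiableAt.differentiableWithinAt) hz

theorem eval_zero (h : DiffGerm) : h.eval 0 = 0 := h.isGermOf_eval.map_zero

theorem eval_one (z : ℂ) : (1 : DiffGerm).eval z = z :=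
  isGermOf_one.eval_eq (r := ‖z‖ + 1) differentiableOn_id (by
    rw [mem_ball_zero_iff]; linarith)

theorem UnivalentOn.differentiableOn {h : DiffGerm} {r : ℝ} (hu : h.UnivalentOn r) :
    DifferentiableOn ℂ h.eval (Metric.ball 0 r) := by
  obtain ⟨F, hF, hd, -⟩ := hu
  exact hd.congr fun z hz => hF.eval_eq hd hz

theorem UnivalentOn.injOn {h : DiffGerm} {r : ℝ} (hu : h.UnivalentOn r) :
    InjOn h.eval (Metric.ball 0 r) := by
  obtain ⟨F, hF, hd, hi⟩ := hu
  exact hi.congr fun z hz => (hF.eval_eq hd hz).symm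

theorem UnivalentOn.mono {h : DiffGerm} {r r' : ℝ} (hu : h.UnivalentOn r) (hr : r' ≤ r) :
    h.UnivalentOn r' := by
  obtain ⟨F, hF, hd, hi⟩ := hu
  exact ⟨F, hF, hd.mono (Metric.ball_subset_ball hr), hi.mono (Metric.ball_subset_ball hr)⟩

theorem UnivalentOn.hasSum {h : DiffGerm} {r : ℝ} (hu : h.UnivalentOn r) {z : ℂ}
    (hz : z ∈ Metric.ball (0 : ℂ) r) : HasSum (fun k => h.coeff k * z ^ k) (h.eval z) :=
  h.isGermOf_eval.hasSum hu.differentiableOn hz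

theorem eventually_eval_mul (h h' : DiffGerm) :
    ∀ᶠ z in 𝓝 0, (h * h').eval z = h.eval (h'.eval z) :=
  (h * h').isGermOf_eval.eventuallyEq (h.isGermOf_eval.mul h'.isGermOf_eval)

theorem eventually_inv_eval_eval (h : DiffGerm) : ∀ᶠ z in 𝓝 0, h⁻¹.eval (h.eval z) = z := by
  have := eventually_eval_mul h⁻¹ h
  rw [inv_mul_cancel] at this
  filter_upwards [this] with z hz
  rw [← hz, eval_one]

theorem eventually_eval_inv_eval (h : DiffGerm) : ∀ᶠ z in 𝓝 0, h.eval (h⁻¹.eval z) = z := by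
  simpa using eventually_inv_eval_eval h⁻¹

theorem eventually_eval_pow (h : DiffGerm) (n : ℕ) :
    ∀ᶠ z in 𝓝 0, (h ^ n).eval z = h.eval^[n] z := by
  induction n with
  | zero => simp [eval_one]
  | succ n ih =>
    filter_upwards [eventually_eval_mul (h ^ n) h, h.isGermOf_eval.tendsto.eventually ih]
      with z h1 h2
    rw [pow_succ, h1, h2, Function.iterate_succ_apply]

theorem exists_univalentOn (h : DiffGerm) : ∃ r : ℝ, 0 < r ∧ h.UnivalentOn r := by
  obtain ⟨r, hr, hb⟩ := Metric.eventually_nhds_iff_ball.1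
    (h.isGermOf_eval.analyticAt.eventually_analyticAt.and h.eventually_inv_eval_eval)
  refine ⟨r, hr, h.eval, h.isGermOf_eval,
    fun z hz => (hb z hz).1.differentiableAt.differentiableWithinAt, fun z hz w hw e => ?_⟩
  rw [← (hb z hz).2, e, (hb w hw).2]

/-! ### The analytic topology -/

theorem dist_le_iff {h h' : DiffGerm} {ε : ℝ} (hε : 0 ≤ ε) :
    dist h h' ≤ ε ↔ ∀ k, ‖h.coeff k - h'.coeff k‖ ≤ ε ^ k := by
  have key : ∀ n : ℕ, distTerm h h' n ≤ ε ↔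
      ‖h.coeff (n + 1) - h'.coeff (n + 1)‖ ≤ ε ^ (n + 1) := by
    intro n
    have hn : ((1 : ℝ) / ((n : ℝ) + 1)) = ((n + 1 : ℕ) : ℝ)⁻¹ := by push_cast; rw [one_div]
    rw [distTerm, hn, Real.rpow_inv_le_iff_of_pos (norm_nonneg _) hε (by positivity),
      Real.rpow_natCast]
  constructor
  · intro hd k
    cases k with
    | zero => simp [coeff_zero]
    | succ n => exact (key n).1 ((le_ciSup (distTerm_bddAbove h h') n).trans hd)
  · intro hk
    exact ciSup_le fun n => (key n).2 (hk _)

/-- The sum of the power series of `h' - h`. -/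
def diffEval (h h' : DiffGerm) (z : ℂ) : ℂ := ∑' k : ℕ, (h'.coeff k - h.coeff k) * z ^ k

theorem norm_coeff_sub_mul_pow_le {h h' : DiffGerm} {ε : ℝ} (hε : 0 ≤ ε) (hd : dist h' h ≤ ε)
    {z : ℂ} (k : ℕ) : ‖(h'.coeff k - h.coeff k) * z ^ k‖ ≤ (ε * ‖z‖) ^ k := by
  rw [norm_mul, norm_pow, mul_pow]
  have := (dist_le_iff hε).1 hd k
  gcongr

theorem summable_diffEval {h h' : DiffGerm} {ε : ℝ} (hε : 0 ≤ ε) (hd : dist h' h ≤ ε)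
    {z : ℂ} (hz : ε * ‖z‖ < 1) : Summable fun k : ℕ => (h'.coeff k - h.coeff k) * z ^ k :=
  Summable.of_norm_bounded (summable_geometric_of_lt_one (by positivity) hz)
    (norm_coeff_sub_mul_pow_le hε hd)

theorem norm_diffEval_le {h h' : DiffGerm} {ε : ℝ} (hε : 0 ≤ ε) (hd : dist h' h ≤ ε)
    {z : ℂ} (hz : ε * ‖z‖ < 1) : ‖diffEval h h' z‖ ≤ ε * ‖z‖ / (1 - ε * ‖z‖) := by
  have h1 := (summable_diffEval hε hd hz).hasSum
  have h2 := (hasSum_geometric_of_lt_one (by positivity) hz).mul_left (ε * ‖z‖)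
  rw [← hasSum_nat_add_iff' 1] at h1
  simp only [Finset.range_one, Finset.sum_singleton, coeff_zero, sub_self, zero_mul, sub_zero] at h1
  have h3 : ∀ k, ‖(h'.coeff (k + 1) - h.coeff (k + 1)) * z ^ (k + 1)‖ ≤
      ε * ‖z‖ * (ε * ‖z‖) ^ k := fun k => by
    rw [← pow_succ']; exact norm_coeff_sub_mul_pow_le hε hd _
  exact h1.norm_le_of_bounded h2 h3

theorem differentiableOn_diffEval {h h' : DiffGerm} {ε C : ℝ} (hε : 0 ≤ ε) (hd : dist h' h ≤ ε)
    (hC : ε * C < 1) : DifferentiableOn ℂ (diffEval h h') (Metric.ball 0 C) := by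
  rcases le_or_gt C 0 with hC0 | hC0
  · rw [Metric.ball_eq_empty.2 hC0]
    exact differentiableOn_empty
  refine Complex.differentiableOn_tsum_of_summable_norm
    (summable_geometric_of_lt_one (r := ε * C) (by positivity) hC) (fun k => by fun_prop)
    Metric.isOpen_ball fun k z hz => (norm_coeff_sub_mul_pow_le hε hd k).trans ?_
  rw [mem_ball_zero_iff] at hz
  gcongr

theorem diffEval_zero (h h' : DiffGerm) : diffEval h h' 0 = 0 := by
  rw [diffEval, tsum_eq_single 0]
  · simp [coeff_zero]
  · intro k hk; simp [hk]

/-- Germs close to `h` differ from it by a function that is holomorphic and small on a large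
disc. -/
theorem eventually_diffEval (h : DiffGerm) {C η : ℝ} (hC : 0 < C) (hη : 0 < η) :
    ∀ᶠ h' in 𝓝 h, DifferentiableOn ℂ (diffEval h h') (Metric.ball 0 C) ∧
      (∀ z ∈ Metric.ball (0 : ℂ) C, ‖diffEval h h' z‖ ≤ η ∧
        Summable fun k : ℕ => (h'.coeff k - h.coeff k) * z ^ k) := by
  set ε := min (1 / (2 * C)) (η / (2 * C)) with hεdef
  have hε : 0 < ε := by positivity
  have h1 : ε * C ≤ 1 / 2 := by
    calc ε * C ≤ 1 / (2 * C) * C := by gcongr; exact min_le_left _ _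
      _ = 1 / 2 := by field_simp
  have h2 : ε * C ≤ η / 2 := by
    calc ε * C ≤ η / (2 * C) * C := by gcongr; exact min_le_right _ _
      _ = η / 2 := by field_simp
  filter_upwards [Metric.closedBall_mem_nhds h hε] with h' hh'
  refine ⟨differentiableOn_diffEval hε.le hh' (by linarith), fun z hz => ?_⟩
  rw [mem_ball_zero_iff] at hz
  have h3 : ε * ‖z‖ ≤ ε * C := by gcongr
  refine ⟨(norm_diffEval_le hε.le hh' (by linarith)).trans ?_,
    summable_diffEval hε.le hh' (by linarith)⟩
  rw [div_le_iff₀ (by linarith)]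
  nlinarith

theorem eval_eq_add_diffEval {h h' : DiffGerm} {r : ℝ} (hu : h.UnivalentOn r) {z : ℂ}
    (hz : z ∈ Metric.ball (0 : ℂ) r)
    (hs : Summable fun k : ℕ => (h'.coeff k - h.coeff k) * z ^ k) :
    h'.eval z = h.eval z + diffEval h h' z := by
  have h1 := (hu.hasSum hz).add hs.hasSum
  refine (h1.congr_fun fun k => ?_).tsum_eq
  ring

end DiffGerm

/-! ### Perturbation of univalent germs -/

/-- A holomorphic function close to the identity has an inverse on a slightly smaller disc. -/
theorem exists_inverse_near_id {G : ℂ → ℂ} {R r η : ℝ} (hη : 0 < η) (hR : r + 4 * η ≤ R)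
    (hG : DifferentiableOn ℂ G (Metric.ball 0 R))
    (hGn : ∀ x ∈ Metric.ball (0 : ℂ) R, ‖G x - x‖ ≤ η) :
    ∃ g : ℂ → ℂ, DifferentiableOn ℂ g (Metric.ball 0 r) ∧
      (∀ y ∈ Metric.ball (0 : ℂ) r, ‖g y - y‖ ≤ η ∧ G (g y) = y) ∧
      ∀ x ∈ Metric.ball (0 : ℂ) (R - 2 * η), g (G x) = x := by
  set O := Metric.ball (0 : ℂ) (R - 2 * η) with hO
  have hOR : ∀ x ∈ O, Metric.closedBall x (2 * η) ⊆ Metric.ball 0 R := by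
    intro x hx
    refine Metric.closedBall_subset_ball' ?_
    rw [hO, Metric.mem_ball] at hx
    linarith
  have hOR' : O ⊆ Metric.ball 0 R := Metric.ball_subset_ball (by linarith)
  have hGd : ∀ x ∈ Metric.ball (0 : ℂ) R, DifferentiableAt ℂ G x := fun x hx =>
    hG.differentiableAt (Metric.isOpen_ball.mem_nhds hx)
  have hder : ∀ x ∈ O, ‖deriv (fun x => G x - x) x‖ ≤ 1 / 2 := by
    intro x hx
    have h := Complex.norm_deriv_le_of_forall_mem_sphere_norm_le (c := x) (R := 2 * η) (C := η)
      (f := fun x => G x - x) (by positivity)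
      (DifferentiableOn.diffContOnCl_ball (U := Metric.ball 0 R) (hG.sub differentiableOn_id)
        (hOR x hx))
      (fun z hz => hGn z (hOR x hx (Metric.sphere_subset_closedBall hz)))
    refine h.trans (le_of_eq ?_)
    field_simp
  have happ : ApproximatesLinearOn G
      ((ContinuousLinearEquiv.refl ℂ ℂ : ℂ ≃L[ℂ] ℂ) : ℂ →L[ℂ] ℂ) O (1 / 2) := by
    intro x hx y hy
    have := (convex_ball (0 : ℂ) (R - 2 * η)).norm_image_sub_le_of_norm_deriv_le
      (f := fun x => G x - x) (C := 1 / 2)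
      (fun z hz => (hGd z (hOR' hz)).sub differentiableAt_id) hder hy hx
    have e : G x - G y - (x - y) = G x - x - (G y - y) := by ring
    change ‖G x - G y - (x - y)‖ ≤ ((1 / 2 : NNReal) : ℝ) * ‖x - y‖
    rw [e]
    simpa using this
  have hN : Subsingleton ℂ ∨ (1 / 2 : NNReal) <
      ‖(((ContinuousLinearEquiv.refl ℂ ℂ).symm : ℂ ≃L[ℂ] ℂ) : ℂ →L[ℂ] ℂ)‖₊⁻¹ := by
    right
    have : ‖(((ContinuousLinearEquiv.refl ℂ ℂ).symm : ℂ ≃L[ℂ] ℂ) : ℂ →L[ℂ] ℂ)‖₊ = 1 := by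
      rw [← NNReal.coe_inj]
      exact ContinuousLinearMap.norm_id
    rw [this, inv_one]
    exact NNReal.half_lt_self one_ne_zero
  set Φ := happ.toOpenPartialHomeomorph G O hN Metric.isOpen_ball with hΦ
  have hinj : InjOn G O := happ.injOn hN
  have hsurj : ∀ y ∈ Metric.ball (0 : ℂ) r, y ∈ G '' O := by
    intro y hy
    rw [mem_ball_zero_iff] at hy
    have hsub : Metric.closedBall y (2 * η) ⊆ O := by
      refine Metric.closedBall_subset_ball' ?_
      rw [dist_zero_right]
      linarith
    have h := happ.surjOn_closedBall_of_nonlinearRightInverse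
      (ContinuousLinearEquiv.refl ℂ ℂ).toNonlinearRightInverse (ε := 2 * η) (b := y)
      (by positivity) hsub
    have hc : (((ContinuousLinearEquiv.refl ℂ ℂ).toNonlinearRightInverse.nnnorm : ℝ)⁻¹
        - ((1 / 2 : NNReal) : ℝ)) = 1 / 2 := by
      have : ((ContinuousLinearEquiv.refl ℂ ℂ).toNonlinearRightInverse.nnnorm : ℝ) = 1 :=
        ContinuousLinearMap.norm_id
      rw [this]; norm_num
    rw [hc] at h
    have hyO : y ∈ Metric.ball (0 : ℂ) R := by rw [mem_ball_zero_iff]; linarith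
    obtain ⟨x, hx, hxy⟩ := h (show y ∈ Metric.closedBall (G y) (1 / 2 * (2 * η)) by
      rw [Metric.mem_closedBall, dist_comm, dist_eq_norm]
      have := hGn y hyO
      linarith)
    exact ⟨x, hsub hx, hxy⟩
  have hmem : ∀ y ∈ Metric.ball (0 : ℂ) r, Φ.symm y ∈ O ∧ G (Φ.symm y) = y := fun y hy =>
    ⟨Φ.map_target (hsurj y hy), Φ.right_inv (hsurj y hy)⟩
  refine ⟨Φ.symm, fun y hy => ?_, fun y hy => ?_, fun x hx => Φ.left_inv hx⟩
  · have hO' := (hmem y hy).1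
    have hd : HasDerivAt Φ (deriv G (Φ.symm y)) (Φ.symm y) := (hGd _ (hOR' hO')).hasDerivAt
    exact (Φ.hasDerivAt_symm (hsurj y hy) (deriv_ne_zero_of_injOn Metric.isOpen_ball
      (hG.mono hOR') hinj hO') hd).differentiableAt.differentiableWithinAt
  · refine ⟨?_, (hmem y hy).2⟩
    have := hGn _ (hOR' (hmem y hy).1)
    rw [(hmem y hy).2] at this
    rwa [norm_sub_rev]

/-- A univalent function is bi-Lipschitz on compact sets. -/
theorem exists_mul_norm_sub_le_of_injOn {F : ℂ → ℂ} {U K : Set ℂ} (hU : IsOpen U)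
    (hF : DifferentiableOn ℂ F U) (hinj : InjOn F U) (hK : IsCompact K) (hKU : K ⊆ U) :
    ∃ c : ℝ, 0 < c ∧ ∀ z ∈ K, ∀ w ∈ K, c * ‖z - w‖ ≤ ‖F z - F w‖ := by
  have key : ∀ᶠ c : ℝ in 𝓝 0, ∀ p ∈ K ×ˢ K, c * ‖p.1 - p.2‖ ≤ ‖F p.1 - F p.2‖ := by
    refine (hK.prod hK).eventually_forall_of_forall_eventually
      (P := fun (c : ℝ) (p : ℂ × ℂ) => c * ‖p.1 - p.2‖ ≤ ‖F p.1 - F p.2‖) fun p hp => ?_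
    by_cases hpe : p.1 = p.2
    · have hs : HasStrictDerivAt F (deriv F p.1) p.1 :=
        (hF.analyticAt (hU.mem_nhds (hKU hp.1))).hasStrictDerivAt
      have hne : 0 < ‖deriv F p.1‖ :=
        norm_pos_iff.2 (deriv_ne_zero_of_injOn hU hF hinj (hKU hp.1))
      have h1 := hs.isLittleO.def (c := ‖deriv F p.1‖ / 2) (by positivity)
      have hp' : p = (p.1, p.1) := Prod.ext rfl hpe.symm
      have h2 : ∀ᶠ c : ℝ in 𝓝 0, c < ‖deriv F p.1‖ / 2 := gt_mem_nhds (by positivity)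
      rw [← hp'] at h1
      rw [nhds_prod_eq]
      filter_upwards [h1.prod_inr (𝓝 (0 : ℝ)), h2.prod_inl (𝓝 p)] with q hq hq2
      have h3 : ‖deriv F p.1‖ * ‖q.2.1 - q.2.2‖ ≤ ‖F q.2.1 - F q.2.2‖ +
          ‖F q.2.1 - F q.2.2 - (q.2.1 - q.2.2) • deriv F p.1‖ := by
        rw [mul_comm, ← norm_smul]
        have := norm_sub_le (F q.2.1 - F q.2.2)
          (F q.2.1 - F q.2.2 - (q.2.1 - q.2.2) • deriv F p.1)
        rwa [sub_sub_cancel] at this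
      have h4 : ‖F q.2.1 - F q.2.2 - (q.2.1 - q.2.2) • deriv F p.1‖ ≤
          ‖deriv F p.1‖ / 2 * ‖q.2.1 - q.2.2‖ := by simpa using hq
      have := norm_nonneg (q.2.1 - q.2.2)
      nlinarith
    · have hne : 0 < ‖F p.1 - F p.2‖ :=
        norm_pos_iff.2 (sub_ne_zero.2 fun h => hpe (hinj (hKU hp.1) (hKU hp.2) h))
      have hcF : ∀ z ∈ K, ContinuousAt F z := fun z hz =>
        (hF.differentiableAt (hU.mem_nhds (hKU hz))).continuousAt
      have h1 : ContinuousAt (fun q : ℝ × ℂ × ℂ => q.1 * ‖q.2.1 - q.2.2‖) (0, p) := by fun_prop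
      have h2 : ContinuousAt (fun q : ℝ × ℂ × ℂ => ‖F q.2.1 - F q.2.2‖) (0, p) := by
        have e1 : ContinuousAt (fun q : ℝ × ℂ × ℂ => F q.2.1) (0, p) :=
          ContinuousAt.comp (f := fun q : ℝ × ℂ × ℂ => q.2.1) (hcF _ hp.1) (by fun_prop)
        have e2 : ContinuousAt (fun q : ℝ × ℂ × ℂ => F q.2.2) (0, p) :=
          ContinuousAt.comp (f := fun q : ℝ × ℂ × ℂ => q.2.2) (hcF _ hp.2) (by fun_prop)
        exact (e1.sub e2).norm
      exact (h1.eventually_lt h2 (by simpa using hne)).mono fun q hq => hq.le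
  obtain ⟨c, hc, hc0⟩ := ((key.filter_mono nhdsWithin_le_nhds).and
    (self_mem_nhdsWithin (a := 0) (s := Ioi 0))).exists
  exact ⟨c, hc0, fun z hz w hw => hc (z, w) ⟨hz, hw⟩⟩

namespace DiffGerm

theorem eventually_univalentOn {h : DiffGerm} {s r : ℝ} (hu : h.UnivalentOn s) (hr : r < s) :
    ∀ᶠ h' in 𝓝 h, h'.UnivalentOn r := by
  rcases le_or_gt r 0 with hr0 | hr0
  · refine Eventually.of_forall fun h' => ?_
    obtain ⟨ρ, hρ, hu'⟩ := h'.exists_univalentOn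
    exact hu'.mono (hr0.trans hρ.le)
  obtain ⟨c, hc, hlow⟩ := exists_mul_norm_sub_le_of_injOn Metric.isOpen_ball hu.differentiableOn
    hu.injOn (isCompact_closedBall (0 : ℂ) r) (Metric.closedBall_subset_ball hr)
  filter_upwards [eventually_diffEval h (C := r + 2) (η := c / 2) (by linarith) (by linarith)]
    with h' ⟨hd, hb⟩
  have hrs : ∀ z ∈ Metric.ball (0 : ℂ) r, z ∈ Metric.ball (0 : ℂ) s := fun z hz =>
    Metric.ball_subset_ball hr.le hz
  have hr2 : Metric.ball (0 : ℂ) r ⊆ Metric.ball 0 (r + 2) := Metric.ball_subset_ball (by linarith)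
  have heq : ∀ z ∈ Metric.ball (0 : ℂ) r, h'.eval z = h.eval z + diffEval h h' z := fun z hz =>
    eval_eq_add_diffEval hu (hrs z hz) (hb z (hr2 hz)).2
  have hder : ∀ x ∈ Metric.ball (0 : ℂ) r, ‖deriv (diffEval h h') x‖ ≤ c / 2 := by
    intro x hx
    have hsub : Metric.closedBall x 1 ⊆ Metric.ball 0 (r + 2) := by
      refine Metric.closedBall_subset_ball' ?_
      rw [Metric.mem_ball] at hx
      linarith
    have := Complex.norm_deriv_le_of_forall_mem_sphere_norm_le (c := x) one_pos
      (hd.diffContOnCl_ball hsub)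
      (fun z hz => (hb z (hsub (Metric.sphere_subset_closedBall hz))).1)
    rwa [div_one] at this
  refine ⟨h'.eval, h'.isGermOf_eval, ?_, ?_⟩
  · exact ((hu.differentiableOn.mono (Metric.ball_subset_ball hr.le)).add (hd.mono hr2)).congr heq
  · intro z hz w hw e
    rw [heq z hz, heq w hw] at e
    have h1 := (convex_ball (0 : ℂ) r).norm_image_sub_le_of_norm_deriv_le
      (fun x hx => hd.differentiableAt (Metric.isOpen_ball.mem_nhds (hr2 hx))) hder hz hw
    have h2 := hlow z (Metric.ball_subset_closedBall hz) w (Metric.ball_subset_closedBall hw)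
    have h3 : h.eval z - h.eval w = diffEval h h' w - diffEval h h' z := by
      linear_combination e
    rw [h3, norm_sub_rev z w] at h2
    have h4 : ‖w - z‖ ≤ 0 := by nlinarith [norm_nonneg (w - z)]
    exact (sub_eq_zero.1 (norm_le_zero_iff.1 h4)).symm

/-- If `h⁻¹` is univalent on a disc, then so is `h'⁻¹` on a smaller disc for all `h'` close to `h`,
and there it is close to `h⁻¹` up to a small change of the argument. (The inversion is not
continuous for the analytic topology.) The inverse of `h' = h + e` is `k ∘ (id + e ∘ k)⁻¹`, where
`k = h⁻¹`. -/
theorem eventually_inv_univalentOn {h : DiffGerm} {s r η : ℝ} (hu : h⁻¹.UnivalentOn s) (hr : r < s)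
    (hη : 0 < η) :
    ∀ᶠ h' in 𝓝 h, h'⁻¹.UnivalentOn r ∧ (∀ y ∈ Metric.ball (0 : ℂ) r,
      ∃ x ∈ Metric.ball (0 : ℂ) s, ‖x - y‖ ≤ η ∧ h'⁻¹.eval y = h⁻¹.eval x) ∧
      ∀ x ∈ Metric.ball (0 : ℂ) r, diffEval h h' (h⁻¹.eval x) = 0 →
        h'⁻¹.eval x = h⁻¹.eval x := by
  wlog hr0 : 0 < r generalizing r
  · have hemp : ∀ y : ℂ, y ∉ Metric.ball (0 : ℂ) r := fun y hy =>
      hr0 (Metric.pos_of_mem_ball hy)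
    refine Eventually.of_forall fun h' => ⟨?_, fun y hy => absurd hy (hemp y),
      fun y hy => absurd hy (hemp y)⟩
    obtain ⟨ρ, hρ, hu'⟩ := h'⁻¹.exists_univalentOn
    exact hu'.mono ((not_lt.1 hr0).trans hρ.le)
  set k := h⁻¹.eval with hk
  set R := (r + s) / 2 with hR
  have hRs : Metric.ball (0 : ℂ) R ⊆ Metric.ball 0 s := Metric.ball_subset_ball (by linarith)
  obtain ⟨M, hM⟩ := (isCompact_closedBall (0 : ℂ) R).exists_bound_of_continuousOn
    (hu.differentiableOn.continuousOn.mono (Metric.closedBall_subset_ball (by linarith)))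
  have hM0 : 0 ≤ M := (norm_nonneg _).trans
    (hM 0 (Metric.mem_closedBall_self (by linarith)))
  set η' := min η ((R - r) / 4) with hη'
  have hη'0 : 0 < η' := lt_min hη (by linarith)
  have hη'R : η' ≤ (R - r) / 4 := min_le_right _ _
  filter_upwards [eventually_diffEval h (C := M + 1) (η := η') (by linarith) hη'0]
    with h' ⟨hd, hb⟩
  have hkM : ∀ x ∈ Metric.ball (0 : ℂ) R, k x ∈ Metric.ball (0 : ℂ) (M + 1) := fun x hx => by
    rw [mem_ball_zero_iff]
    linarith [hM x (Metric.ball_subset_closedBall hx)]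
  set G : ℂ → ℂ := fun x => x + diffEval h h' (k x) with hG
  have hkd : DifferentiableOn ℂ k (Metric.ball 0 R) := hu.differentiableOn.mono hRs
  have hGd : DifferentiableOn ℂ G (Metric.ball 0 R) := differentiableOn_id.add (hd.comp hkd hkM)
  have hGn : ∀ x ∈ Metric.ball (0 : ℂ) R, ‖G x - x‖ ≤ η' := fun x hx => by
    rw [hG, add_sub_cancel_left]
    exact (hb _ (hkM x hx)).1
  obtain ⟨g, hgd, hg, hg'⟩ := exists_inverse_near_id (r := r) hη'0 (by linarith) hGd hGn
  have hgR : ∀ y ∈ Metric.ball (0 : ℂ) r, g y ∈ Metric.ball (0 : ℂ) R := fun y hy => by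
    have h1 := (hg y hy).1
    have h2 := norm_le_norm_add_norm_sub' (g y) y
    rw [mem_ball_zero_iff] at hy ⊢
    linarith
  have hG0 : G 0 = 0 := by simp [hG, hk, eval_zero, diffEval_zero]
  have hg0 : g 0 = 0 := by
    have := hg' 0 (Metric.mem_ball_self (by linarith))
    rwa [hG0] at this
  have hr0B : Metric.ball (0 : ℂ) r ∈ 𝓝 0 := Metric.ball_mem_nhds _ hr0
  have hgt : Tendsto g (𝓝 0) (𝓝 0) := by
    have := (hgd.differentiableAt hr0B).continuousAt.tendsto
    rwa [hg0] at this
  have hkt : Tendsto k (𝓝 0) (𝓝 0) := h⁻¹.isGermOf_eval.tendsto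
  obtain ⟨ρ, hρ, huρ⟩ := h.exists_univalentOn
  have hgerm : h'⁻¹.IsGermOf (k ∘ g) := by
    refine h'⁻¹.isGermOf_eval.congr ?_
    have hx : ∀ᶠ x in 𝓝 0, h'.eval (k x) = G x := by
      filter_upwards [h.eventually_eval_inv_eval, hkt.eventually (Metric.ball_mem_nhds _ hρ),
        Metric.ball_mem_nhds (0 : ℂ) (show 0 < R by linarith)] with x h1 h2 h3
      rw [eval_eq_add_diffEval huρ h2 (hb _ (hkM x h3)).2, h1]
    filter_upwards [hgt.eventually hx, hr0B,
      (hkt.comp hgt).eventually h'.eventually_inv_eval_eval] with y h1 h2 h3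
    simp only [Function.comp_apply] at h3 ⊢
    rw [h1, (hg y h2).2] at h3
    exact h3.symm
  have hcomp : DifferentiableOn ℂ (k ∘ g) (Metric.ball 0 r) := hkd.comp hgd hgR
  refine ⟨⟨k ∘ g, hgerm, hcomp, fun y hy y' hy' e => ?_⟩, fun y hy =>
    ⟨g y, hRs (hgR y hy), (hg y hy).1.trans (min_le_left _ _), hgerm.eval_eq hcomp hy⟩,
    fun x hx hx0 => ?_⟩
  · have := hu.injOn (hRs (hgR y hy)) (hRs (hgR y' hy')) e
    rw [← (hg y hy).2, this, (hg y' hy').2]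
  · have hGx : G x = x := by simp only [hG]; rw [hx0, add_zero]
    have := hg' x (Metric.ball_subset_ball (by linarith) hx)
    rw [hGx] at this
    rw [hgerm.eval_eq hcomp hx, Function.comp_apply, this]

theorem continuousAt_eval {h : DiffGerm} {r : ℝ} (hu : h.UnivalentOn r) {z : ℂ}
    (hz : z ∈ Metric.ball (0 : ℂ) r) :
    ContinuousAt (fun p : DiffGerm × ℂ => p.1.eval p.2) (h, z) := by
  rw [Metric.continuousAt_iff']
  intro ε hε
  have hr : 0 < r := Metric.pos_of_mem_ball hz
  have hzn : Metric.ball (0 : ℂ) r ∈ 𝓝 z := Metric.isOpen_ball.mem_nhds hz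
  have hc := (hu.differentiableOn.differentiableAt hzn).continuousAt
  have h1 := Metric.continuousAt_iff'.1 hc (ε / 2) (by positivity)
  rw [nhds_prod_eq]
  filter_upwards [(eventually_diffEval h hr (half_pos (half_pos hε))).prod_inl (𝓝 z),
    (h1.and hzn).prod_inr (𝓝 h)] with p hp hp2
  have hb := hp.2 p.2 hp2.2
  simp only [eval_eq_add_diffEval hu hp2.2 hb.2]
  have h3 := hp2.1
  rw [dist_eq_norm] at h3 ⊢
  have e : h.eval p.2 + diffEval h p.1 p.2 - h.eval z =
      (h.eval p.2 - h.eval z) + diffEval h p.1 p.2 := by ring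
  rw [e]
  have := norm_add_le (h.eval p.2 - h.eval z) (diffEval h p.1 p.2)
  linarith [hb.1]

theorem continuousAt_inv_eval {h : DiffGerm} {r : ℝ} (hu : h⁻¹.UnivalentOn r) {y : ℂ}
    (hy : y ∈ Metric.ball (0 : ℂ) r) :
    ContinuousAt (fun p : DiffGerm × ℂ => p.1⁻¹.eval p.2) (h, y) := by
  rw [Metric.continuousAt_iff']
  intro ε hε
  obtain ⟨r', hyr', hr'⟩ := exists_between (mem_ball_zero_iff.1 hy)
  have hyn : Metric.ball (0 : ℂ) r ∈ 𝓝 y := Metric.isOpen_ball.mem_nhds hy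
  have hc := (hu.differentiableOn.differentiableAt hyn).continuousAt
  obtain ⟨δ, hδ, hb⟩ := Metric.continuousAt_iff.1 hc ε hε
  have hyn' : Metric.ball (0 : ℂ) r' ∈ 𝓝 y :=
    Metric.isOpen_ball.mem_nhds (mem_ball_zero_iff.2 hyr')
  rw [nhds_prod_eq]
  filter_upwards [(eventually_inv_univalentOn hu hr' (half_pos hδ)).prod_inl (𝓝 y),
    (Eventually.and hyn' (Metric.ball_mem_nhds y (half_pos hδ))).prod_inr (𝓝 h)] with p hp hp2
  obtain ⟨x, -, hx, hex⟩ := hp.2.1 p.2 hp2.1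
  rw [hex]
  refine hb ?_
  have h1 : dist p.2 y < δ / 2 := hp2.2
  have h2 : dist x p.2 ≤ δ / 2 := by rwa [dist_eq_norm]
  linarith [dist_triangle x p.2 y]

open Polynomial in
/-- Adding to a germ small multiples of a polynomial vanishing to high order at `0`. -/
theorem exists_add_polynomial (h : DiffGerm) {α : ℕ} (hh : h ∈ tangentToId α) (p : ℂ[X])
    (hp : X ^ (α + 2) ∣ p) :
    ∃ H : ℂ → DiffGerm, (∀ t, H t ∈ tangentToId α) ∧ Tendsto H (𝓝 0) (𝓝 h) ∧
      ∀ t k, (H t).coeff k = h.coeff k + t * p.coeff k := by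
  have hp0 : ∀ k, k < α + 2 → p.coeff k = 0 := X_pow_dvd_iff.1 hp
  have han := h.isGermOf_eval.analyticAt
  have hz : p.eval 0 = 0 := by rw [← coeff_zero_eq_eval_zero]; exact hp0 0 (by omega)
  have hd : p.derivative.eval 0 = 0 := by
    rw [← coeff_zero_eq_eval_zero, coeff_derivative, hp0 1 (by omega)]; simp
  set H : ℂ → DiffGerm := fun t => mk
    { toFun := fun z => h.eval z + t * p.eval z
      analyticAt := han.add (analyticAt_const.mul (p.differentiable.analyticAt 0))
      map_zero := by simp [eval_zero, hz]
      deriv_ne_zero := by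
        have h1 : HasDerivAt (fun z => h.eval z + t * p.eval z)
            (deriv h.eval 0 + t * p.derivative.eval 0) 0 :=
          han.differentiableAt.hasDerivAt.add ((p.hasDerivAt 0).const_mul t)
        rw [h1.deriv, hd, mul_zero, add_zero]
        exact h.isGermOf_eval.deriv_ne_zero } with hH
  have hgerm : ∀ t, (H t).IsGermOf fun z => h.eval z + t * p.eval z := fun t => isGermOf_mk _
  have hcoeff : ∀ t k, (H t).coeff k = h.coeff k + t * p.coeff k := by
    intro t k
    have hpk : iteratedDeriv k (fun z => p.eval z) 0 = k.factorial * p.coeff k := by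
      have : ∀ k, iteratedDeriv k (fun z => p.eval z) = fun z => (derivative^[k] p).eval z := by
        intro k
        induction k with
        | zero => simp
        | succ k ih =>
          rw [iteratedDeriv_succ, ih, Function.iterate_succ_apply']
          ext z
          exact ((derivative^[k] p).hasDerivAt z).deriv
      rw [this]
      change (derivative^[k] p).eval 0 = _
      rw [← coeff_zero_eq_eval_zero, coeff_iterate_derivative, zero_add, Nat.descFactorial_self,
        nsmul_eq_mul]
    have h1 : ContDiffAt ℂ k h.eval 0 := han.contDiffAt
    have h2 : ContDiffAt ℂ k (fun z => t * p.eval z) 0 :=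
      (analyticAt_const.mul (p.differentiable.analyticAt 0)).contDiffAt
    rw [(hgerm t).coeff_eq, h.isGermOf_eval.coeff_eq, iteratedDeriv_fun_add h1 h2,
      iteratedDeriv_const_mul_field, hpk]
    have : (k.factorial : ℂ) ≠ 0 := by exact_mod_cast k.factorial_ne_zero
    field_simp
  refine ⟨H, fun t k hk1 hk => ?_, ?_, hcoeff⟩
  · rw [hcoeff, hp0 k (by omega), mul_zero, add_zero]
    exact hh k hk1 hk
  · rw [Metric.tendsto_nhds]
    intro ε hε
    have hev : ∀ᶠ t : ℂ in 𝓝 0, ∀ k ∈ Finset.range (p.natDegree + 1),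
        ‖t * p.coeff k‖ < (ε / 2) ^ k := by
      rw [Finset.eventually_all]
      intro k _
      have : Continuous fun t : ℂ => ‖t * p.coeff k‖ := by fun_prop
      exact (this.tendsto 0).eventually (gt_mem_nhds (by simp; positivity))
    filter_upwards [hev] with t ht
    refine lt_of_le_of_lt ((dist_le_iff (ε := ε / 2) (by positivity)).2 fun k => ?_) (by linarith)
    rw [hcoeff, add_sub_cancel_left]
    by_cases hk : k < p.natDegree + 1
    · exact (ht k (Finset.mem_range.2 hk)).le
    · rw [coeff_eq_zero_of_natDegree_lt (by omega), mul_zero, norm_zero]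
      positivity

open Polynomial in
theorem hasSum_of_coeff_eq_add_polynomial {h h' : DiffGerm} {p : ℂ[X]} {t : ℂ}
    (hc : ∀ k, h'.coeff k = h.coeff k + t * p.coeff k) (z : ℂ) :
    HasSum (fun k => (h'.coeff k - h.coeff k) * z ^ k) (t * p.eval z) := by
  have e : (fun k => (h'.coeff k - h.coeff k) * z ^ k) = fun k => t * (p.coeff k * z ^ k) := by
    ext k; rw [hc]; ring
  rw [e, eval_eq_sum_range]
  refine (hasSum_sum_of_ne_finset_zero fun k hk => ?_).mul_left t
  rw [coeff_eq_zero_of_natDegree_lt (by simpa using hk), zero_mul]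

end DiffGerm

/-! ### Small cycles -/

/-- If a real function increases along the dynamics near `0`, there are no periodic orbits near
`0`. -/
theorem exists_radius_of_monotone {φ : ℂ → ℂ} {V : ℂ → ℝ}
    (hV : ∀ᶠ x in 𝓝[≠] (0 : ℂ), φ x ≠ 0 ∧ V x < V (φ x)) :
    ∃ r : ℝ, 0 < r ∧ ∀ n : ℕ, 1 ≤ n → ∀ x : ℂ, (∀ i < n, ‖φ^[i] x‖ < r) → φ^[n] x = x → x = 0 := by
  rw [eventually_nhdsWithin_iff] at hV
  obtain ⟨r, hr, hb⟩ := Metric.eventually_nhds_iff_ball.1 hV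
  refine ⟨r, hr, fun n hn x horb hfix => ?_⟩
  by_contra hx
  have key : ∀ i ≤ n, φ^[i] x ≠ 0 ∧ (1 ≤ i → V x < V (φ^[i] x)) := by
    intro i
    induction i with
    | zero => exact fun _ => ⟨hx, fun h => absurd h (by omega)⟩
    | succ i ih =>
      intro hi
      obtain ⟨h1, h2⟩ := ih (by omega)
      have h3 := hb _ (mem_ball_zero_iff.2 (horb i (by omega))) h1
      rw [Function.iterate_succ_apply']
      refine ⟨h3.1, fun _ => ?_⟩
      rcases Nat.eq_zero_or_pos i with rfl | hi0
      · exact h3.2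
      · exact (h2 hi0).trans h3.2
  have := (key n le_rfl).2 hn
  rw [hfix] at this
  exact lt_irrefl _ this

/-- There are no periodic orbits near a parabolic fixed point with multiplier `1`. Conjugating by
`w = -1 / (k a x ^ k)` turns `x ↦ x + a x ^ (k + 1) + ⋯` into `w ↦ w + 1 + o(1)`. -/
theorem exists_radius_of_parabolic {ψ : ℂ → ℂ} (hψ : AnalyticAt ℂ ψ 0) (h0 : ψ 0 = 0)
    (h1 : deriv ψ 0 = 1) (hne : ¬ ∀ᶠ x in 𝓝 0, ψ x = x) :
    ∃ r : ℝ, 0 < r ∧ ∀ n : ℕ, 1 ≤ n → ∀ x : ℂ, (∀ i < n, ‖ψ^[i] x‖ < r) → ψ^[n] x = x → x = 0 := by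
  have han : AnalyticAt ℂ (fun x => ψ x - x) 0 := hψ.sub analyticAt_id
  obtain ⟨m, g, hg, hg0, hev⟩ := han.exists_eventuallyEq_pow_smul_nonzero_iff.2
    (fun h => hne (h.mono fun x hx => sub_eq_zero.1 hx))
  simp only [sub_zero, smul_eq_mul] at hev
  have hd : HasDerivAt (fun x => ψ x - x) 0 0 := by
    have := hψ.differentiableAt.hasDerivAt.sub (hasDerivAt_id (0 : ℂ))
    rw [h1, sub_self] at this
    exact this
  have hm0 : m ≠ 0 := by
    rintro rfl
    have := hev.self_of_nhds
    simp only [h0, sub_self, pow_zero, one_mul] at this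
    exact hg0 this.symm
  have hm1 : m ≠ 1 := by
    rintro rfl
    have h2 : HasDerivAt (fun x => x ^ 1 * g x) (g 0) 0 := by
      have := (hasDerivAt_id (0 : ℂ)).mul hg.differentiableAt.hasDerivAt
      simp only [id, one_mul, zero_mul, add_zero] at this
      refine this.congr_of_eventuallyEq (Eventually.of_forall fun x => ?_)
      simp
    exact hg0 ((h2.congr_of_eventuallyEq hev).unique hd)
  obtain ⟨k, rfl⟩ : ∃ k, m = k + 2 := ⟨m - 2, by omega⟩
  set a := g 0 with ha
  set ε : ℂ → ℂ := fun x => x ^ (k + 1) * g x with hε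
  have hεc : ContinuousAt ε 0 := (continuousAt_id.pow _).mul hg.continuousAt
  have hε0 : ε 0 = 0 := by simp [hε]
  set Δ : ℂ → ℂ := fun x => g x / ((k + 1) * a) *
    ((∑ i ∈ Finset.range (k + 1), (1 + ε x) ^ i) / (1 + ε x) ^ (k + 1)) with hΔ
  have hk : (k + 1 : ℂ) ≠ 0 := by exact_mod_cast k.succ_ne_zero
  have hΔc : ContinuousAt Δ 0 := by
    refine (hg.continuousAt.div_const _).mul (ContinuousAt.div ?_ ?_ (by simp [hε0]))
    · exact tendsto_finsetSum _ fun i _ => (continuousAt_const.add hεc).pow i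
    · exact (continuousAt_const.add hεc).pow _
  have hΔ0 : Δ 0 = 1 := by
    simp only [hΔ, hε0, add_zero, one_pow, Finset.sum_const, Finset.card_range, nsmul_eq_mul,
      mul_one, div_one, ← ha]
    push_cast
    field_simp
  have hev1 : ∀ᶠ x in 𝓝 0, 0 < (Δ x).re := by
    have : ContinuousAt (fun x => (Δ x).re) 0 := Complex.continuous_re.continuousAt.comp hΔc
    exact this.eventually (lt_mem_nhds (by change 0 < (Δ 0).re; rw [hΔ0]; norm_num))
  have hev2 : ∀ᶠ x in 𝓝 0, 1 + ε x ≠ 0 :=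
    (continuousAt_const.add hεc).eventually_ne (by simp [hε0])
  refine exists_radius_of_monotone (V := fun x => (-1 / ((k + 1) * a * x ^ (k + 1))).re) ?_
  filter_upwards [nhdsWithin_le_nhds hev, nhdsWithin_le_nhds hev1, nhdsWithin_le_nhds hev2,
    self_mem_nhdsWithin] with x hx hx1 hx2 hx0
  have hx0' : x ≠ 0 := hx0
  have hψx : ψ x = x * (1 + ε x) := by
    simp only [hε]
    linear_combination hx
  refine ⟨by rw [hψx]; exact mul_ne_zero hx0' hx2, ?_⟩
  have hdiff : -1 / ((k + 1) * a * ψ x ^ (k + 1)) = -1 / ((k + 1) * a * x ^ (k + 1)) + Δ x := by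
    have hgeom := geom_sum_mul (1 + ε x) (k + 1)
    rw [add_sub_cancel_left] at hgeom
    have hgε : g x = ε x / x ^ (k + 1) := by simp only [hε]; field_simp
    have h3 : (1 + ε x) ^ (k + 1) ≠ 0 := pow_ne_zero _ hx2
    have h4 : x ^ (k + 1) ≠ 0 := pow_ne_zero _ hx0'
    simp only [hΔ]
    rw [hψx, mul_pow, hgε]
    generalize (1 + ε x) ^ (k + 1) = P at *
    generalize x ^ (k + 1) = X at *
    generalize ∑ i ∈ Finset.range (k + 1), (1 + ε x) ^ i = S at *
    field_simp
    linear_combination -hgeom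
  rw [hdiff, Complex.add_re]
  linarith

namespace DiffGerm

theorem coeff_one_mul (h h' : DiffGerm) : (h * h').coeff 1 = h.coeff 1 * h'.coeff 1 := by
  have hh := h.isGermOf_eval
  have hh' := h'.isGermOf_eval
  rw [(hh.mul hh').coeff_one_eq, hh.coeff_one_eq, hh'.coeff_one_eq]
  have h1 : HasDerivAt h.eval (deriv h.eval 0) (h'.eval 0) := by
    rw [eval_zero]; exact hh.analyticAt.differentiableAt.hasDerivAt
  exact (h1.comp 0 hh'.analyticAt.differentiableAt.hasDerivAt).deriv

theorem coeff_one_one : (1 : DiffGerm).coeff 1 = 1 := by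
  rw [isGermOf_one.coeff_one_eq]; simp

theorem coeff_one_pow (h : DiffGerm) (n : ℕ) : (h ^ n).coeff 1 = h.coeff 1 ^ n := by
  induction n with
  | zero => simp [coeff_one_one]
  | succ n ih => rw [pow_succ, coeff_one_mul, ih, pow_succ]

theorem multiplier_inv (h : DiffGerm) : h⁻¹.multiplier = h.multiplier⁻¹ := by
  refine eq_inv_of_mul_eq_one_left (Units.ext ?_)
  have := coeff_one_mul h⁻¹ h
  rw [inv_mul_cancel, coeff_one_one] at this
  exact this.symm

theorem isGermOf_linear (c : ℂˣ) : (linear c).IsGermOf fun z => c * z := isGermOf_mk _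

theorem linear_inv (c : ℂˣ) : linear c⁻¹ = (linear c)⁻¹ := by
  refine eq_inv_of_mul_eq_one_left ?_
  refine ((isGermOf_linear c⁻¹).mul (isGermOf_linear c)).unique (isGermOf_one.congr ?_)
  refine Eventually.of_forall fun z => ?_
  simp

theorem IsLinearizable.inv {f : DiffGerm} (hf : f.IsLinearizable) : f⁻¹.IsLinearizable := by
  obtain ⟨h, hh⟩ := hf
  refine ⟨h, ?_⟩
  rw [multiplier_inv, linear_inv, ← hh]
  group

theorem not_hasCremerPoint_inv {f : DiffGerm} (hf : ¬ f.HasCremerPoint) :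
    ¬ f⁻¹.HasCremerPoint := by
  rintro ⟨h1, h2, h3⟩
  refine hf ⟨?_, fun n hn h => h2 n hn ?_, fun h => h3 h.inv⟩
  · rw [multiplier_inv, Units.val_inv_eq_inv_val, norm_inv, inv_eq_one] at h1
    exact h1
  · rw [multiplier_inv, inv_pow, h, inv_one]

theorem eq_one_of_eventually {h : DiffGerm} (hh : ∀ᶠ z in 𝓝 0, h.eval z = z) : h = 1 :=
  (h.isGermOf_eval.congr (EventuallyEq.symm hh : id =ᶠ[𝓝 0] h.eval)).unique isGermOf_one

theorem eventually_eval_ne_zero (h : DiffGerm) : ∀ᶠ x in 𝓝[≠] (0 : ℂ), h.eval x ≠ 0 := by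
  obtain ⟨r, hr, hu⟩ := h.exists_univalentOn
  filter_upwards [nhdsWithin_le_nhds (Metric.ball_mem_nhds (0 : ℂ) hr), self_mem_nhdsWithin]
    with x hx hx0 h0
  exact hx0 (hu.injOn hx (Metric.mem_ball_self hr) (by rw [h0, eval_zero]))

/-- A germ without a Cremer point has no small cycles, except for those forced by
finite order. The multiplier has modulus different from `1`, or it is a root of unity (and then
the germ has finite order, or a power of it is parabolic), or the germ is linearizable. -/
theorem exists_radius_no_periodic (F : DiffGerm) (hF : ¬ F.HasCremerPoint) :
    ∃ r : ℝ, 0 < r ∧ ∀ n : ℕ, 1 ≤ n → F ^ n ≠ 1 → ∀ x : ℂ, (∀ i < n, ‖F.eval^[i] x‖ < r) →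
      F.eval^[n] x = x → x = 0 := by
  have hgerm := F.isGermOf_eval
  have hd : HasDerivAt F.eval (F.coeff 1) 0 := by
    rw [hgerm.coeff_one_eq]; exact hgerm.analyticAt.differentiableAt.hasDerivAt
  have hlim : Tendsto (fun x => ‖F.eval x‖ / ‖x‖) (𝓝[≠] 0) (𝓝 ‖F.coeff 1‖) := by
    refine (hd.tendsto_slope.norm).congr fun x => ?_
    rw [slope_def_field, eval_zero, sub_zero, sub_zero, norm_div]
  by_cases hroot : ∃ q : ℕ, 0 < q ∧ F.coeff 1 ^ q = 1
  · obtain ⟨q, hq, hroot1⟩ := hroot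
    by_cases hFq : F ^ q = 1
    · -- finite order: only finitely many iterates matter
      have h1 : ∀ᶠ x in 𝓝 0, F.eval^[q] x = x := by
        filter_upwards [F.eventually_eval_pow q] with x hx
        rw [← hx, hFq, eval_one]
      have h2 : ∀ᶠ x in 𝓝 (0 : ℂ), ∀ n ∈ Finset.range q, F ^ n ≠ 1 → F.eval^[n] x = x → x = 0 := by
        rw [Finset.eventually_all]
        intro n _
        by_cases hn : F ^ n = 1
        · exact Eventually.of_forall fun x h => absurd hn h
        have han : AnalyticAt ℂ (fun x => (F ^ n).eval x - x) 0 :=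
          (F ^ n).isGermOf_eval.analyticAt.sub analyticAt_id
        rcases han.eventually_eq_zero_or_eventually_ne_zero with h | h
        · exact absurd (eq_one_of_eventually (h.mono fun x hx => sub_eq_zero.1 hx)) hn
        · rw [eventually_nhdsWithin_iff] at h
          filter_upwards [h, F.eventually_eval_pow n] with x hx hx' _ hfix
          by_contra hx0
          exact hx hx0 (by rw [hx', hfix, sub_self])
      obtain ⟨r, hr, hb⟩ := Metric.eventually_nhds_iff_ball.1 (h1.and h2)
      refine ⟨r, hr, fun n hn hFn x horb hfix => ?_⟩
      obtain ⟨hx1, hx2⟩ := hb x (mem_ball_zero_iff.2 (horb 0 hn))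
      refine hx2 (n % q) (Finset.mem_range.2 (Nat.mod_lt _ hq)) (fun h => hFn ?_) ?_
      · rw [← Nat.mod_add_div n q, pow_add, pow_mul, hFq, one_pow, h, one_mul]
      · have e : F.eval^[n % q + q * (n / q)] x = x := by rw [Nat.mod_add_div, hfix]
        rw [Function.iterate_add_apply, Function.iterate_mul, Function.iterate_fixed hx1] at e
        exact e
    · -- parabolic case
      have hpow := F.eventually_eval_pow q
      have hψ : AnalyticAt ℂ F.eval^[q] 0 := (F ^ q).isGermOf_eval.analyticAt.congr hpow
      obtain ⟨r, hr, hb⟩ := exists_radius_of_parabolic hψ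
        (by rw [← hpow.self_of_nhds, eval_zero])
        (by rw [← (show (F ^ q).eval =ᶠ[𝓝 0] F.eval^[q] from hpow).deriv_eq,
              ← (F ^ q).isGermOf_eval.coeff_one_eq, coeff_one_pow, hroot1])
        (fun h => hFq (eq_one_of_eventually (by
          filter_upwards [h, hpow] with x h1 h2
          rw [h2, h1])))
      -- a cycle of `F` is also a cycle of `F^q`, contained in the former
      refine ⟨r, hr, fun n hn _ x horb hfix => hb n hn x (fun i _ => ?_) ?_⟩
      · have e : F.eval^[q * i] x = F.eval^[q * i % n] x := by
          conv_lhs => rw [← Nat.mod_add_div (q * i) n, Function.iterate_add_apply,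
            Function.iterate_mul, Function.iterate_fixed hfix]
        rw [← Function.iterate_mul, e]
        exact horb _ (Nat.mod_lt _ hn)
      · rw [← Function.iterate_mul, mul_comm, Function.iterate_mul, Function.iterate_fixed hfix]
  -- attracting, irrationally indifferent and repelling fixed points
  rcases lt_trichotomy ‖F.coeff 1‖ 1 with hlt | heq | hgt
  · obtain ⟨r, hr, hb⟩ := exists_radius_of_monotone (φ := F.eval) (V := fun x => -‖x‖) (by
      filter_upwards [F.eventually_eval_ne_zero, hlim.eventually (gt_mem_nhds hlt),
        self_mem_nhdsWithin] with x h1 h2 h3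
      refine ⟨h1, neg_lt_neg ?_⟩
      rwa [div_lt_one (norm_pos_iff.2 h3)] at h2)
    exact ⟨r, hr, fun n hn _ => hb n hn⟩
  · have hlin : F.IsLinearizable := by
      by_contra hl
      refine hF ⟨heq, fun n hn h => hroot ⟨n, hn, ?_⟩, hl⟩
      have := congrArg (fun u : ℂˣ => (u : ℂ)) h
      simpa [multiplier] using this
    obtain ⟨h, hh⟩ := hlin
    have hconj : h * F = linear F.multiplier * h := by rw [← hh]; group
    have h1 : ∀ᶠ x in 𝓝 0, h.eval (F.eval x) = F.coeff 1 * h.eval x := by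
      have e1 := h.eventually_eval_mul F
      have e2 := ((isGermOf_linear F.multiplier).mul h.isGermOf_eval).eventuallyEq
        (linear F.multiplier * h).isGermOf_eval
      rw [← hconj] at e2
      filter_upwards [e1, e2] with x hx1 hx2
      rw [← hx1, ← hx2]
      rfl
    have h2 := h.eventually_eval_ne_zero
    rw [eventually_nhdsWithin_iff] at h2
    obtain ⟨r, hr, hb⟩ := Metric.eventually_nhds_iff_ball.1 (h1.and h2)
    refine ⟨r, hr, fun n hn _ x horb hfix => ?_⟩
    have key : ∀ i ≤ n, h.eval (F.eval^[i] x) = F.coeff 1 ^ i * h.eval x := by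
      intro i
      induction i with
      | zero => simp
      | succ i ih =>
        intro hi
        rw [Function.iterate_succ_apply', (hb _ (mem_ball_zero_iff.2 (horb i (by omega)))).1,
          ih (by omega), pow_succ']
        ring
    by_contra hx0
    have hne := (hb x (mem_ball_zero_iff.2 (horb 0 hn))).2 hx0
    have := key n le_rfl
    rw [hfix] at this
    refine hroot ⟨n, hn, mul_right_cancel₀ hne ?_⟩
    rw [← this, one_mul]
  · obtain ⟨r, hr, hb⟩ := exists_radius_of_monotone (φ := F.eval) (V := fun x => ‖x‖) (by
      filter_upwards [F.eventually_eval_ne_zero, hlim.eventually (lt_mem_nhds hgt),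
        self_mem_nhdsWithin] with x h1 h2 h3
      refine ⟨h1, ?_⟩
      rwa [one_lt_div (norm_pos_iff.2 h3)] at h2)
    exact ⟨r, hr, fun n hn _ => hb n hn⟩

end DiffGerm

/-! ### Domains of the words -/

namespace DiffGerm

theorem univalentOn_of_lt_univalenceRadius {h : DiffGerm} {t : ℝ} (ht : 0 < t)
    (hlt : ENNReal.ofReal t < h.univalenceRadius) : h.UnivalentOn t := by
  obtain ⟨r, hr⟩ := lt_iSup_iff.1 hlt
  obtain ⟨hu, hr⟩ := lt_iSup_iff.1 hr
  exact hu.mono ((ENNReal.ofReal_lt_ofReal_iff_of_nonneg ht.le).1 hr).le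

theorem univalentOn_of_mem_openDom {h : DiffGerm} {z : ℂ} (hz : z ∈ h.openDom) (hz0 : z ≠ 0) :
    h.UnivalentOn (‖z‖ / 0.9) := by
  have hz' : ENNReal.ofReal ‖z‖ < 9 / 10 * h.univalenceRadius := hz
  have hn : 0 < ‖z‖ := norm_pos_iff.2 hz0
  refine univalentOn_of_lt_univalenceRadius (by positivity) ?_
  have e : ENNReal.ofReal ‖z‖ = 9 / 10 * ENNReal.ofReal (‖z‖ / 0.9) := by
    have : (9 / 10 : ℝ≥0∞) = ENNReal.ofReal 0.9 := by
      rw [show (0.9 : ℝ) = 9 / 10 by norm_num, ENNReal.ofReal_div_of_pos (by norm_num)]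
      norm_num
    rw [this, ← ENNReal.ofReal_mul (by norm_num)]
    congr 1
    field_simp
  rw [e] at hz'
  exact lt_of_mul_lt_mul_left' hz'

/-- On a smaller open set of parameters, the radius of univalence is almost constant, as long as
it is lower semicontinuous: a parameter whose radius nearly attains the supremum has a
neighbourhood on which the radius is between that supremum and slightly less. The radii may be
infinite or unbounded, so the discs are truncated at the radius `C`. -/
theorem exists_uniform_radius {X : Type*} [TopologicalSpace X] (Φ : X → DiffGerm)
    (hΦ : ∀ x s r, (Φ x).UnivalentOn s → r < s → ∀ᶠ x' in 𝓝 x, (Φ x').UnivalentOn r)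
    (C : ℝ) {V : Set X} (hV : IsOpen V) (hne : V.Nonempty) :
    ∃ V' ⊆ V, IsOpen V' ∧ V'.Nonempty ∧ ∃ s : ℝ, 0 < s ∧ ∀ x ∈ V', (Φ x).UnivalentOn s ∧
      ∀ z ∈ (Φ x).openDom, ‖z‖ ≤ C → ‖z‖ ≤ 0.905 * s := by
  set C' := max C 1 / 0.9 with hC'
  have hC'0 : 0 < C' := div_pos (lt_max_of_lt_right one_pos) (by norm_num)
  set A : Set ℝ := {r | 0 < r ∧ r ≤ C' ∧ ∃ x ∈ V, (Φ x).UnivalentOn r} with hA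
  have hAb : BddAbove A := ⟨C', fun r hr => hr.2.1⟩
  obtain ⟨x₀, hx₀⟩ := hne
  obtain ⟨r₀, hr₀, hu₀⟩ := (Φ x₀).exists_univalentOn
  have hr₀A : min r₀ C' ∈ A :=
    ⟨lt_min hr₀ hC'0, min_le_right _ _, x₀, hx₀, hu₀.mono (min_le_left _ _)⟩
  have hS : 0 < sSup A := lt_of_lt_of_le hr₀A.1 (le_csSup hAb hr₀A)
  obtain ⟨r₁, ⟨hr₁, -, x₁, hx₁, hu₁⟩, hr₁S⟩ :=
    exists_lt_of_lt_csSup ⟨_, hr₀A⟩ (show sSup A / 1.002 < sSup A from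
      div_lt_self hS (by norm_num))
  rw [div_lt_iff₀ (by norm_num)] at hr₁S
  obtain ⟨O, hOsub, hO, hxO⟩ := mem_nhds_iff.1
    (hΦ x₁ r₁ (r₁ / 1.002) hu₁ (div_lt_self hr₁ (by norm_num)))
  refine ⟨V ∩ O, inter_subset_left, hV.inter hO, ⟨x₁, hx₁, hxO⟩, r₁ / 1.002, by positivity,
    fun x hx => ⟨hOsub hx.2, fun z hz hzC => ?_⟩⟩
  rcases eq_or_ne z 0 with rfl | hz0
  · rw [norm_zero]; positivity
  have hmem : ‖z‖ / 0.9 ∈ A := by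
    refine ⟨div_pos (norm_pos_iff.2 hz0) (by norm_num), ?_, x, hx.1,
      univalentOn_of_mem_openDom hz hz0⟩
    rw [hC']
    gcongr
    exact hzC.trans (le_max_left _ _)
  have h1 := le_csSup hAb hmem
  rw [div_le_iff₀ (by norm_num)] at h1
  have h2 : 0.905 * (r₁ / 1.002) = 0.905 / 1.002 * r₁ := by ring
  rw [h2]
  nlinarith

end DiffGerm

/-- Pairs of germs tangent to the identity to order `α`. -/
abbrev GermPair (α : ℕ) : Type := DiffGerm.tangentToId α × DiffGerm.tangentToId α

theorem continuous_conjGerm {α : ℕ} (θ : Letter × Bool) :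
    Continuous fun h : GermPair α => conjGerm h.1 h.2 θ := by
  obtain ⟨θ, _⟩ := θ
  cases θ
  · exact continuous_subtype_val.comp continuous_fst
  · exact continuous_subtype_val.comp continuous_snd

/-- An open set `V` of pairs of germs, with radii of discs on which all the conjugating germs,
their inverses, and the base germs `f^{±1}`, `g^{±1}` are univalent. -/
structure UnivalenceFrame (f g : DiffGerm) (α : ℕ) where
  /-- The open set of pairs. -/
  V : Set (GermPair α)
  isOpen_V : IsOpen V
  /-- A radius of univalence for the base germs. -/
  R₀ : ℝ
  /-- Radii of univalence for the conjugating germs. -/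
  s : Letter × Bool → ℝ
  /-- Radii of univalence for the inverses of the conjugating germs. -/
  s' : Letter × Bool → ℝ
  s_pos : ∀ θ, 0 < s θ
  s'_pos : ∀ θ, 0 < s' θ
  base : ∀ θ, (baseGerm f g θ).UnivalentOn R₀
  conj : ∀ h ∈ V, ∀ θ, (conjGerm h.1 h.2 θ).UnivalentOn (s θ)
  conj_inv : ∀ h ∈ V, ∀ θ, (conjGerm h.1 h.2 θ)⁻¹.UnivalentOn (s' θ)

namespace UnivalenceFrame

variable {f g : DiffGerm} {α : ℕ} (Q : UnivalenceFrame f g α)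

/-- An open domain for the map substituted for a letter, slightly larger than the one prescribed by
the `9/10` rule. The constant `0.91` is the one of `comp_eq_of_univalent`. -/
def stepDom (h : GermPair α) (θ : Letter × Bool) : Set ℂ :=
  {z | ‖z‖ < 0.91 * Q.s θ ∧ ‖(conjGerm h.1 h.2 θ).eval z‖ < Q.R₀ ∧
    ‖(baseGerm f g θ).eval ((conjGerm h.1 h.2 θ).eval z)‖ < 0.91 * Q.s' θ}

/-- The open domain of a composition of letters. -/
def chainDom (h : GermPair α) : List (Letter × Bool) → Set ℂ
  | [] => univ
  | θ :: L => {z | z ∈ chainDom h L ∧ spellingMap f g h.1 h.2 L z ∈ Q.stepDom h θ}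

/-- The total space of the domains `chainDom`. -/
def totalDom (L : List (Letter × Bool)) : Set (GermPair α × ℂ) :=
  {p | p.1 ∈ Q.V ∧ p.2 ∈ Q.chainDom p.1 L}

variable {Q}

theorem mem_ball_of_lt {a s : ℝ} {z : ℂ} (ha : ‖z‖ < a * s) (ha1 : a ≤ 1) (ha0 : 0 < a) :
    z ∈ Metric.ball (0 : ℂ) s := by
  rw [mem_ball_zero_iff]
  have : 0 < a * s := (norm_nonneg z).trans_lt ha
  have hs : 0 < s := (pos_iff_pos_of_mul_pos this).1 ha0
  nlinarith

section step

variable {h : GermPair α} {θ : Letter × Bool} {z : ℂ}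

theorem stepDom_mem_ball (hz : z ∈ Q.stepDom h θ) : z ∈ Metric.ball (0 : ℂ) (Q.s θ) :=
  mem_ball_of_lt hz.1 (by norm_num) (by norm_num)

theorem stepDom_mem_ball_base (hz : z ∈ Q.stepDom h θ) :
    (conjGerm h.1 h.2 θ).eval z ∈ Metric.ball (0 : ℂ) Q.R₀ := mem_ball_zero_iff.2 hz.2.1

theorem stepDom_mem_ball_inv (hz : z ∈ Q.stepDom h θ) :
    (baseGerm f g θ).eval ((conjGerm h.1 h.2 θ).eval z) ∈ Metric.ball (0 : ℂ) (Q.s' θ) :=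
  mem_ball_of_lt hz.2.2 (by norm_num) (by norm_num)

theorem continuousAt_conjGerm_eval (hh : h ∈ Q.V) (hz : z ∈ Metric.ball (0 : ℂ) (Q.s θ)) :
    ContinuousAt (fun p : GermPair α × ℂ => (conjGerm p.1.1 p.1.2 θ).eval p.2) (h, z) := by
  have h1 : ContinuousAt (fun p : GermPair α × ℂ => (conjGerm p.1.1 p.1.2 θ, p.2)) (h, z) :=
    (((continuous_conjGerm θ).comp continuous_fst).prodMk continuous_snd).continuousAt
  exact ContinuousAt.comp (f := fun p : GermPair α × ℂ => (conjGerm p.1.1 p.1.2 θ, p.2))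
    (DiffGerm.continuousAt_eval (Q.conj h hh θ) hz) h1

theorem continuousAt_baseGerm_eval (hh : h ∈ Q.V) (hz : z ∈ Metric.ball (0 : ℂ) (Q.s θ))
    (hz' : (conjGerm h.1 h.2 θ).eval z ∈ Metric.ball (0 : ℂ) Q.R₀) :
    ContinuousAt (fun p : GermPair α × ℂ =>
      (baseGerm f g θ).eval ((conjGerm p.1.1 p.1.2 θ).eval p.2)) (h, z) := by
  have h1 : ContinuousAt (baseGerm f g θ).eval ((conjGerm h.1 h.2 θ).eval z) :=
    ((Q.base θ).differentiableOn.differentiableAt (Metric.isOpen_ball.mem_nhds hz')).continuousAt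
  exact ContinuousAt.comp (f := fun p : GermPair α × ℂ => (conjGerm p.1.1 p.1.2 θ).eval p.2) h1
    (continuousAt_conjGerm_eval hh hz)

theorem continuousAt_conjMap (hh : h ∈ Q.V) (hz : z ∈ Q.stepDom h θ) :
    ContinuousAt (fun p : GermPair α × ℂ =>
      DiffGerm.conjMap (baseGerm f g θ) (conjGerm p.1.1 p.1.2 θ) p.2) (h, z) := by
  have h1 : ContinuousAt (fun p : GermPair α × ℂ => (conjGerm p.1.1 p.1.2 θ,
      (baseGerm f g θ).eval ((conjGerm p.1.1 p.1.2 θ).eval p.2))) (h, z) :=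
    ((continuous_conjGerm θ).comp continuous_fst).continuousAt.prodMk
      (continuousAt_baseGerm_eval hh (stepDom_mem_ball hz) (stepDom_mem_ball_base hz))
  exact ContinuousAt.comp (f := fun p : GermPair α × ℂ => (conjGerm p.1.1 p.1.2 θ,
      (baseGerm f g θ).eval ((conjGerm p.1.1 p.1.2 θ).eval p.2)))
    (DiffGerm.continuousAt_inv_eval (Q.conj_inv h hh θ) (stepDom_mem_ball_inv hz)) h1

theorem eventually_mem_stepDom (hh : h ∈ Q.V) (hz : z ∈ Q.stepDom h θ) :
    ∀ᶠ p : GermPair α × ℂ in 𝓝 (h, z), p.2 ∈ Q.stepDom p.1 θ := by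
  have h1 : ContinuousAt (fun p : GermPair α × ℂ => ‖p.2‖) (h, z) := by fun_prop
  have h2 := (continuousAt_conjGerm_eval hh (stepDom_mem_ball hz)).norm
  have h3 := (continuousAt_baseGerm_eval hh (stepDom_mem_ball hz) (stepDom_mem_ball_base hz)).norm
  filter_upwards [h1.eventually (gt_mem_nhds hz.1), h2.eventually (gt_mem_nhds hz.2.1),
    h3.eventually (gt_mem_nhds hz.2.2)] with p hp1 hp2 hp3 using ⟨hp1, hp2, hp3⟩

theorem differentiableAt_conjMap (hh : h ∈ Q.V) (hz : z ∈ Q.stepDom h θ) :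
    DifferentiableAt ℂ (DiffGerm.conjMap (baseGerm f g θ) (conjGerm h.1 h.2 θ)) z := by
  have h1 := (Q.conj h hh θ).differentiableOn.differentiableAt
    (Metric.isOpen_ball.mem_nhds (stepDom_mem_ball hz))
  have h2 := (Q.base θ).differentiableOn.differentiableAt
    (Metric.isOpen_ball.mem_nhds (stepDom_mem_ball_base hz))
  have h3 := (Q.conj_inv h hh θ).differentiableOn.differentiableAt
    (Metric.isOpen_ball.mem_nhds (stepDom_mem_ball_inv hz))
  exact h3.comp z (h2.comp z h1)

theorem conjMap_injOn (hh : h ∈ Q.V) :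
    InjOn (DiffGerm.conjMap (baseGerm f g θ) (conjGerm h.1 h.2 θ)) (Q.stepDom h θ) := by
  intro z hz w hw e
  exact (Q.conj h hh θ).injOn (stepDom_mem_ball hz) (stepDom_mem_ball hw)
    ((Q.base θ).injOn (stepDom_mem_ball_base hz) (stepDom_mem_ball_base hw)
      ((Q.conj_inv h hh θ).injOn (stepDom_mem_ball_inv hz) (stepDom_mem_ball_inv hw) e))

theorem conjMap_ne_zero (hh : h ∈ Q.V) (hz : z ∈ Q.stepDom h θ) (hz0 : z ≠ 0) :
    DiffGerm.conjMap (baseGerm f g θ) (conjGerm h.1 h.2 θ) z ≠ 0 := by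
  have h0 : (0 : ℂ) ∈ Q.stepDom h θ := by
    simp only [stepDom, mem_ofPred_eq, DiffGerm.eval_zero, norm_zero]
    exact ⟨(norm_nonneg _).trans_lt hz.1, (norm_nonneg _).trans_lt hz.2.1,
      (norm_nonneg _).trans_lt hz.2.2⟩
  intro e
  refine hz0 (conjMap_injOn hh hz h0 ?_)
  rw [e]
  simp [DiffGerm.conjMap, DiffGerm.eval_zero]

end step

section chain

variable {h : GermPair α} {z : ℂ}

theorem continuousAt_spellingMap (hh : h ∈ Q.V) {L : List (Letter × Bool)}
    (hz : z ∈ Q.chainDom h L) :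
    ContinuousAt (fun p : GermPair α × ℂ => spellingMap f g p.1.1 p.1.2 L p.2) (h, z) := by
  induction L with
  | nil => exact continuousAt_snd
  | cons θ L ih =>
    have h1 : ContinuousAt (fun p : GermPair α × ℂ =>
        (p.1, spellingMap f g p.1.1 p.1.2 L p.2)) (h, z) := continuousAt_fst.prodMk (ih hz.1)
    have h2 := continuousAt_conjMap hh hz.2
    generalize hS : (fun p : GermPair α × ℂ =>
      (p.1, spellingMap f g p.1.1 p.1.2 L p.2)) = S at h1
    have hS' : S (h, z) = (h, spellingMap f g h.1 h.2 L z) := by rw [← hS]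
    rw [← hS'] at h2
    have h3 := h2.comp h1
    rw [← hS] at h3
    exact h3

theorem isOpen_totalDom (L : List (Letter × Bool)) : IsOpen (Q.totalDom L) := by
  rw [isOpen_iff_mem_nhds]
  rintro ⟨h, z⟩ ⟨hh, hz⟩
  induction L with
  | nil =>
    filter_upwards [continuousAt_fst.eventually (Q.isOpen_V.mem_nhds hh)] with p hp
      using ⟨hp, trivial⟩
  | cons θ L ih =>
    have h1 : ContinuousAt (fun p : GermPair α × ℂ =>
        (p.1, spellingMap f g p.1.1 p.1.2 L p.2)) (h, z) :=
      continuousAt_fst.prodMk (continuousAt_spellingMap hh hz.1)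
    filter_upwards [ih hz.1, h1.eventually (eventually_mem_stepDom hh hz.2)] with p hp1 hp2
      using ⟨hp1.1, hp1.2, hp2⟩

theorem differentiableAt_spellingMap (hh : h ∈ Q.V) {L : List (Letter × Bool)}
    (hz : z ∈ Q.chainDom h L) : DifferentiableAt ℂ (spellingMap f g h.1 h.2 L) z := by
  induction L with
  | nil => exact differentiableAt_id
  | cons θ L ih => exact (differentiableAt_conjMap hh hz.2).comp z (ih hz.1)

theorem spellingMap_injOn (hh : h ∈ Q.V) (L : List (Letter × Bool)) :
    InjOn (spellingMap f g h.1 h.2 L) (Q.chainDom h L) := by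
  induction L with
  | nil => exact injOn_id _
  | cons θ L ih =>
    intro z hz w hw e
    exact ih hz.1 hw.1 (conjMap_injOn hh hz.2 hw.2 e)

theorem spellingMap_ne_zero (hh : h ∈ Q.V) {L : List (Letter × Bool)}
    (hz : z ∈ Q.chainDom h L) (hz0 : z ≠ 0) : spellingMap f g h.1 h.2 L z ≠ 0 := by
  induction L with
  | nil => exact hz0
  | cons θ L ih => exact conjMap_ne_zero hh hz.2 (ih hz.1)

theorem spellingMap_append (M N : List (Letter × Bool)) (h₁ h₂ : DiffGerm) (z : ℂ) :
    spellingMap f g h₁ h₂ (M ++ N) z =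
      spellingMap f g h₁ h₂ M (spellingMap f g h₁ h₂ N z) := by
  induction M with
  | nil => rfl
  | cons θ M ih => simp only [List.cons_append, spellingMap, ih]

theorem mem_chainDom_append {M N : List (Letter × Bool)} :
    z ∈ Q.chainDom h (M ++ N) ↔
      z ∈ Q.chainDom h N ∧ spellingMap f g h.1 h.2 N z ∈ Q.chainDom h M := by
  induction M with
  | nil => simp [chainDom]
  | cons θ M ih =>
    simp only [List.cons_append, chainDom, mem_ofPred_eq, ih, spellingMap_append]
    tauto

theorem mem_chainDom_of_suffix {M L : List (Letter × Bool)} (hM : M <:+ L)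
    (hz : z ∈ Q.chainDom h L) : z ∈ Q.chainDom h M := by
  obtain ⟨P, rfl⟩ := hM
  exact (mem_chainDom_append.1 hz).1

/-- The map `(h, z) ↦ (h, w_h z)`, where `w_h` is the value of a word at the pair `h`, sends every
nonempty open set to a set with nonempty interior. -/
theorem exists_open_subset_image {L : List (Letter × Bool)} {O : Set (GermPair α × ℂ)}
    (hO : IsOpen O) (hne : O.Nonempty) (hOL : O ⊆ Q.totalDom L) :
    ∃ O' : Set (GermPair α × ℂ), IsOpen O' ∧ O'.Nonempty ∧
      ∀ p ∈ O', ∃ z, (p.1, z) ∈ O ∧ spellingMap f g p.1.1 p.1.2 L z = p.2 := by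
  obtain ⟨⟨h₀, z₀⟩, hp⟩ := hne
  obtain ⟨A, B, hA, hB, hAh, hBz, hAB⟩ := isOpen_prod_iff.1 hO h₀ z₀ hp
  obtain ⟨r, hr, hrB⟩ := Metric.nhds_basis_closedBall.mem_iff.1 (hB.mem_nhds hBz)
  set w : GermPair α → ℂ → ℂ := fun h => spellingMap f g h.1 h.2 L with hw
  have hmem : ∀ h ∈ A, ∀ z ∈ Metric.closedBall z₀ r, (h, z) ∈ Q.totalDom L := fun h hh z hz =>
    hOL (hAB ⟨hh, hrB hz⟩)
  have hinj : ∀ h ∈ A, InjOn (w h) (Metric.closedBall z₀ r) := fun h hh z hz z' hz' e =>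
    spellingMap_injOn (hmem h hh z hz).1 L (hmem h hh z hz).2 (hmem h hh z' hz').2 e
  have hz₀r : z₀ ∈ Metric.closedBall z₀ r := Metric.mem_closedBall_self hr.le
  have hsph : ∀ z ∈ Metric.sphere z₀ r, z ∈ Metric.closedBall z₀ r := fun z hz =>
    Metric.sphere_subset_closedBall hz
  have hcont : ∀ h ∈ A, ∀ z ∈ Metric.closedBall z₀ r,
      ContinuousAt (fun p : GermPair α × ℂ => w p.1 p.2) (h, z) := fun h hh z hz =>
    continuousAt_spellingMap (hmem h hh z hz).1 (hmem h hh z hz).2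
  -- a lower bound on a circle for the central parameter, which persists for nearby parameters
  obtain ⟨ε, hε, hεb⟩ : ∃ ε : ℝ, 0 < ε ∧ ∀ z ∈ Metric.sphere z₀ r, ε < ‖w h₀ z - w h₀ z₀‖ := by
    have hc : ContinuousOn (fun z => ‖w h₀ z - w h₀ z₀‖) (Metric.sphere z₀ r) := by
      intro z hz
      have hm := hmem h₀ hAh z (hsph z hz)
      have : ContinuousAt (w h₀) z := (differentiableAt_spellingMap hm.1 hm.2).continuousAt
      exact (this.sub continuousAt_const).norm.continuousWithinAt
    rcases (Metric.sphere z₀ r).eq_empty_or_nonempty with he | hne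
    · exact ⟨1, one_pos, fun z hz => by rw [he] at hz; exact absurd hz (notMem_empty z)⟩
    obtain ⟨z₁, hz₁, hmin⟩ := (isCompact_sphere z₀ r).exists_isMinOn hne hc
    have hpos : 0 < ‖w h₀ z₁ - w h₀ z₀‖ := by
      refine norm_pos_iff.2 (sub_ne_zero.2 fun e => ?_)
      have := hinj h₀ hAh (hsph z₁ hz₁) hz₀r e
      rw [this, Metric.mem_sphere, dist_self] at hz₁
      exact hr.ne hz₁
    exact ⟨_, half_pos hpos, fun z hz => (half_lt_self hpos).trans_le (hmin hz)⟩
  have hev : ∀ᶠ h in 𝓝 h₀, ∀ z ∈ Metric.sphere z₀ r, ε < ‖w h z - w h z₀‖ := by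
    refine (isCompact_sphere z₀ r).eventually_forall_of_forall_eventually
      (P := fun h z => ε < ‖w h z - w h z₀‖) fun z hz => ?_
    have h1 := hcont h₀ hAh z (hsph z hz)
    have h2 : ContinuousAt (fun p : GermPair α × ℂ => w p.1 z₀) (h₀, z) := by
      have h3 : ContinuousAt (fun p : GermPair α × ℂ => (p.1, z₀)) (h₀, z) :=
        continuousAt_fst.prodMk continuousAt_const
      exact (hcont h₀ hAh z₀ hz₀r).tendsto.comp h3.tendsto
    exact (h1.sub h2).norm.eventually (lt_mem_nhds (hεb z hz))
  have hev2 : ∀ᶠ h in 𝓝 h₀, dist (w h z₀) (w h₀ z₀) < ε / 4 := by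
    have h2 : ContinuousAt (fun h : GermPair α => w h z₀) h₀ := by
      have h3 : ContinuousAt (fun h : GermPair α => (h, z₀)) h₀ :=
        continuousAt_id.prodMk continuousAt_const
      exact (hcont h₀ hAh z₀ hz₀r).tendsto.comp h3.tendsto
    exact Metric.continuousAt_iff'.1 h2 _ (by positivity)
  obtain ⟨A', hA'sub, hA', hA'h⟩ := mem_nhds_iff.1 ((hev.and hev2).and (hA.mem_nhds hAh))
  refine ⟨A' ×ˢ Metric.ball (w h₀ z₀) (ε / 4), hA'.prod Metric.isOpen_ball,
    ⟨(h₀, w h₀ z₀), hA'h, Metric.mem_ball_self (by positivity)⟩, ?_⟩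
  rintro ⟨h, y⟩ ⟨hh, hy⟩
  obtain ⟨⟨hh1, hh2⟩, hhA⟩ := hA'sub hh
  have hd : DifferentiableOn ℂ (w h) (Metric.closedBall z₀ r) := fun z hz =>
    (differentiableAt_spellingMap (hmem h hhA z hz).1
      (hmem h hhA z hz).2).differentiableWithinAt
  have hfreq : ∃ᶠ z in 𝓝 z₀, w h z ≠ w h z₀ := by
    have h1 : ∀ᶠ z in 𝓝[≠] z₀, w h z ≠ w h z₀ := by
      filter_upwards [nhdsWithin_le_nhds (Metric.closedBall_mem_nhds z₀ hr), self_mem_nhdsWithin]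
        with z hz hz0 e using hz0 (hinj h hhA hz hz₀r e)
    exact h1.frequently.filter_mono nhdsWithin_le_nhds
  have hdc := (hd.mono Metric.closure_ball_subset_closedBall).diffContOnCl
  have himg := hdc.ball_subset_image_closedBall hr (fun z hz => (hh1 z hz).le) hfreq
  obtain ⟨z, hz, hzy⟩ := himg (show y ∈ Metric.ball (w h z₀) (ε / 2) by
    rw [Metric.mem_ball] at hy ⊢
    have := dist_triangle_right y (w h z₀) (w h₀ z₀)
    linarith)
  exact ⟨z, hAB ⟨hhA, hrB hz⟩, hzy⟩

end chain

end UnivalenceFrame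

/-! ### Spellings -/

/-- A spelling in which adjacent equal letters are not inverse to each other, and in which no run of
one letter stands for the identity. -/
def IsNontrivialSpelling (f g : DiffGerm) (L : List (Letter × Bool)) : Prop :=
  L.IsChain (fun p q => p.1 = q.1 → p = q) ∧
    ∀ n θ, n ≠ 0 → List.replicate n θ <:+: L → baseGerm f g θ ^ n ≠ 1

theorem IsNontrivialSpelling.infix {f g : DiffGerm} {L M : List (Letter × Bool)}
    (hL : IsNontrivialSpelling f g L) (hM : M <:+: L) : IsNontrivialSpelling f g M :=
  ⟨hL.1.infix hM, fun n θ hn h => hL.2 n θ hn (h.trans hM)⟩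

theorem pow_ne_one_of_isReducedExponent {F : DiffGerm} {r : ℤ}
    (hr : IsReducedExponent (orderOf F) r) {n : ℕ} (hn : n ≠ 0) (hnr : n ≤ r.natAbs) :
    (0 < r → F ^ n ≠ 1) ∧ (¬ 0 < r → F⁻¹ ^ n ≠ 1) := by
  have key : (orderOf F = 0 ∨ 0 < r) → F ^ n ≠ 1 := by
    intro h e
    have hdvd := orderOf_dvd_of_pow_eq_one e
    unfold IsReducedExponent at hr
    split_ifs at hr with h0
    · rw [h0, zero_dvd_iff] at hdvd
      exact hn hdvd
    · have := Nat.le_of_dvd (by omega) hdvd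
      omega
  refine ⟨fun h => key (Or.inr h), fun h e => key ?_ (by simpa using e)⟩
  unfold IsReducedExponent at hr
  split_ifs at hr with h0
  · exact Or.inl h0
  · omega

theorem baseGerm_pow_ne_one {f g : DiffGerm} {p : Letter × ℤ}
    (hp : match p.1 with
      | .a => IsReducedExponent (orderOf f) p.2
      | .b => IsReducedExponent (orderOf g) p.2) {n : ℕ} (hn : n ≠ 0) (hnr : n ≤ p.2.natAbs) :
    baseGerm f g (p.1, decide (0 < p.2)) ^ n ≠ 1 := by
  obtain ⟨θ, r⟩ := p
  cases θ <;>
  · have h := pow_ne_one_of_isReducedExponent hp hn hnr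
    by_cases hr : 0 < r
    · simpa [hr, baseGerm] using h.1 hr
    · simpa [hr, baseGerm] using h.2 hr

theorem natAbs_ne_zero_of_isReduced {f g : DiffGerm} {W : Word} (hW : W.IsReduced f g)
    {p : Letter × ℤ} (hp : p ∈ W) : p.2.natAbs ≠ 0 := by
  have h := hW.2 p hp
  have key : ∀ n, IsReducedExponent n p.2 → p.2.natAbs ≠ 0 := by
    intro n hn
    unfold IsReducedExponent at hn
    split_ifs at hn <;> omega
  split at h <;> exact key _ h

theorem Word.spelling_cons (p : Letter × ℤ) (W : Word) :
    Word.spelling (p :: W) =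
      List.replicate p.2.natAbs (p.1, decide (0 < p.2)) ++ Word.spelling W := rfl

theorem Word.spelling_ne_nil {f g : DiffGerm} {W : Word} (hW : W.IsReduced f g) (hne : W ≠ []) :
    W.spelling ≠ [] := by
  cases W with
  | nil => exact absurd rfl hne
  | cons p W =>
    rw [Word.spelling_cons]
    intro h
    rw [List.append_eq_nil_iff, List.replicate_eq_nil_iff] at h
    exact natAbs_ne_zero_of_isReduced hW List.mem_cons_self h.1

theorem Word.IsReduced.isNontrivialSpelling {f g : DiffGerm} {W : Word} (hW : W.IsReduced f g) :
    IsNontrivialSpelling f g W.spelling := by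
  induction W with
  | nil =>
    refine ⟨List.IsChain.nil, fun n θ hn h => ?_⟩
    have := List.eq_nil_of_infix_nil h
    rw [List.replicate_eq_nil_iff] at this
    exact absurd this hn
  | cons p W ih =>
    have hW' : Word.IsReduced f g W :=
      ⟨hW.1.tail, fun q hq => hW.2 q (List.mem_cons_of_mem _ hq)⟩
    have ih := ih hW'
    rw [Word.spelling_cons]
    set θ₀ : Letter × Bool := (p.1, decide (0 < p.2)) with hθ₀
    -- the letter changes from one run to the next
    have hhead : ∀ x ∈ (Word.spelling W).head?, x.1 ≠ θ₀.1 := by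
      cases W with
      | nil => intro x hx; simp [Word.spelling] at hx
      | cons q W =>
        have hq := natAbs_ne_zero_of_isReduced hW' (p := q) List.mem_cons_self
        obtain ⟨m, hm⟩ := Nat.exists_eq_succ_of_ne_zero hq
        intro x hx
        rw [Word.spelling_cons, hm, List.replicate_succ] at hx
        simp only [List.cons_append, List.head?_cons, Option.mem_def, Option.some.injEq] at hx
        rw [← hx]
        exact (List.isChain_cons_cons.1 hW.1).1.symm
    refine ⟨List.isChain_append.2 ⟨?_, ih.1, ?_⟩, fun n θ hn hinf => ?_⟩
    · exact List.isChain_replicate_of_rel _ fun _ => rfl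
    · intro x hx y hy e
      have hx' := List.eq_of_mem_replicate (List.mem_of_mem_getLast? hx)
      rw [hx'] at e
      exact absurd e.symm (hhead y hy)
    · rcases List.infix_append_iff_ne_nil.1 hinf with h | h | ⟨t₁, t₂, ht₁, ht₂, he, hs, hp⟩
      · have hn' : n ≤ p.2.natAbs := by simpa using h.length_le
        have hθ : θ = θ₀ := List.eq_of_mem_replicate (h.subset (by simp [hn]))
        rw [hθ]
        exact baseGerm_pow_ne_one (hW.2 p List.mem_cons_self) hn hn'
      · exact ih.2 n θ hn h
      · exfalso
        have h1 : θ = θ₀ := by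
          obtain ⟨x, hx⟩ := List.exists_mem_of_ne_nil t₁ ht₁
          have e1 := List.eq_of_mem_replicate (hs.subset hx)
          have e2 : x = θ := List.eq_of_mem_replicate (n := n) (by
            rw [he]; exact List.mem_append_left _ hx)
          rw [← e1, e2]
        obtain ⟨x, t, rfl⟩ := List.exists_cons_of_ne_nil ht₂
        have e2 : x = θ := List.eq_of_mem_replicate (n := n) (by rw [he]; simp)
        obtain ⟨u, hu⟩ := hp
        refine hhead x ?_ (by rw [e2, h1])
        rw [← hu]
        simp

/-- Either two different letters are adjacent in the spelling, or it is a power of one letter. -/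
theorem exists_switch_or_eq_replicate {L : List (Letter × Bool)}
    (hL : L.IsChain (fun p q => p.1 = q.1 → p = q)) (hne : L ≠ []) :
    (∃ P θ' θ N, L = P ++ θ' :: θ :: N ∧ θ'.1 ≠ θ.1) ∨
      ∃ n θ, n ≠ 0 ∧ L = List.replicate n θ := by
  induction L with
  | nil => exact absurd rfl hne
  | cons θ' M ih =>
    cases M with
    | nil => exact Or.inr ⟨1, θ', one_ne_zero, rfl⟩
    | cons θ M =>
      obtain ⟨h1, h2⟩ := List.isChain_cons_cons.1 hL
      by_cases hθ : θ'.1 = θ.1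
      · rcases ih h2 (List.cons_ne_nil _ _) with ⟨P, φ', φ, N, hM, hφ⟩ | ⟨n, φ, hn, hM⟩
        · exact Or.inl ⟨θ' :: P, φ', φ, N, by rw [hM]; rfl, hφ⟩
        · right
          obtain ⟨m, rfl⟩ := Nat.exists_eq_succ_of_ne_zero hn
          have : θ = φ := by
            rw [List.replicate_succ] at hM
            exact (List.cons.inj hM).1
          refine ⟨m + 2, φ, by omega, ?_⟩
          rw [hM, h1 hθ, this]
          rfl
      · exact Or.inl ⟨[], θ', θ, M, rfl, hθ⟩

/-- Finitely many generic conditions hold simultaneously on a nonempty open subset. -/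
theorem exists_open_forall_mem {Y ι : Type*} [TopologicalSpace Y] (l : List ι) (P : ι → Y → Prop)
    {O : Set Y} (hO : IsOpen O) (hne : O.Nonempty)
    (h : ∀ i ∈ l, ∀ O' ⊆ O, IsOpen O' → O'.Nonempty →
      ∃ O'' ⊆ O', IsOpen O'' ∧ O''.Nonempty ∧ ∀ y ∈ O'', P i y) :
    ∃ O' ⊆ O, IsOpen O' ∧ O'.Nonempty ∧ ∀ i ∈ l, ∀ y ∈ O', P i y := by
  induction l with
  | nil => exact ⟨O, Subset.rfl, hO, hne, by simp⟩
  | cons i l ih =>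
    obtain ⟨O₁, h₁, hO₁, hne₁, hP₁⟩ := ih fun j hj => h j (List.mem_cons_of_mem _ hj)
    obtain ⟨O₂, h₂, hO₂, hne₂, hP₂⟩ := h i List.mem_cons_self O₁ h₁ hO₁ hne₁
    refine ⟨O₂, h₂.trans h₁, hO₂, hne₂, fun j hj y hy => ?_⟩
    rcases List.mem_cons.1 hj with rfl | hj
    · exact hP₂ y hy
    · exact hP₁ j hj y (h₂ hy)

/-! ### Words are generically different from the identity -/

open Polynomial in
/-- Perturbation of the conjugating germ of one letter, by a small multiple of a polynomial. -/
theorem exists_perturbation {α : ℕ} (h : GermPair α) (x : Letter) (p : ℂ[X])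
    (hp : X ^ (α + 2) ∣ p) :
    ∃ H : ℂ → GermPair α, Tendsto H (𝓝 0) (𝓝 h) ∧ ∀ t (θ : Letter × Bool),
      (θ.1 ≠ x → conjGerm (H t).1 (H t).2 θ = conjGerm h.1 h.2 θ) ∧
      (θ.1 = x → ∀ k, (conjGerm (H t).1 (H t).2 θ).coeff k =
        (conjGerm h.1 h.2 θ).coeff k + t * p.coeff k) := by
  cases x with
  | a =>
    obtain ⟨K, hK, hKt, hKc⟩ := DiffGerm.exists_add_polynomial h.1.1 h.1.2 p hp
    refine ⟨fun t => (⟨K t, hK t⟩, h.2), ?_, ?_⟩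
    · exact (tendsto_subtype_rng.2 hKt).prodMk_nhds tendsto_const_nhds
    · rintro t ⟨_ | _, b⟩
      · exact ⟨fun h => absurd rfl h, fun _ => hKc t⟩
      · exact ⟨fun _ => rfl, fun h => by cases h⟩
  | b =>
    obtain ⟨K, hK, hKt, hKc⟩ := DiffGerm.exists_add_polynomial h.2.1 h.2.2 p hp
    refine ⟨fun t => (h.1, ⟨K t, hK t⟩), ?_, ?_⟩
    · exact tendsto_const_nhds.prodMk_nhds (tendsto_subtype_rng.2 hKt)
    · rintro t ⟨_ | _, b⟩
      · exact ⟨fun _ => rfl, fun h => by cases h⟩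
      · exact ⟨fun h => absurd rfl h, fun _ => hKc t⟩

namespace UnivalenceFrame

variable {f g : DiffGerm} {α : ℕ} {Q : UnivalenceFrame f g α}

/-- Along a power of a single letter, the orbit is conjugate to an orbit of the base germ. Hence
its only fixed point is `0`. The conjugation goes through `comp_eq_of_univalent`: the conjugating
germ and its inverse cancel at every intermediate point of the orbit. -/
theorem eq_zero_of_spellingMap_replicate {h : GermPair α} (hh : h ∈ Q.V) {θ : Letter × Bool}
    {n : ℕ} (hn : n ≠ 0)
    (hper : ∀ x : ℂ, (∀ i < n, ‖(baseGerm f g θ).eval^[i] x‖ < Q.R₀) →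
      (baseGerm f g θ).eval^[n] x = x → x = 0)
    {z : ℂ} (hz : z ∈ Q.chainDom h (List.replicate n θ))
    (hfix : spellingMap f g h.1 h.2 (List.replicate n θ) z = z) : z = 0 := by
  set c := conjGerm h.1 h.2 θ with hc
  set F := (baseGerm f g θ).eval with hF
  set Z : ℕ → ℂ := fun i => spellingMap f g h.1 h.2 (List.replicate i θ) z with hZ
  have hZs : ∀ i, Z (i + 1) = c⁻¹.eval (F (c.eval (Z i))) := fun i => rfl
  have hstep : ∀ i < n, Z i ∈ Q.stepDom h θ := by
    intro i hi
    have hsuf : List.replicate (i + 1) θ <:+ List.replicate n θ :=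
      ⟨List.replicate (n - (i + 1)) θ, by rw [List.replicate_append_replicate]; congr 1; omega⟩
    exact (mem_chainDom_of_suffix hsuf hz).2
  have hback : ∀ i < n, ‖Z (i + 1)‖ < 0.91 * Q.s θ → c.eval (Z (i + 1)) = F (c.eval (Z i)) := by
    intro i hi hlt
    rw [hZs] at hlt ⊢
    exact comp_eq_of_univalent (Q.conj h hh θ).differentiableOn c.eval_zero
      (Q.conj_inv h hh θ).differentiableOn (Q.conj_inv h hh θ).injOn c⁻¹.eval_zero
      c.eventually_eval_inv_eval (hstep i hi).2.2.le hlt.le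
  have hiter : ∀ i < n, c.eval (Z i) = F^[i] (c.eval z) := by
    intro i
    induction i with
    | zero => exact fun _ => rfl
    | succ i ih =>
      intro hi
      rw [hback i (by omega) (hstep _ hi).1, ih (by omega), Function.iterate_succ_apply']
  obtain ⟨m, rfl⟩ := Nat.exists_eq_succ_of_ne_zero hn
  have hzs : z ∈ Q.stepDom h θ := hstep 0 (by omega)
  have hlast := hback m (by omega) (by
    change ‖spellingMap f g h.1 h.2 (List.replicate (m + 1) θ) z‖ < _
    rw [hfix]; exact hzs.1)
  have hcz : c.eval z = 0 := by
    refine hper _ (fun i hi => ?_) ?_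
    · rw [← hiter i hi]
      exact (hstep i hi).2.1
    · rw [Function.iterate_succ_apply', ← hiter m (by omega), ← hlast]
      change c.eval (spellingMap f g h.1 h.2 (List.replicate (m + 1) θ) z) = _
      rw [hfix]
  have hzb := stepDom_mem_ball hzs
  exact (Q.conj h hh θ).injOn hzb (Metric.mem_ball_self (Metric.pos_of_mem_ball hzb))
    (by rw [DiffGerm.eval_zero]; exact hcz)

open Polynomial in
/-- At a change of letter, the point reached there can be moved without moving the previous points
of the orbit: perturb the conjugating germ by a polynomial vanishing at all other points of the
orbit. If the word fixed the initial point before the perturbation, it does not do so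
afterwards. -/
theorem exists_ne_of_switch {L P N' : List (Letter × Bool)} {θ' θ : Letter × Bool}
    (hL : L = P ++ θ' :: θ :: N') (hθ : θ'.1 ≠ θ.1) {O : Set (GermPair α × ℂ)} (hO : IsOpen O)
    (hOL : O ⊆ Q.totalDom L) {h : GermPair α} {z : ℂ} (hz : (h, z) ∈ O) (hz0 : z ≠ 0)
    (hdist : ∀ M, M <:+ L → M ≠ θ :: N' → M ≠ L →
      spellingMap f g h.1 h.2 M z ≠ spellingMap f g h.1 h.2 (θ :: N') z) :
    ∃ p ∈ O, spellingMap f g p.1.1 p.1.2 L p.2 ≠ p.2 := by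
  by_contra! hcon
  set N := θ :: N' with hN
  set W : List (Letter × Bool) → ℂ := fun M => spellingMap f g h.1 h.2 M z with hW
  have hhV := (hOL hz).1
  have hzL := (hOL hz).2
  have hNL : N <:+ L := ⟨P ++ [θ'], by rw [hL]; simp⟩
  have hθNL : θ' :: N <:+ L := ⟨P, hL.symm⟩
  have hlen : N.length < L.length := by
    rw [hL]; simp only [List.length_append, List.length_cons (a := θ')]; omega
  have hWN0 : W N ≠ 0 := spellingMap_ne_zero hhV (mem_chainDom_of_suffix hNL hzL) hz0
  classical
  -- a polynomial vanishing at the points of the orbit, except the one where the letter changes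
  set S := (L.tails.filter fun M => M ≠ N ∧ M ≠ L) with hS
  set p : ℂ[X] := X ^ (α + 2) * (S.map fun M => X - C (W M)).prod with hp
  have hpN : p.eval (W N) ≠ 0 := by
    rw [hp, eval_mul, eval_pow, eval_X]
    refine mul_ne_zero (pow_ne_zero _ hWN0) ?_
    rw [← coe_evalRingHom, map_list_prod, List.map_map, Ne, List.prod_eq_zero_iff]
    intro hmem
    obtain ⟨M, hM, hM0⟩ := List.mem_map.1 hmem
    simp only [hS, List.mem_filter, List.mem_tails, decide_eq_true_eq] at hM
    simp only [Function.comp_apply, coe_evalRingHom, eval_sub, eval_X, eval_C] at hM0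
    exact hdist M hM.1 hM.2.1 hM.2.2 (sub_eq_zero.1 hM0).symm
  have hp0' : ∀ M, M <:+ L → M ≠ N → M ≠ L → p.eval (W M) = 0 := by
    intro M hM hMN hML
    rw [hp, eval_mul]
    refine mul_eq_zero_of_right _ ?_
    rw [← coe_evalRingHom, map_list_prod, List.map_map, List.prod_eq_zero_iff]
    refine List.mem_map.2 ⟨M, ?_, by simp⟩
    simp only [hS, List.mem_filter, List.mem_tails, decide_eq_true_eq]
    exact ⟨hM, hMN, hML⟩
  have hWL : W L = z := hcon _ hz
  have hLne : L ≠ [] := by rw [hL]; simp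
  have hp0 : ∀ M, M <:+ L → M ≠ N → p.eval (W M) = 0 := by
    intro M hM hMN
    by_cases hML : M = L
    · have := hp0' [] (List.nil_suffix) (by simp [hN]) hLne.symm
      rw [hML, hWL]
      exact this
    · exact hp0' M hM hMN hML
  obtain ⟨H, hHt, hHc⟩ := exists_perturbation h θ'.1 p (dvd_mul_right _ _)
  have hev1 : ∀ᶠ t in 𝓝 (0 : ℂ), (H t, z) ∈ O :=
    (hHt.prodMk_nhds tendsto_const_nhds).eventually (hO.mem_nhds hz)
  have hev2 : ∀ᶠ t in 𝓝 (0 : ℂ), ∀ b : Bool, ∀ y ∈ Metric.ball (0 : ℂ) (0.95 * Q.s' (θ'.1, b)),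
      DiffGerm.diffEval (conjGerm h.1 h.2 (θ'.1, b)) (conjGerm (H t).1 (H t).2 (θ'.1, b))
        ((conjGerm h.1 h.2 (θ'.1, b))⁻¹.eval y) = 0 →
      (conjGerm (H t).1 (H t).2 (θ'.1, b))⁻¹.eval y = (conjGerm h.1 h.2 (θ'.1, b))⁻¹.eval y := by
    rw [Filter.eventually_all]
    intro b
    have hpos := Q.s'_pos (θ'.1, b)
    have h1 := DiffGerm.eventually_inv_univalentOn (η := 1) (Q.conj_inv h hhV (θ'.1, b))
      (show 0.95 * Q.s' (θ'.1, b) < Q.s' (θ'.1, b) by linarith) one_pos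
    have h2 : Tendsto (fun t => conjGerm (H t).1 (H t).2 (θ'.1, b)) (𝓝 0)
        (𝓝 (conjGerm h.1 h.2 (θ'.1, b))) := ((continuous_conjGerm (θ'.1, b)).tendsto h).comp hHt
    exact (h2.eventually h1).mono fun t ht => ht.2.2
  obtain ⟨t, ⟨ht1, ht2⟩, ht0⟩ := (((hev1.and hev2).filter_mono nhdsWithin_le_nhds).and
    (self_mem_nhdsWithin (a := (0 : ℂ)) (s := {0}ᶜ))).exists
  have ht0 : t ≠ 0 := ht0
  set h' := H t with hh'
  have hh'V := (hOL ht1).1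
  have hzL' := (hOL ht1).2
  set W' : List (Letter × Bool) → ℂ := fun M => spellingMap f g h'.1 h'.2 M z with hW'
  -- the perturbed conjugating germ and its inverse, at a point of the old orbit
  have heval : ∀ φ : Letter × Bool, φ.1 = θ'.1 → ∀ x ∈ Metric.ball (0 : ℂ) (Q.s φ),
      (conjGerm h'.1 h'.2 φ).eval x = (conjGerm h.1 h.2 φ).eval x + t * p.eval x := by
    intro φ hφ x hx
    have hs := DiffGerm.hasSum_of_coeff_eq_add_polynomial ((hHc t φ).2 hφ) x
    rw [DiffGerm.eval_eq_add_diffEval (Q.conj h hhV φ) hx hs.summable, DiffGerm.diffEval,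
      hs.tsum_eq]
  have hinv : ∀ φ : Letter × Bool, φ.1 = θ'.1 → ∀ y, ‖y‖ < 0.91 * Q.s' φ →
      p.eval ((conjGerm h.1 h.2 φ)⁻¹.eval y) = 0 →
      (conjGerm h'.1 h'.2 φ)⁻¹.eval y = (conjGerm h.1 h.2 φ)⁻¹.eval y := by
    rintro ⟨φ, b⟩ hφ y hy hpy
    have hφ' : φ = θ'.1 := hφ
    subst hφ'
    refine ht2 b y ?_ ?_
    · rw [mem_ball_zero_iff]
      linarith [Q.s'_pos (θ'.1, b)]
    · rw [DiffGerm.diffEval,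
        (DiffGerm.hasSum_of_coeff_eq_add_polynomial ((hHc t (θ'.1, b)).2 rfl) _).tsum_eq, hpy,
        mul_zero]
  have key : ∀ (φ : Letter × Bool) (x : ℂ), x ∈ Q.stepDom h φ →
      (φ.1 ≠ θ'.1 ∨ (p.eval x = 0 ∧
        p.eval (DiffGerm.conjMap (baseGerm f g φ) (conjGerm h.1 h.2 φ) x) = 0)) →
      DiffGerm.conjMap (baseGerm f g φ) (conjGerm h'.1 h'.2 φ) x =
          DiffGerm.conjMap (baseGerm f g φ) (conjGerm h.1 h.2 φ) x ∧
        (conjGerm h'.1 h'.2 φ).eval x = (conjGerm h.1 h.2 φ).eval x := by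
    intro φ x hx hor
    by_cases hφ : φ.1 = θ'.1
    · obtain ⟨hpx, hpy⟩ := hor.resolve_left (not_not_intro hφ)
      have e := heval φ hφ x (stepDom_mem_ball hx)
      rw [hpx, mul_zero, add_zero] at e
      refine ⟨?_, e⟩
      simp only [DiffGerm.conjMap] at hpy ⊢
      rw [e]
      exact hinv φ hφ _ hx.2.2 hpy
    · rw [(hHc t φ).1 hφ]
      exact ⟨rfl, rfl⟩
  -- nothing moves before the change of letter
  have hbefore : ∀ M, M <:+ N → W' M = W M := by
    intro M
    induction M with
    | nil => exact fun _ => rfl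
    | cons φ M ih =>
      intro hM
      have hM1 : M <:+ N := (List.suffix_cons φ M).trans hM
      have hlenM : M.length < N.length := by
        have := hM.length_le; simp only [List.length_cons] at this; omega
      have e := ih hM1
      have hdom : W M ∈ Q.stepDom h φ := (mem_chainDom_of_suffix (hM.trans hNL) hzL).2
      change DiffGerm.conjMap _ _ (W' M) = DiffGerm.conjMap _ _ (W M)
      rw [e]
      refine (key φ (W M) hdom ?_).1
      by_cases hMN : φ :: M = N
      · left
        rw [hN] at hMN
        rw [(List.cons.inj hMN).1]
        exact hθ.symm
      · right
        exact ⟨hp0 M (hM1.trans hNL) (fun h => by rw [h] at hlenM; exact lt_irrefl _ hlenM),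
          hp0 (φ :: M) (hM.trans hNL) hMN⟩
  have hθNN : θ' :: N ≠ N := fun h => by
    have := congrArg List.length h; simp at this
  -- the point moves at the change of letter
  have hswitch : W' (θ' :: N) ≠ W (θ' :: N) := by
    have hdom : W N ∈ Q.stepDom h θ' := (mem_chainDom_of_suffix hθNL hzL).2
    have hdom' : W' N ∈ Q.stepDom h' θ' := (mem_chainDom_of_suffix hθNL hzL').2
    rw [hbefore N List.suffix_rfl] at hdom'
    change DiffGerm.conjMap _ _ (W' N) ≠ DiffGerm.conjMap _ _ (W N)
    rw [hbefore N List.suffix_rfl]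
    have hpy : p.eval (DiffGerm.conjMap (baseGerm f g θ') (conjGerm h.1 h.2 θ') (W N)) = 0 :=
      hp0 (θ' :: N) hθNL hθNN
    have e := hinv θ' rfl _ hdom.2.2 hpy
    simp only [DiffGerm.conjMap]
    rw [← e]
    intro e2
    have e3 := (Q.conj_inv h' hh'V θ').injOn (stepDom_mem_ball_inv hdom')
      (stepDom_mem_ball_inv hdom) e2
    have e4 := (Q.base θ').injOn (stepDom_mem_ball_base hdom') (stepDom_mem_ball_base hdom) e3
    rw [heval θ' rfl _ (stepDom_mem_ball hdom)] at e4
    exact mul_ne_zero ht0 hpN (add_eq_left.1 e4)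
  -- and never meets the old orbit again, the later maps being injective
  have hafter : ∀ P', P' <:+ P → W' (P' ++ θ' :: N) ≠ W (P' ++ θ' :: N) := by
    intro P'
    induction P' with
    | nil => exact fun _ => hswitch
    | cons φ P' ih =>
      intro hP'
      have hne := ih ((List.suffix_cons φ P').trans hP')
      set M := P' ++ θ' :: N with hM
      have hML : φ :: M <:+ L := by
        obtain ⟨R, hR⟩ := hP'
        exact ⟨R, by rw [hL, ← hR, hM]; simp⟩
      have hM1 : M <:+ L := (List.suffix_cons φ M).trans hML
      have hlenM : N.length < M.length := by rw [hM]; simp; omega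
      have hdom : W M ∈ Q.stepDom h φ := (mem_chainDom_of_suffix hML hzL).2
      have hdom' : W' M ∈ Q.stepDom h' φ := (mem_chainDom_of_suffix hML hzL').2
      obtain ⟨k1, k2⟩ := key φ (W M) hdom (Or.inr
        ⟨hp0 M hM1 (fun h => by rw [h] at hlenM; exact lt_irrefl _ hlenM),
          hp0 (φ :: M) hML (fun h => by
            have := congrArg List.length h
            simp only [List.length_cons] at this
            omega)⟩)
      have hdom2 : W M ∈ Q.stepDom h' φ := by
        refine ⟨hdom.1, ?_, ?_⟩
        · rw [k2]; exact hdom.2.1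
        · rw [k2]; exact hdom.2.2
      change DiffGerm.conjMap _ _ (W' M) ≠ DiffGerm.conjMap _ _ (W M)
      rw [← k1]
      exact fun e => hne (conjMap_injOn hh'V hdom' hdom2 e)
  have hfin := hafter P List.suffix_rfl
  rw [← hL, hWL] at hfin
  exact hfin (hcon _ ht1)

theorem isOpen_spellingMap_ne {A B L : List (Letter × Bool)} (hA : A <:+ L) (hB : B <:+ L)
    {O : Set (GermPair α × ℂ)} (hO : IsOpen O) (hOL : O ⊆ Q.totalDom L) :
    IsOpen {p ∈ O | spellingMap f g p.1.1 p.1.2 A p.2 ≠ spellingMap f g p.1.1 p.1.2 B p.2} := by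
  rw [isOpen_iff_mem_nhds]
  rintro ⟨h, z⟩ ⟨hp, hne⟩
  have hc : ∀ M, M <:+ L → ContinuousAt
      (fun p : GermPair α × ℂ => spellingMap f g p.1.1 p.1.2 M p.2) (h, z) := fun M hM =>
    continuousAt_spellingMap (hOL hp).1 (mem_chainDom_of_suffix hM (hOL hp).2)
  filter_upwards [hO.mem_nhds hp, ((hc A hA).sub (hc B hB)).eventually_ne (sub_ne_zero.2 hne)]
    with p h1 h2 using ⟨h1, sub_ne_zero.1 h2⟩

theorem exists_snd_ne_zero {O : Set (GermPair α × ℂ)} (hO : IsOpen O) (hne : O.Nonempty) :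
    ({p ∈ O | p.2 ≠ 0}).Nonempty := by
  obtain ⟨⟨h, z⟩, hp⟩ := hne
  have h1 : ∀ᶠ w in 𝓝[≠] z, (h, w) ∈ O := by
    have : ContinuousAt (fun w : ℂ => (h, w)) z := continuousAt_const.prodMk continuousAt_id
    exact nhdsWithin_le_nhds (this.eventually (hO.mem_nhds hp))
  by_cases hz : z = 0
  · obtain ⟨w, hw, hw0⟩ := (h1.and self_mem_nhdsWithin).exists
    exact ⟨(h, w), hw, fun e => hw0 (by rw [hz]; exact e)⟩
  · exact ⟨(h, z), hp, hz⟩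

/-- A nontrivial word differs from the identity somewhere in any nonempty open set of parameters and
points of its domain. By induction on the length of the word, the points of an orbit may be assumed
to be different, and then the word is perturbed at a change of letter. If there is no change of
letter, the word is a power and has no fixed point but `0`. -/
theorem exists_spellingMap_ne
    (hper : ∀ θ n, 1 ≤ n → baseGerm f g θ ^ n ≠ 1 →
      ∀ x : ℂ, (∀ i < n, ‖(baseGerm f g θ).eval^[i] x‖ < Q.R₀) →
        (baseGerm f g θ).eval^[n] x = x → x = 0)
    {L : List (Letter × Bool)} (hL : IsNontrivialSpelling f g L) (hne : L ≠ [])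
    {O : Set (GermPair α × ℂ)} (hO : IsOpen O) (hOne : O.Nonempty) (hOL : O ⊆ Q.totalDom L) :
    ∃ p ∈ O, spellingMap f g p.1.1 p.1.2 L p.2 ≠ p.2 := by
  induction hn : L.length using Nat.strong_induction_on generalizing L O with
  | _ n ih =>
  subst hn
  have hO₁ : IsOpen {p ∈ O | p.2 ≠ 0} :=
    hO.inter (isOpen_ne.preimage continuous_snd)
  have hne₁ := exists_snd_ne_zero hO hOne
  rcases exists_switch_or_eq_replicate hL.1 hne with ⟨P, θ', θ, N', hLe, hθ⟩ | ⟨n, θ, hn, hLe⟩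
  · set N := θ :: N' with hN
    have hNL : N <:+ L := ⟨P ++ [θ'], by rw [hLe]; simp⟩
    have hlen : N.length < L.length := by
      rw [hLe]; simp only [List.length_append, List.length_cons (a := θ')]; omega
    -- two points of the orbit generically differ: by induction, applied to the part of the word
    -- that leads from one to the other
    have hpair : ∀ A B, A <:+ B → B <:+ L → A ≠ B → B ≠ L →
        ∀ O' ⊆ O, IsOpen O' → O'.Nonempty →
          ∃ p ∈ O', spellingMap f g p.1.1 p.1.2 B p.2 ≠ spellingMap f g p.1.1 p.1.2 A p.2 := by
      rintro A B ⟨R, rfl⟩ hB hAB hBL O' hO'O hO' hne'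
      have hRne : R ≠ [] := fun h => hAB (by rw [h]; rfl)
      have hlt : (R ++ A).length < L.length :=
        lt_of_le_of_ne hB.length_le fun h => hBL (hB.eq_of_length h)
      have hR : R <:+: L := List.infix_append_left.trans hB.isInfix
      have hsub : O' ⊆ Q.totalDom (R ++ A) := fun p hp =>
        ⟨(hOL (hO'O hp)).1, mem_chainDom_of_suffix hB (hOL (hO'O hp)).2⟩
      obtain ⟨O₂, hO₂, hne₂, him⟩ := exists_open_subset_image (L := A) hO' hne' fun p hp =>
        ⟨(hsub hp).1, (mem_chainDom_append.1 (hsub hp).2).1⟩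
      obtain ⟨p, hp, hpne⟩ := ih R.length (by rw [List.length_append] at hlt; omega)
        (hL.infix hR) hRne hO₂ hne₂ (fun p hp => by
          obtain ⟨z, hz, hzp⟩ := him p hp
          have := (mem_chainDom_append.1 (hsub hz).2).2
          simp only [hzp] at this
          exact ⟨(hsub hz).1, this⟩) rfl
      obtain ⟨z, hz, hzp⟩ := him p hp
      refine ⟨(p.1, z), hz, ?_⟩
      simp only [spellingMap_append, hzp]
      exact hpne
    obtain ⟨O₂, hO₂sub, hO₂, hne₂, hdist⟩ := exists_open_forall_mem L.tails
      (fun M (p : GermPair α × ℂ) => M ≠ N → M ≠ L →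
        spellingMap f g p.1.1 p.1.2 M p.2 ≠ spellingMap f g p.1.1 p.1.2 N p.2) hO₁ hne₁ (by
      intro M hM O' hO'sub hO' hne'
      rw [List.mem_tails] at hM
      have hO'O : O' ⊆ O := fun p hp => (hO'sub hp).1
      by_cases hMN : M = N
      · exact ⟨O', Subset.rfl, hO', hne', fun y _ h => absurd hMN h⟩
      by_cases hML : M = L
      · exact ⟨O', Subset.rfl, hO', hne', fun y _ _ h => absurd hML h⟩
      refine ⟨_, sep_subset _ _, isOpen_spellingMap_ne hM hNL hO' (hO'O.trans hOL), ?_,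
        fun y hy _ _ => hy.2⟩
      rcases List.suffix_or_suffix_of_suffix hM hNL with h | h
      · obtain ⟨p, hp, hpne⟩ := hpair M N h hNL hMN
          (fun h => by rw [h] at hlen; exact lt_irrefl _ hlen) O' hO'O hO' hne'
        exact ⟨p, hp, hpne.symm⟩
      · exact hpair N M h hM (Ne.symm hMN) hML O' hO'O hO' hne')
    obtain ⟨⟨h, z⟩, hp⟩ := hne₂
    exact exists_ne_of_switch hLe hθ hO hOL (hO₂sub hp).1 (hO₂sub hp).2
      fun M hM hMN hML => hdist M ((List.mem_tails _ _).2 hM) _ hp hMN hML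
  · obtain ⟨⟨h, z⟩, hp, hz0⟩ := hne₁
    refine ⟨(h, z), hp, fun hfix => hz0 ?_⟩
    have hdom := (hOL hp).2
    simp only [hLe] at hdom hfix
    exact eq_zero_of_spellingMap_replicate (hOL hp).1 hn
      (hper θ n (Nat.one_le_iff_ne_zero.2 hn) (hL.2 n θ hn (by rw [hLe])))
      hdom hfix

end UnivalenceFrame

/-! ### Finiteness of the fixed points -/

namespace UnivalenceFrame

variable {f g : DiffGerm} {α : ℕ} (Q : UnivalenceFrame f g α)

/-- A closed domain for the map substituted for a letter. The constant `0.905` lies between the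
`9/10` of the rule for domains and the `0.91` of `stepDom`. -/
def closedStepDom (h : GermPair α) (R : ℝ) (θ : Letter × Bool) : Set ℂ :=
  {z | ‖z‖ ≤ 0.905 * Q.s θ ∧ ‖(conjGerm h.1 h.2 θ).eval z‖ ≤ R ∧
    ‖(baseGerm f g θ).eval ((conjGerm h.1 h.2 θ).eval z)‖ ≤ 0.905 * Q.s' θ}

/-- A closed domain for a composition of letters, compact and contained in `chainDom`. -/
def closedChainDom (h : GermPair α) (R : ℝ) : List (Letter × Bool) → Set ℂ
  | [] => Metric.closedBall 0 R
  | θ :: L => {z | z ∈ closedChainDom h R L ∧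
      spellingMap f g h.1 h.2 L z ∈ Q.closedStepDom h R θ}

variable {Q} {h : GermPair α} {R : ℝ}

theorem closedStepDom_subset (hR : R < Q.R₀) (θ : Letter × Bool) :
    Q.closedStepDom h R θ ⊆ Q.stepDom h θ := fun z hz =>
  ⟨hz.1.trans_lt (by have := Q.s_pos θ; nlinarith), hz.2.1.trans_lt hR,
    hz.2.2.trans_lt (by have := Q.s'_pos θ; nlinarith)⟩

theorem closedChainDom_subset (hR : R < Q.R₀) (L : List (Letter × Bool)) :
    Q.closedChainDom h R L ⊆ Q.chainDom h L := by
  induction L with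
  | nil => exact subset_univ _
  | cons θ L ih => exact fun z hz => ⟨ih hz.1, closedStepDom_subset hR θ hz.2⟩

theorem closedChainDom_subset_closedBall (L : List (Letter × Bool)) :
    Q.closedChainDom h R L ⊆ Metric.closedBall 0 R := by
  induction L with
  | nil => exact Subset.rfl
  | cons θ L ih => exact fun z hz => ih hz.1

theorem eventually_notMem_closedStepDom (hR : R < Q.R₀) (hh : h ∈ Q.V) {θ : Letter × Bool} {z : ℂ}
    (hz : z ∉ Q.closedStepDom h R θ) :
    ∀ᶠ p : GermPair α × ℂ in 𝓝 (h, z), p.2 ∉ Q.closedStepDom p.1 R θ := by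
  by_cases h1 : ‖z‖ ≤ 0.905 * Q.s θ
  · have hz1 : z ∈ Metric.ball (0 : ℂ) (Q.s θ) := by
      rw [mem_ball_zero_iff]; have := Q.s_pos θ; linarith
    by_cases h2 : ‖(conjGerm h.1 h.2 θ).eval z‖ ≤ R
    · have h3 : 0.905 * Q.s' θ < ‖(baseGerm f g θ).eval ((conjGerm h.1 h.2 θ).eval z)‖ := by
        by_contra! h3
        exact hz ⟨h1, h2, h3⟩
      have hc := (continuousAt_baseGerm_eval hh hz1 (mem_ball_zero_iff.2 (h2.trans_lt hR))).norm
      filter_upwards [hc.eventually (lt_mem_nhds h3)] with p hp hp' using absurd hp'.2.2 hp.not_ge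
    · have hc := (continuousAt_conjGerm_eval hh hz1).norm
      filter_upwards [hc.eventually (lt_mem_nhds (not_le.1 h2))] with p hp hp'
        using absurd hp'.2.1 hp.not_ge
  · have hc : ContinuousAt (fun p : GermPair α × ℂ => ‖p.2‖) (h, z) := by fun_prop
    filter_upwards [hc.eventually (lt_mem_nhds (not_le.1 h1))] with p hp hp'
      using absurd hp'.1 hp.not_ge

/-- The closed domains vary upper semicontinuously. -/
theorem eventually_notMem_closedChainDom (hR : R < Q.R₀) (hh : h ∈ Q.V)
    {L : List (Letter × Bool)} {z : ℂ} (hz : z ∉ Q.closedChainDom h R L) :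
    ∀ᶠ p : GermPair α × ℂ in 𝓝 (h, z), p.2 ∉ Q.closedChainDom p.1 R L := by
  induction L with
  | nil =>
    exact (continuousAt_snd (p := (h, z))).eventually
      (Metric.isClosed_closedBall.isOpen_compl.mem_nhds hz)
  | cons θ L ih =>
    by_cases h1 : z ∈ Q.closedChainDom h R L
    · have hc : ContinuousAt (fun p : GermPair α × ℂ =>
          (p.1, spellingMap f g p.1.1 p.1.2 L p.2)) (h, z) :=
        continuousAt_fst.prodMk (continuousAt_spellingMap hh (closedChainDom_subset hR L h1))
      have h2 : spellingMap f g h.1 h.2 L z ∉ Q.closedStepDom h R θ := fun h2 => hz ⟨h1, h2⟩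
      filter_upwards [hc.eventually (eventually_notMem_closedStepDom hR hh h2)] with p hp hp'
        using hp hp'.2
    · filter_upwards [ih h1] with p hp hp' using hp hp'.1

theorem isCompact_closedChainDom (hR : R < Q.R₀) (hh : h ∈ Q.V) (L : List (Letter × Bool)) :
    IsCompact (Q.closedChainDom h R L) := by
  refine (isCompact_closedBall (0 : ℂ) R).of_isClosed_subset ?_
    (closedChainDom_subset_closedBall L)
  rw [← isOpen_compl_iff, isOpen_iff_mem_nhds]
  intro z hz
  have hc : ContinuousAt (fun w : ℂ => (h, w)) z := continuousAt_const.prodMk continuousAt_id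
  exact hc.eventually (eventually_notMem_closedChainDom hR hh hz)

/-- On a nonempty open set of parameters, a word has finitely many fixed points in its closed
domain: cover the closed domain for one parameter by finitely many discs on which the word is
holomorphic, for all nearby parameters, and make the word different from the identity on each of
them. -/
theorem exists_open_finite_fixedPoints (hR : R < Q.R₀) (hV : Q.V.Nonempty)
    (hper : ∀ θ n, 1 ≤ n → baseGerm f g θ ^ n ≠ 1 →
      ∀ x : ℂ, (∀ i < n, ‖(baseGerm f g θ).eval^[i] x‖ < Q.R₀) →
        (baseGerm f g θ).eval^[n] x = x → x = 0)
    {L : List (Letter × Bool)} (hL : IsNontrivialSpelling f g L) (hne : L ≠ []) :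
    ∃ V ⊆ Q.V, IsOpen V ∧ V.Nonempty ∧ ∀ h ∈ V,
      {z | z ∈ Q.closedChainDom h R L ∧ spellingMap f g h.1 h.2 L z = z}.Finite := by
  obtain ⟨h₀, hh₀⟩ := hV
  set K := Q.closedChainDom h₀ R L with hK
  have hloc : ∀ z : ℂ, ∃ ε : ℝ, 0 < ε ∧ (z ∈ K → ∀ᶠ h in 𝓝 h₀, ∀ w ∈ Metric.ball z ε,
      (h, w) ∈ Q.totalDom L) := by
    intro z
    by_cases hz : z ∈ K
    · obtain ⟨A, B, hA, hB, hAh, hBz, hAB⟩ := isOpen_prod_iff.1 (isOpen_totalDom (Q := Q) L) h₀ z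
        ⟨hh₀, closedChainDom_subset hR L hz⟩
      obtain ⟨ε, hε, hεB⟩ := Metric.isOpen_iff.1 hB z hBz
      refine ⟨ε, hε, fun _ => ?_⟩
      filter_upwards [hA.mem_nhds hAh] with h hh w hw using hAB ⟨hh, hεB hw⟩
    · exact ⟨1, one_pos, fun h => absurd h hz⟩
  choose ε hε hεK using hloc
  obtain ⟨t, htK, hcover⟩ := (isCompact_closedChainDom hR hh₀ L).elim_nhds_subcover
    (fun z => Metric.ball z (ε z)) fun z _ => Metric.ball_mem_nhds z (hε z)
  have hev1 : ∀ᶠ h in 𝓝 h₀, ∀ z ∈ t, ∀ w ∈ Metric.ball z (ε z), (h, w) ∈ Q.totalDom L := by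
    rw [Finset.eventually_all]
    exact fun z hz => hεK z (htK z hz)
  have hUo : IsOpen (⋃ z ∈ t, Metric.ball z (ε z)) :=
    isOpen_biUnion fun z _ => Metric.isOpen_ball
  have hev2 : ∀ᶠ h in 𝓝 h₀, ∀ w ∈ Metric.closedBall (0 : ℂ) R \ ⋃ z ∈ t, Metric.ball z (ε z),
      w ∉ Q.closedChainDom h R L := by
    refine ((isCompact_closedBall (0 : ℂ) R).diff hUo).eventually_forall_of_forall_eventually
      (P := fun h w => w ∉ Q.closedChainDom h R L) fun w hw => ?_
    exact eventually_notMem_closedChainDom hR hh₀ fun h => hw.2 (hcover h)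
  obtain ⟨V₁, hV₁sub, hV₁, hV₁h⟩ :=
    mem_nhds_iff.1 ((hev1.and hev2).and (Q.isOpen_V.mem_nhds hh₀))
  obtain ⟨V₂, hV₂sub, hV₂, hne₂, hV₂ne⟩ := exists_open_forall_mem t.toList
    (fun z (h : GermPair α) => ∃ w ∈ Metric.ball z (ε z), spellingMap f g h.1 h.2 L w ≠ w)
    hV₁ ⟨h₀, hV₁h⟩ (by
      rintro z hz V' hV'sub hV' ⟨h', hh'⟩
      rw [Finset.mem_toList] at hz
      have hsub : V' ×ˢ Metric.ball z (ε z) ⊆ Q.totalDom L := fun p hp =>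
        (hV₁sub (hV'sub hp.1)).1.1 z hz p.2 hp.2
      obtain ⟨⟨h, w⟩, hp, hpne⟩ := exists_spellingMap_ne hper hL hne
        (hV'.prod Metric.isOpen_ball) ⟨(h', z), hh', Metric.mem_ball_self (hε z)⟩ hsub
      have hc : ContinuousAt (fun p : GermPair α × ℂ => spellingMap f g p.1.1 p.1.2 L p.2) (h, w) :=
        continuousAt_spellingMap (hsub hp).1 (hsub hp).2
      have hc2 : ContinuousAt (fun k : GermPair α => (k, w)) h :=
        continuousAt_id.prodMk continuousAt_const
      have hev : ∀ᶠ k in 𝓝 h, spellingMap f g k.1 k.2 L w ≠ w :=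
        (hc.tendsto.comp hc2.tendsto).eventually_ne hpne
      obtain ⟨V'', hV''sub, hV'', hhV''⟩ := mem_nhds_iff.1 (hev.and (hV'.mem_nhds hp.1))
      exact ⟨V'', fun k hk => (hV''sub hk).2, hV'', ⟨h, hhV''⟩,
        fun k hk => ⟨w, hp.2, (hV''sub hk).1⟩⟩)
  refine ⟨V₂, fun h hh => (hV₁sub (hV₂sub hh)).2, hV₂, hne₂, fun h hh => ?_⟩
  obtain ⟨⟨hA, hB⟩, hhV⟩ := hV₁sub (hV₂sub hh)
  by_contra hinf
  obtain ⟨x, hxK, hx⟩ := Set.Infinite.exists_accPt_of_subset_isCompact hinf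
    (isCompact_closedChainDom hR hhV L) fun z hz => hz.1
  have hxU : x ∈ ⋃ z ∈ t, Metric.ball z (ε z) := by
    by_contra hxU
    exact hB x ⟨closedChainDom_subset_closedBall L hxK, hxU⟩ hxK
  obtain ⟨z, hz, hxz⟩ := mem_iUnion₂.1 hxU
  have hd : DifferentiableOn ℂ (spellingMap f g h.1 h.2 L) (Metric.ball z (ε z)) := fun w hw =>
    (differentiableAt_spellingMap (hA z hz w hw).1 (hA z hz w hw).2).differentiableWithinAt
  have hfreq : ∃ᶠ w in 𝓝[≠] x, spellingMap f g h.1 h.2 L w = id w := by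
    rw [frequently_nhdsWithin_iff]
    exact (accPt_iff_frequently.1 hx).mono fun w hw => ⟨hw.2.2, hw.1⟩
  obtain ⟨w, hw, hwne⟩ := hV₂ne z (Finset.mem_toList.2 hz) h hh
  exact hwne ((hd.analyticOnNhd Metric.isOpen_ball).eqOn_of_preconnected_of_frequently_eq
    (differentiableOn_id.analyticOnNhd Metric.isOpen_ball) (convex_ball z (ε z)).isPreconnected
    hxz hfreq hw)

end UnivalenceFrame

/-- Every nonempty open set of pairs contains the set of parameters of a frame for which the open
domains given by the `9/10` rule are contained, up to a truncation, in closed discs that are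
compactly contained in the ones of the frame. -/
theorem exists_univalenceFrame {f g : DiffGerm} {R₀ : ℝ}
    (hbase : ∀ θ, (baseGerm f g θ).UnivalentOn R₀) {α : ℕ} (C : ℝ) {V : Set (GermPair α)}
    (hV : IsOpen V) (hne : V.Nonempty) :
    ∃ Q : UnivalenceFrame f g α, Q.R₀ = R₀ ∧ Q.V ⊆ V ∧ Q.V.Nonempty ∧ ∀ h ∈ Q.V, ∀ θ,
      (∀ z ∈ (conjGerm h.1 h.2 θ).openDom, ‖z‖ ≤ C → ‖z‖ ≤ 0.905 * Q.s θ) ∧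
      (∀ z ∈ (conjGerm h.1 h.2 θ)⁻¹.openDom, ‖z‖ ≤ C → ‖z‖ ≤ 0.905 * Q.s' θ) := by
  have hlsc : ∀ (θ : Letter × Bool) (x : GermPair α) (s r : ℝ),
      (conjGerm x.1 x.2 θ).UnivalentOn s → r < s →
        ∀ᶠ x' in 𝓝 x, (conjGerm x'.1 x'.2 θ).UnivalentOn r := fun θ x s r hu hr =>
    (continuous_conjGerm θ).continuousAt.eventually (DiffGerm.eventually_univalentOn hu hr)
  have hlsc' : ∀ (θ : Letter × Bool) (x : GermPair α) (s r : ℝ),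
      (conjGerm x.1 x.2 θ)⁻¹.UnivalentOn s → r < s →
        ∀ᶠ x' in 𝓝 x, (conjGerm x'.1 x'.2 θ)⁻¹.UnivalentOn r := fun θ x s r hu hr =>
    (continuous_conjGerm θ).continuousAt.eventually
      ((DiffGerm.eventually_inv_univalentOn hu hr one_pos).mono fun _ h => h.1)
  obtain ⟨V₁, hV₁s, hV₁, hne₁, s₁, hs₁, h₁⟩ := DiffGerm.exists_uniform_radius
    (fun h : GermPair α => conjGerm h.1 h.2 (.a, true)) (hlsc _) C hV hne
  obtain ⟨V₂, hV₂s, hV₂, hne₂, s₂, hs₂, h₂⟩ := DiffGerm.exists_uniform_radius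
    (fun h : GermPair α => conjGerm h.1 h.2 (.b, true)) (hlsc _) C hV₁ hne₁
  obtain ⟨V₃, hV₃s, hV₃, hne₃, s₃, hs₃, h₃⟩ := DiffGerm.exists_uniform_radius
    (fun h : GermPair α => (conjGerm h.1 h.2 (.a, true))⁻¹) (hlsc' _) C hV₂ hne₂
  obtain ⟨V₄, hV₄s, hV₄, hne₄, s₄, hs₄, h₄⟩ := DiffGerm.exists_uniform_radius
    (fun h : GermPair α => (conjGerm h.1 h.2 (.b, true))⁻¹) (hlsc' _) C hV₃ hne₃
  let s : Letter × Bool → ℝ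
    | (.a, _) => s₁
    | (.b, _) => s₂
  let s' : Letter × Bool → ℝ
    | (.a, _) => s₃
    | (.b, _) => s₄
  have e₃ : ∀ h ∈ V₄, h ∈ V₃ := fun h hh => hV₄s hh
  have e₂ : ∀ h ∈ V₄, h ∈ V₂ := fun h hh => hV₃s (e₃ h hh)
  have e₁ : ∀ h ∈ V₄, h ∈ V₁ := fun h hh => hV₂s (e₂ h hh)
  refine ⟨⟨V₄, hV₄, R₀, s, s', ?_, ?_, hbase, ?_, ?_⟩, rfl, fun h hh => hV₁s (e₁ h hh), hne₄, ?_⟩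
  · rintro ⟨_ | _, b⟩
    exacts [hs₁, hs₂]
  · rintro ⟨_ | _, b⟩
    exacts [hs₃, hs₄]
  · rintro h hh ⟨_ | _, b⟩
    exacts [(h₁ h (e₁ h hh)).1, (h₂ h (e₂ h hh)).1]
  · rintro h hh ⟨_ | _, b⟩
    exacts [(h₃ h (e₃ h hh)).1, (h₄ h hh).1]
  · rintro h hh ⟨_ | _, b⟩
    exacts [⟨(h₁ h (e₁ h hh)).2, (h₃ h (e₃ h hh)).2⟩, ⟨(h₂ h (e₂ h hh)).2, (h₄ h hh).2⟩]

theorem UnivalenceFrame.spellingDom_subset {f g : DiffGerm} {α : ℕ} {Q : UnivalenceFrame f g α}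
    {C R : ℝ} {h : GermPair α} (hCR : R ≤ C)
    (hC : ∀ θ, ∀ z ∈ Metric.ball (0 : ℂ) R, ‖(baseGerm f g θ).eval z‖ ≤ C)
    (hdom : ∀ θ, (∀ z ∈ (conjGerm h.1 h.2 θ).openDom, ‖z‖ ≤ C → ‖z‖ ≤ 0.905 * Q.s θ) ∧
      (∀ z ∈ (conjGerm h.1 h.2 θ)⁻¹.openDom, ‖z‖ ≤ C → ‖z‖ ≤ 0.905 * Q.s' θ))
    (L : List (Letter × Bool)) :
    spellingDom (Metric.ball 0 R) f g h.1 h.2 L ⊆ Q.closedChainDom h R L := by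
  induction L with
  | nil => exact Metric.ball_subset_closedBall
  | cons θ L ih =>
    rintro z ⟨hz, hzD, hz1, hz2, hz3⟩
    refine ⟨ih hz, (hdom θ).1 _ hz1 ?_, (mem_ball_zero_iff.1 hz2).le, (hdom θ).2 _ hz3 (hC θ _ hz2)⟩
    exact (mem_ball_zero_iff.1 hzD).le.trans hCR

theorem mainTheorem4 (f g : DiffGerm) (hf : ¬ f.HasCremerPoint) (hg : ¬ g.HasCremerPoint) :
    ∃ R₀ : ℝ, 0 < R₀ ∧
      (f.UnivalentOn R₀ ∧ f⁻¹.UnivalentOn R₀ ∧ g.UnivalentOn R₀ ∧ g⁻¹.UnivalentOn R₀) ∧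
      ∀ R : ℝ, 0 < R → R < R₀ →
        ∀ (α : ℕ) (W : Word), W ≠ [] → W.IsReduced f g →
          ∃ U : Set (DiffGerm.tangentToId α × DiffGerm.tangentToId α),
            IsOpen U ∧ Dense U ∧
              ∀ h ∈ U, (wordFixedPoints (Metric.ball 0 R) f g h.1 h.2 W).Finite := by
  have hcremer : ∀ θ, ¬ (baseGerm f g θ).HasCremerPoint := by
    rintro ⟨_ | _, _ | _⟩
    exacts [DiffGerm.not_hasCremerPoint_inv hf, hf, DiffGerm.not_hasCremerPoint_inv hg, hg]
  choose r hr hur using fun θ => (baseGerm f g θ).exists_univalentOn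
  choose r' hr' hper using fun θ => (baseGerm f g θ).exists_radius_no_periodic (hcremer θ)
  obtain ⟨R₀, hR₀, hR₀le⟩ : ∃ R₀ : ℝ, 0 < R₀ ∧ ∀ θ, R₀ ≤ r θ ∧ R₀ ≤ r' θ := by
    have hpos : ∀ θ, 0 < min (r θ) (r' θ) := fun θ => lt_min (hr θ) (hr' θ)
    refine ⟨min (min (min (r (.a, true)) (r' (.a, true))) (min (r (.a, false)) (r' (.a, false))))
      (min (min (r (.b, true)) (r' (.b, true))) (min (r (.b, false)) (r' (.b, false)))),
      lt_min (lt_min (hpos _) (hpos _)) (lt_min (hpos _) (hpos _)), ?_⟩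
    rintro ⟨_ | _, _ | _⟩ <;> simp
  have hbase : ∀ θ, (baseGerm f g θ).UnivalentOn R₀ := fun θ => (hur θ).mono (hR₀le θ).1
  refine ⟨R₀, hR₀, ⟨hbase (.a, true), hbase (.a, false), hbase (.b, true), hbase (.b, false)⟩,
    fun R hR hRR₀ α W hne hW => ?_⟩
  -- a bound for the base germs on the disc of radius `R`
  have hbound : ∀ θ, ∃ C, ∀ z ∈ Metric.ball (0 : ℂ) R, ‖(baseGerm f g θ).eval z‖ ≤ C := by
    intro θ
    obtain ⟨C, hC⟩ := (isCompact_closedBall (0 : ℂ) R).exists_bound_of_continuousOn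
      ((hbase θ).differentiableOn.continuousOn.mono (Metric.closedBall_subset_ball hRR₀))
    exact ⟨C, fun z hz => hC z (Metric.ball_subset_closedBall hz)⟩
  choose c hc using hbound
  obtain ⟨C, hCR, hC⟩ : ∃ C : ℝ, R ≤ C ∧ ∀ θ, c θ ≤ C := by
    refine ⟨max R (max (max (c (.a, true)) (c (.a, false))) (max (c (.b, true)) (c (.b, false)))),
      le_max_left _ _, ?_⟩
    rintro ⟨_ | _, _ | _⟩ <;> simp
  let G : Set (GermPair α) := {h | (wordFixedPoints (Metric.ball 0 R) f g h.1 h.2 W).Finite}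
  have hG : ∀ h ∈ interior G, h ∈ G := fun h hh => interior_subset hh
  refine ⟨interior G, isOpen_interior, ?_, fun h hh => hG h hh⟩
  rw [dense_iff_inter_open]
  intro V hV hVne
  obtain ⟨Q, hQR, hQV, hQne, hQ⟩ := exists_univalenceFrame hbase C hV hVne
  have hRQ : R < Q.R₀ := by rw [hQR]; exact hRR₀
  obtain ⟨V', hV'sub, hV', ⟨h, hh⟩, hfin⟩ := UnivalenceFrame.exists_open_finite_fixedPoints hRQ hQne
    (fun θ n hn hpow x horb => hper θ n hn hpow x fun i hi =>
      (horb i hi).trans_le (by rw [hQR]; exact (hR₀le θ).2))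
    hW.isNontrivialSpelling (Word.spelling_ne_nil hW hne)
  refine ⟨h, hQV (hV'sub hh), mem_interior.2 ⟨V', fun k hk => ?_, hV', hh⟩⟩
  refine (hfin k hk).subset fun z hz => ⟨?_, hz.2⟩
  have hkV := hV'sub hk
  exact closure_minimal (UnivalenceFrame.spellingDom_subset hCR
    (fun θ z hz => (hc θ z hz).trans (hC θ)) (hQ k hkV) _)
    (UnivalenceFrame.isCompact_closedChainDom hRQ hkV _).isClosed hz.1

end
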